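/- Let $M$ be a smooth manifold, let $A\to M$ be a Lie algebroid with anchor $\rho$ and bracket $[\cdot,\cdot]$, and let $E\to M$ be a smooth real vector bundle of rank $k$. An $A$-connection on $E$ is a map $\nabla\colon\Gamma(A)\times\Gamma(E)\to\Gamma(E)$ that is $C^\infty(M)$-linear in the first argument, $\mathbb R$-linear in the second, and satisfies $\nabla_a(fe)=f\nabla_ae+\rho(a)(f)\,e$; its curvature is $R_\nabla\in\Omega^2(A;\operatorname{End}E)$, $R_\nabla(a,b)=\nabla_a\nabla_b-\nabla_b\nabla_a-\nabla_{[a,b]}$, and $R_\nabla^i\in\Omega^{2i}(A;\operatorname{End}E)$ is its $i$-th power with respect to the wedge product combined with the composition of endomorphisms. The forms $\operatorname{tr}(R_\nabla^i)\in\Omega^{2i}(A)$, $i\ge1$, are closed, and $\operatorname{Pont}_A(E)\subseteq H^\bullet(A)$ denotes the $\mathbb R$-subalgebra generated by the classes $[\operatorname{tr}(R_\nabla^i)]$, $i\geq 1$ (which do not depend on the choice of the $A$-connection $\nabla$); $\operatorname{Pont}^l_A(E)\subseteq H^l(A)$ is its part of degree $l$. Theorem. Let $B\subseteq A$ be a Lie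 subalgebroid over $M$ of codimension $q$, that is, $\operatorname{rank}A-\operatorname{rank}B=q$, and suppose that $E$ carries a flat $B$-connection $\nabla^B\colon\Gamma(B)\times\Gamma(E)\to\Gamma(E)$. Then: 1. $\nabla^B$ extends to an $A$-connection on $E$, i.e. there is an $A$-connection $\nabla$ on $E$ with $\nabla_be=\nabla^B_be$ for all $b\in\Gamma(B)$, $e\in\Gamma(E)$. 2. For every $A$-connection $\nabla$ on $E$ that extends $\nabla^B$ and every homogeneous polynomial $p$ of degree $d>q$ on $\mathfrak{gl}(k,\mathbb R)$ that is invariant under conjugation by $\mathrm{GL}(k,\mathbb R)$, the form $p(R_\nabla)\in\Omega^{2d}(A)$ is zero. In particular, every wedge product of forms $\operatorname{tr}(R_\nabla^i)$, $i\geq 1$, of total degree $l>2q$ is zero. 3. For every $A$-connection $\nabla$ on $E$, all wedge products of the forms $\operatorname{tr}(R_\nabla^i)$, $i\ge1$, are closed, and $\operatorname{Pont}^l_A(E)=0$ for all $l>2q$. (This generalises Bott's vanishing theorem: for $A=TM$, an involutive subbundle $B=F_M\subseteq TM$ and $E=TM/F_M$ with its Bott connection, one recovers that theorem.) -/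

import Mathlib

open Bundle Module Filter
open scoped Manifold ContDiff Topology Matrix

noncomputable section

/-! ### Smooth functions and the module of smooth sections -/

section Sections

variable {EM : Type*} [NormedAddCommGroup EM] [NormedSpace ℝ EM]
  {H : Type*} [TopologicalSpace H]

/-- The ring `C^∞(M)` of smooth real functions on `M`. -/
abbrev SmoothFun (I : ModelWithCorners ℝ EM H) (M : Type*) [TopologicalSpace M]
    [ChartedSpace H M] : Type _ :=
  C^∞⟮I, M; 𝓘(ℝ, ℝ), ℝ⟯

variable {I : ModelWithCorners ℝ EM H} {M : Type*} [TopologicalSpace M] [ChartedSpace H M]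
  {F : Type*} [NormedAddCommGroup F] [NormedSpace ℝ F]
  {V : M → Type*} [TopologicalSpace (TotalSpace F V)]
  [∀ x, AddCommGroup (V x)] [∀ x, Module ℝ (V x)] [∀ x, TopologicalSpace (V x)]
  [FiberBundle F V] [VectorBundle ℝ F V]

/-- Smooth sections of a vector bundle can be multiplied pointwise by smooth functions. -/
instance ContMDiffSection.smulSmoothFun : SMul (SmoothFun I M) Cₛ^∞⟮I; F, V⟯ :=
  ⟨fun f s ↦ ⟨fun x ↦ f x • s x, f.contMDiff.smul_section s.contMDiff⟩⟩

@[simp]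
theorem ContMDiffSection.smulSmoothFun_apply (f : SmoothFun I M) (s : Cₛ^∞⟮I; F, V⟯) (x : M) :
    (f • s) x = f x • s x :=
  rfl

/-- The smooth sections of a vector bundle form a module over `C^∞(M)`. -/
instance ContMDiffSection.moduleSmoothFun : Module (SmoothFun I M) Cₛ^∞⟮I; F, V⟯ where
  one_smul s := by ext x; exact one_smul ℝ (s x)
  mul_smul f g s := by ext x; exact mul_smul (f x) (g x) (s x)
  smul_zero f := by ext x; exact smul_zero (f x)
  smul_add f s t := by ext x; exact smul_add (f x) (s x) (t x)
  add_smul f g s := by ext x; exact add_smul (f x) (g x) (s x)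
  zero_smul s := by ext x; exact zero_smul ℝ (s x)

instance ContMDiffSection.isScalarTowerSmoothFun :
    IsScalarTower ℝ (SmoothFun I M) Cₛ^∞⟮I; F, V⟯ where
  smul_assoc c f s := by ext x; exact smul_assoc c (f x) (s x)

instance ContMDiffSection.smulCommClassSmoothFun :
    SMulCommClass ℝ (SmoothFun I M) Cₛ^∞⟮I; F, V⟯ where
  smul_comm c f s := by ext x; exact smul_comm c (f x) (s x)

theorem ContMDiffSection.finsetSum_apply {ι : Type*} (t : Finset ι) (s : ι → Cₛ^∞⟮I; F, V⟯)
    (x : M) : (∑ i ∈ t, s i) x = ∑ i ∈ t, s i x := by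
  have h := congrFun (map_sum (ContMDiffSection.coeAddHom I F ∞ V) s t) x
  rwa [Finset.sum_apply] at h

/-- The derivative `X(f)` of a smooth function `f` along a smooth vector field `X`. -/
def smoothLieDeriv [IsManifold I ∞ M] (X : Cₛ^∞⟮I; EM, (TangentSpace I : M → Type _)⟯)
    (f : SmoothFun I M) : SmoothFun I M :=
  ⟨fun x ↦ mvfderiv I f x (X x), by
    have h1 : ContMDiff I.tangent 𝓘(ℝ, ℝ).tangent ∞ (tangentMap I 𝓘(ℝ, ℝ) f) :=
      f.contMDiff.contMDiff_tangentMap (by simp)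
    have h2 := h1.comp X.contMDiff
    intro x
    have h3 := (contMDiffAt_totalSpace.1 (h2 x)).2
    refine h3.congr_of_eventuallyEq (Eventually.of_forall fun y ↦ ?_)
    simp [mvfderiv, tangentMap]
    rfl⟩

end Sections

/-! ### Endomorphisms of a vector bundle: fibre maps and trace

`Γ(End V)` is the module of `C^∞(M)`-linear endomorphisms of `Γ(V)`. -/

section FibreMaps

variable {EM : Type*} [NormedAddCommGroup EM] [NormedSpace ℝ EM] [FiniteDimensional ℝ EM]
  {H : Type*} [TopologicalSpace H]
  {I : ModelWithCorners ℝ EM H} {M : Type*} [TopologicalSpace M] [ChartedSpace H M]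
  [IsManifold I ∞ M] [T2Space M]
  {F : Type*} [NormedAddCommGroup F] [NormedSpace ℝ F] [FiniteDimensional ℝ F]
  {V : M → Type*} [TopologicalSpace (TotalSpace F V)]
  [∀ x, AddCommGroup (V x)] [∀ x, Module ℝ (V x)] [∀ x, TopologicalSpace (V x)]
  [FiberBundle F V] [VectorBundle ℝ F V] [ContMDiffVectorBundle ∞ F V I]

/-- Near every point there is a smooth local frame made of globally defined smooth sections, with
globally defined coefficient functionals. -/
theorem exists_globalFrame (x₀ : M) :
    ∃ (s : Fin (finrank ℝ F) → Cₛ^∞⟮I; F, V⟯)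
      (c : Fin (finrank ℝ F) → Cₛ^∞⟮I; F, V⟯ → SmoothFun I M)
      (ψ : SmoothFun I M), ∃ U ∈ 𝓝 x₀, (∀ x ∈ U, ψ x = 1) ∧
        (∀ e : Cₛ^∞⟮I; F, V⟯, ψ • e = ∑ i, c i e • s i) ∧
        (∀ e x, e x = 0 → ∀ i, c i e x = 0) ∧
        ∀ x ∈ U, ∃ b : Basis (Fin (finrank ℝ F)) ℝ (V x),
          (∀ i, b i = s i x) ∧ ∀ e i, b.repr (e x) i = c i e x := by
  classical
  let t := trivializationAt F V x₀
  have hx₀ : x₀ ∈ t.baseSet := FiberBundle.mem_baseSet_trivializationAt' x₀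
  have : ContMDiffVectorBundle 1 F V I :=
    ContMDiffVectorBundle.of_le (n := ∞) (by simp)
  let b₀ : Basis (Fin (finrank ℝ F)) ℝ F := finBasis ℝ F
  obtain ⟨f, -, hf⟩ := (SmoothBumpFunction.nhds_basis_tsupport (I := I) x₀).mem_iff.1
    (t.open_baseSet.mem_nhds hx₀)
  have hfs : ∀ x, x ∉ t.baseSet → f x = 0 := fun x hx ↦
    image_eq_zero_of_notMem_tsupport fun h ↦ hx (hf h)
  let s : Fin (finrank ℝ F) → Cₛ^∞⟮I; F, V⟯ := fun i ↦
    ⟨(f : M → ℝ) • t.localFrame b₀ i,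
      ContMDiffOn.smul_section_of_tsupport f.contMDiff.contMDiffOn t.open_baseSet hf
        (t.contMDiffOn_localFrame_baseSet ∞ b₀ i)⟩
  let c : Fin (finrank ℝ F) → Cₛ^∞⟮I; F, V⟯ → SmoothFun I M := fun i e ↦
    ⟨fun x ↦ f x * t.localFrameCoeff I b₀ i x (e x), by
      refine contMDiff_of_tsupport fun x hx ↦ ?_
      have hx' : x ∈ t.baseSet := hf (tsupport_mul_subset_left hx)
      exact f.contMDiff.contMDiffAt.mul
        (contMDiffAt_localFrameCoeff b₀ hx' e.contMDiff.contMDiffAt i)⟩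
  let ψ : SmoothFun I M := ⟨fun x ↦ f x * f x, f.contMDiff.mul f.contMDiff⟩
  refine ⟨s, c, ψ, t.baseSet ∩ {x | f x = 1},
    inter_mem (t.open_baseSet.mem_nhds hx₀) f.eventuallyEq_one, ?_, ?_, ?_, ?_⟩
  · rintro x ⟨-, hx : f x = 1⟩
    change f x * f x = 1
    simp [hx]
  · intro e
    ext x
    rw [ContMDiffSection.finsetSum_apply]
    change (f x * f x) • e x = ∑ i, (f x * t.localFrameCoeff I b₀ i x (e x)) •
      (f x • t.localFrame b₀ i x)
    by_cases hx : x ∈ t.baseSet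
    · conv_lhs => rw [t.eq_sum_localFrameCoeff_smul (I := I) (b := b₀) (s := e) hx]
      rw [Finset.smul_sum]
      refine Finset.sum_congr rfl fun i _ ↦ ?_
      simp only [smul_smul]
      congr 1
      ring
    · simp [hfs x hx]
  · intro e x hx i
    change f x * t.localFrameCoeff I b₀ i x (e x) = 0
    simp [hx]
  · rintro x ⟨hx, hx1 : f x = 1⟩
    refine ⟨t.basisAt b₀ hx, fun i ↦ ?_, fun e i ↦ ?_⟩
    · change _ = f x • t.localFrame b₀ i x
      simp [hx1, hx]
    · change _ = f x * t.localFrameCoeff I b₀ i x (e x)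
      rw [hx1, one_mul, t.localFrameCoeff_apply_of_mem_baseSet b₀ hx (fun y ↦ e y) i]

/-- Every vector in a fibre is the value of a smooth section. -/
theorem exists_section_apply_eq (x : M) (v : V x) : ∃ e : Cₛ^∞⟮I; F, V⟯, e x = v := by
  obtain ⟨s, c, ψ, U, hU, -, -, -, hb⟩ := exists_globalFrame (I := I) (F := F) (V := V) x
  obtain ⟨b, hbs, -⟩ := hb x (mem_of_mem_nhds hU)
  refine ⟨∑ i, b.repr v i • s i, ?_⟩
  rw [ContMDiffSection.finsetSum_apply]
  conv_rhs => rw [← b.sum_repr v]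
  simp [hbs]

/-- `C^∞(M)`-linear endomorphisms of `Γ(V)` act pointwise. -/
theorem endSection_apply_eq_zero (φ : Module.End (SmoothFun I M) Cₛ^∞⟮I; F, V⟯) {x : M}
    {e : Cₛ^∞⟮I; F, V⟯} (he : e x = 0) : φ e x = 0 := by
  obtain ⟨s, c, ψ, U, hU, hψ, hsum, hc, -⟩ := exists_globalFrame (I := I) (F := F) (V := V) x
  have h1 : φ (ψ • e) = ∑ i, c i e • φ (s i) := by
    rw [hsum, map_sum]; simp
  have h2 := congrArg (fun t : Cₛ^∞⟮I; F, V⟯ ↦ t x) h1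
  simp only [map_smul, ContMDiffSection.smulSmoothFun_apply, hψ x (mem_of_mem_nhds hU),
    one_smul, ContMDiffSection.finsetSum_apply] at h2
  rw [h2]
  simp [hc e x he]

/-- The endomorphism `φ_x` of the fibre `V x` induced by a `C^∞(M)`-linear endomorphism `φ` of
`Γ(V)`; it is characterised by `φ_x (e x) = (φ e) x`. -/
def fibreMap (x : M) (φ : Module.End (SmoothFun I M) Cₛ^∞⟮I; F, V⟯) : Module.End ℝ (V x) where
  toFun v := φ (exists_section_apply_eq (I := I) (F := F) x v).choose x
  map_add' v w := by
    have hv := (exists_section_apply_eq (I := I) (F := F) x v).choose_spec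
    have hw := (exists_section_apply_eq (I := I) (F := F) x w).choose_spec
    have hvw := (exists_section_apply_eq (I := I) (F := F) x (v + w)).choose_spec
    set e₁ := (exists_section_apply_eq (I := I) (F := F) x v).choose
    set e₂ := (exists_section_apply_eq (I := I) (F := F) x w).choose
    set e₃ := (exists_section_apply_eq (I := I) (F := F) x (v + w)).choose
    have := endSection_apply_eq_zero φ (x := x) (e := e₃ - (e₁ + e₂)) (by simp [hv, hw, hvw])
    simpa [sub_eq_zero] using this
  map_smul' r v := by
    have hv := (exists_section_apply_eq (I := I) (F := F) x v).choose_spec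
    have hw := (exists_section_apply_eq (I := I) (F := F) x (r • v)).choose_spec
    set e₁ := (exists_section_apply_eq (I := I) (F := F) x v).choose
    set e₂ := (exists_section_apply_eq (I := I) (F := F) x (r • v)).choose
    have := endSection_apply_eq_zero φ (x := x) (e := e₂ - r • e₁) (by simp [hv, hw])
    have h : φ (r • e₁) = r • φ e₁ := φ.map_smul_of_tower r e₁
    simpa [sub_eq_zero, h] using this

theorem fibreMap_apply (φ : Module.End (SmoothFun I M) Cₛ^∞⟮I; F, V⟯) (x : M)
    (e : Cₛ^∞⟮I; F, V⟯) : fibreMap x φ (e x) = φ e x := by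
  have hv := (exists_section_apply_eq (I := I) (F := F) x (e x)).choose_spec
  have := endSection_apply_eq_zero φ (x := x)
    (e := (exists_section_apply_eq (I := I) (F := F) x (e x)).choose - e) (by simp [hv])
  rw [map_sub, ContMDiffSection.coe_sub, Pi.sub_apply, sub_eq_zero] at this
  exact this

/-- The fibrewise trace `tr : Γ(End V) → C^∞(M)`. -/
def bundleTrace : Module.End (SmoothFun I M) Cₛ^∞⟮I; F, V⟯ →ₗ[SmoothFun I M] SmoothFun I M where
  toFun φ := ⟨fun x ↦ LinearMap.trace ℝ (V x) (fibreMap x φ), by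
    intro x₀
    obtain ⟨s, c, ψ, U, hU, -, -, -, hb⟩ := exists_globalFrame (I := I) (F := F) (V := V) x₀
    have hsm : ContMDiffAt I 𝓘(ℝ, ℝ) ∞ (fun x ↦ (∑ i, c i (φ (s i))) x) x₀ :=
      (∑ i, c i (φ (s i))).contMDiff.contMDiffAt
    refine hsm.congr_of_eventuallyEq ?_
    filter_upwards [hU] with x hx
    obtain ⟨b, hbs, hbc⟩ := hb x hx
    have hsum : (∑ i, c i (φ (s i))) x = ∑ i, c i (φ (s i)) x :=
      map_sum (ContMDiffMap.evalRingHom (I := I) (n := ∞) (R := ℝ) (I' := 𝓘(ℝ, ℝ)) x)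
        (fun i ↦ c i (φ (s i))) Finset.univ
    rw [LinearMap.trace_eq_matrix_trace ℝ b, hsum, Matrix.trace]
    refine Finset.sum_congr rfl fun i _ ↦ ?_
    rw [Matrix.diag_apply, LinearMap.toMatrix_apply, hbs, fibreMap_apply, hbc]⟩
  map_add' φ χ := by
    ext x
    have : fibreMap x (φ + χ) = fibreMap x φ + fibreMap x χ := by
      ext v
      obtain ⟨e, rfl⟩ := exists_section_apply_eq (I := I) (F := F) x v
      simp [fibreMap_apply]
    change LinearMap.trace ℝ (V x) (fibreMap x (φ + χ)) =
      LinearMap.trace ℝ (V x) (fibreMap x φ) + LinearMap.trace ℝ (V x) (fibreMap x χ)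
    rw [this, map_add]
  map_smul' f φ := by
    ext x
    have : fibreMap x (f • φ) = f x • fibreMap x φ := by
      ext v
      obtain ⟨e, rfl⟩ := exists_section_apply_eq (I := I) (F := F) x v
      simp [fibreMap_apply]
    change LinearMap.trace ℝ (V x) (fibreMap x (f • φ)) =
      f x * LinearMap.trace ℝ (V x) (fibreMap x φ)
    rw [this, map_smul, smul_eq_mul]

end FibreMaps

/-! ### The Koszul formula -/

namespace LieAlgebroid

section Koszul

variable {C Γ : Type*} [CommRing C] [Algebra ℝ C] [AddCommGroup Γ] [Module C Γ]

/-- The Koszul formula, for a bracket `br` on `Γ` and an action `ρ` of `Γ` on `C`: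
`∑ i, (-1)^i ρ(v i)(w(v 0, …, v̂ i, …, v n))
  - ∑ i < j, (-1)^i w(v 0, …, v̂ i, …, br (v i) (v j), …, v n)`,
where `br (v i) (v j)` stands at the place of `v j`. Moving it to the first place costs the sign
`(-1)^(j-1)`, so this is the usual
`∑ i, (-1)^i ρ(v i)(w(…, v̂ i, …)) + ∑ i < j, (-1)^(i+j) w(br (v i) (v j), …, v̂ i, …, v̂ j, …)`. -/
def koszulFormula (br : Γ → Γ → Γ) (ρ : Γ → C → C) {n : ℕ} (w : Γ [⋀^Fin n]→ₗ[C] C)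
    (v : Fin (n + 1) → Γ) : C :=
  ∑ i : Fin (n + 1), (-1) ^ (i : ℕ) * ρ (v i) (w (i.removeNth v)) -
    ∑ i : Fin (n + 1), ∑ j ∈ Finset.Ioi i,
      (-1) ^ (i : ℕ) * w (i.removeNth (Function.update v j (br (v i) (v j))))

variable {n : ℕ} (w : Γ [⋀^Fin n]→ₗ[C] C)

theorem removeNth_update_self {n : ℕ} (v : Fin (n + 1) → Γ) (k : Fin (n + 1)) (x : Γ) :
    k.removeNth (Function.update v k x) = k.removeNth v := by
  ext i
  simp [Fin.removeNth]

theorem removeNth_update_ne {n : ℕ} {i k : Fin (n + 1)} (h : k ≠ i) :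
    ∃ k' : Fin n, ∀ (v : Fin (n + 1) → Γ) (x : Γ),
      i.removeNth (Function.update v k x) = Function.update (i.removeNth v) k' x := by
  obtain ⟨k', rfl⟩ := Fin.exists_succAbove_eq h
  refine ⟨k', fun v x ↦ ?_⟩
  ext j
  rcases eq_or_ne j k' with rfl | hj
  · simp [Fin.removeNth]
  · have : i.succAbove j ≠ i.succAbove k' := fun h ↦ hj (Fin.succAbove_right_injective h)
    simp [Fin.removeNth, hj, this]

theorem map_removeNth_add {i k : Fin (n + 1)} (h : k ≠ i) (v : Fin (n + 1) → Γ)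
    (x y : Γ) : w (i.removeNth (Function.update v k (x + y))) =
      w (i.removeNth (Function.update v k x)) + w (i.removeNth (Function.update v k y)) := by
  obtain ⟨k', hk⟩ := removeNth_update_ne (Γ := Γ) h
  simp [hk]

theorem map_removeNth_smul {i k : Fin (n + 1)} (h : k ≠ i) (v : Fin (n + 1) → Γ)
    (f : C) (x : Γ) : w (i.removeNth (Function.update v k (f • x))) =
      f * w (i.removeNth (Function.update v k x)) := by
  obtain ⟨k', hk⟩ := removeNth_update_ne (Γ := Γ) h
  simp [hk]

theorem removeNth_swap_sign {i k : Fin (n + 1)} (h : k ≠ i) (v : Fin (n + 1) → Γ)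
    (x : Γ) : (-1) ^ (k : ℕ) * w (k.removeNth (Function.update v i x)) =
      -((-1) ^ (i : ℕ) * w (i.removeNth (Function.update v k x))) := by
  have := w.neg_one_pow_smul_map_removeNth_add_eq_zero_of_eq
    (v := Function.update (Function.update v i x) k x) (i := k) (j := i) (by simp [h.symm]) h
  rw [removeNth_update_self, Function.update_comm h.symm, removeNth_update_self] at this
  rw [eq_neg_iff_add_eq_zero]
  simpa [zsmul_eq_mul] using this

/-- The bracket term of the Koszul formula. -/
def koszulTerm (br : Γ → Γ → Γ) (v : Fin (n + 1) → Γ) (i j : Fin (n + 1)) : C :=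
  (-1) ^ (i : ℕ) * w (i.removeNth (Function.update v j (br (v i) (v j))))

theorem koszulTerm_symm {br : Γ → Γ → Γ} (anti : ∀ a b, br a b = -br b a)
    (v : Fin (n + 1) → Γ) {i j : Fin (n + 1)} (h : i ≠ j) :
    koszulTerm w br v i j = koszulTerm w br v j i := by
  unfold koszulTerm
  have h1 := map_removeNth_smul w h v (-1) (br (v i) (v j))
  rw [removeNth_swap_sign w h, anti (v j) (v i), ← neg_one_smul C (br (v i) (v j)), h1]
  ring

theorem sum_Ioi_eq (T : Fin (n + 1) → Fin (n + 1) → C)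
    (hT : ∀ i j, i ≠ j → T i j = T j i) :
    ∑ i, ∑ j ∈ Finset.Ioi i, T i j =
      algebraMap ℝ C (1 / 2) * ∑ i, ∑ j ∈ Finset.univ.erase i, T i j := by
  have h1 : ∀ i : Fin (n + 1), ∑ j ∈ Finset.univ.erase i, T i j =
      ∑ j ∈ Finset.Ioi i, T i j + ∑ j ∈ Finset.Iio i, T i j := by
    intro i
    rw [← Finset.sum_union]
    · congr 1
      ext j
      simp [lt_or_lt_iff_ne, eq_comm]
    · rw [Finset.disjoint_left]
      intro j hj hj'
      simp only [Finset.mem_Ioi, Finset.mem_Iio] at hj hj'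
      exact lt_asymm hj hj'
  have h2 : ∑ i, ∑ j ∈ Finset.Iio i, T i j = ∑ i, ∑ j ∈ Finset.Ioi i, T i j := by
    rw [Finset.sum_comm' (t' := Finset.univ) (s' := fun j ↦ Finset.Ioi j) (by simp)]
    refine Finset.sum_congr rfl fun i _ ↦ Finset.sum_congr rfl fun j hj ↦ hT _ _ ?_
    exact (Finset.mem_Ioi.1 hj).ne'
  simp only [h1, Finset.sum_add_distrib, h2]
  rw [← two_mul, ← mul_assoc]
  have : algebraMap ℝ C (1 / 2) * 2 = 1 := by
    rw [← map_ofNat (algebraMap ℝ C) 2, ← map_mul]; norm_num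
  rw [this, one_mul]

theorem koszulFormula_eq {br : Γ → Γ → Γ} (anti : ∀ a b, br a b = -br b a)
    (ρ : Γ → C → C) (v : Fin (n + 1) → Γ) :
    koszulFormula br ρ w v = ∑ i : Fin (n + 1), (-1) ^ (i : ℕ) * ρ (v i) (w (i.removeNth v)) -
      algebraMap ℝ C (1 / 2) * ∑ i, ∑ j ∈ Finset.univ.erase i, koszulTerm w br v i j := by
  rw [← sum_Ioi_eq _ fun i j h ↦ koszulTerm_symm w anti v h]
  rfl

theorem koszulFormula_update_add {br : Γ → Γ → Γ} {ρ : Γ → C → C}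
    (br_add : ∀ a b c, br a (b + c) = br a b + br a c)
    (add_br : ∀ a b c, br (a + b) c = br a c + br b c)
    (add_ρ : ∀ a b f, ρ (a + b) f = ρ a f + ρ b f)
    (ρ_add : ∀ a f g, ρ a (f + g) = ρ a f + ρ a g)
    (v : Fin (n + 1) → Γ) (k : Fin (n + 1)) (x y : Γ) :
    koszulFormula br ρ w (Function.update v k (x + y)) =
      koszulFormula br ρ w (Function.update v k x) +
        koszulFormula br ρ w (Function.update v k y) := by
  have h1 : ∀ i, ρ (Function.update v k (x + y) i) (w (i.removeNth (Function.update v k (x + y))))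
      = ρ (Function.update v k x i) (w (i.removeNth (Function.update v k x))) +
        ρ (Function.update v k y i) (w (i.removeNth (Function.update v k y))) := by
    intro i
    rcases eq_or_ne k i with rfl | h
    · simp [removeNth_update_self, add_ρ]
    · simp [Function.update_of_ne h.symm, map_removeNth_add w h, ρ_add]
  have h2 : ∀ i j, i < j → koszulTerm w br (Function.update v k (x + y)) i j =
      koszulTerm w br (Function.update v k x) i j +
        koszulTerm w br (Function.update v k y) i j := by
    intro i j hij
    unfold koszulTerm
    rw [← mul_add]
    congr 1
    rcases eq_or_ne k i with rfl | hi
    · simp only [Function.update_self, Function.update_of_ne hij.ne', add_br,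
        map_removeNth_add w hij.ne', Function.update_comm hij.ne, removeNth_update_self]
    · rcases eq_or_ne k j with rfl | hj
      · simp [Function.update_of_ne hij.ne, br_add, map_removeNth_add w hij.ne']
      · simp only [Function.update_of_ne hi.symm, Function.update_of_ne hj.symm,
          Function.update_comm hj, map_removeNth_add w hi]
  unfold koszulFormula
  simp only [h1, mul_add, Finset.sum_add_distrib]
  have h3 : ∑ i, ∑ j ∈ Finset.Ioi i, koszulTerm w br (Function.update v k (x + y)) i j =
      ∑ i, ∑ j ∈ Finset.Ioi i, koszulTerm w br (Function.update v k x) i j +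
        ∑ i, ∑ j ∈ Finset.Ioi i, koszulTerm w br (Function.update v k y) i j := by
    simp only [← Finset.sum_add_distrib]
    exact Finset.sum_congr rfl fun i _ ↦ Finset.sum_congr rfl fun j hj ↦
      h2 i j (Finset.mem_Ioi.1 hj)
  unfold koszulTerm at h3
  rw [h3]
  ring

theorem koszulFormula_update_smul {br : Γ → Γ → Γ} {ρ : Γ → C → C}
    (anti : ∀ a b, br a b = -br b a)
    (leib : ∀ a (f : C) b, br a (f • b) = f • br a b + ρ a f • b)
    (smul_ρ : ∀ (f : C) a g, ρ (f • a) g = f * ρ a g)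
    (ρ_mul : ∀ a f g, ρ a (f * g) = f * ρ a g + ρ a f * g)
    (v : Fin (n + 1) → Γ) (k : Fin (n + 1)) (f : C) (x : Γ) :
    koszulFormula br ρ w (Function.update v k (f • x)) =
      f • koszulFormula br ρ w (Function.update v k x) := by
  set G : Fin (n + 1) → C := fun i ↦
    (-1) ^ (i : ℕ) * (ρ (v i) f * w (i.removeNth (Function.update v k x))) with hG
  have h1 : ∀ i : Fin (n + 1), (-1) ^ (i : ℕ) * ρ (Function.update v k (f • x) i)
        (w (i.removeNth (Function.update v k (f • x)))) =
      f * ((-1) ^ (i : ℕ) * ρ (Function.update v k x i)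
        (w (i.removeNth (Function.update v k x)))) + if i = k then 0 else G i := by
    intro i
    rcases eq_or_ne k i with rfl | h
    · simp [removeNth_update_self, smul_ρ]; ring
    · simp [Function.update_of_ne h.symm, map_removeNth_smul w h, ρ_mul, h.symm, hG]; ring
  have leib' : ∀ (f : C) a b, br (f • a) b = f • br a b + (-ρ b f) • a := by
    intro f a b
    rw [anti, leib, anti b a, smul_neg, neg_smul, neg_add, neg_neg]
  have h2 : ∀ i j, i ≠ j → koszulTerm w br (Function.update v k (f • x)) i j =
      f * koszulTerm w br (Function.update v k x) i j +
        ((if j = k then G i else 0) + if i = k then G j else 0) := by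
    intro i j hij
    unfold koszulTerm
    rcases eq_or_ne k i with rfl | hi
    · simp only [Function.update_self, Function.update_of_ne hij.symm, leib',
        map_removeNth_add w hij.symm, map_removeNth_smul w hij.symm, Function.update_comm hij,
        removeNth_update_self, if_neg hij.symm, if_true, zero_add, hG]
      have := removeNth_swap_sign w hij v x
      linear_combination (-ρ (v j) f) * this
    · rcases eq_or_ne k j with rfl | hj
      · simp only [Function.update_self, Function.update_of_ne hij, leib,
          map_removeNth_add w hij.symm, map_removeNth_smul w hij.symm, Function.update_idem,
          if_neg hij, if_true, add_zero, hG]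
        ring
      · simp only [Function.update_of_ne hi.symm, Function.update_of_ne hj.symm,
          Function.update_comm hj, map_removeNth_smul w hi, if_neg hi.symm, if_neg hj.symm]
        ring
  rw [koszulFormula_eq w anti, koszulFormula_eq w anti]
  have h3 : ∑ i, ∑ j ∈ Finset.univ.erase i, koszulTerm w br (Function.update v k (f • x)) i j =
      f * ∑ i, ∑ j ∈ Finset.univ.erase i, koszulTerm w br (Function.update v k x) i j +
        2 * ∑ i, if i = k then 0 else G i := by
    have h4 : ∑ i, ∑ j ∈ Finset.univ.erase i, koszulTerm w br (Function.update v k (f • x)) i j =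
        ∑ i, ∑ j ∈ Finset.univ.erase i, (f * koszulTerm w br (Function.update v k x) i j +
          ((if j = k then G i else 0) + if i = k then G j else 0)) :=
      Finset.sum_congr rfl fun i _ ↦ Finset.sum_congr rfl fun j hj ↦
        h2 i j (Finset.ne_of_mem_erase hj).symm
    have h5 : ∑ i, ∑ j ∈ Finset.univ.erase i, (if j = k then G i else 0) =
        ∑ i, if i = k then 0 else G i := by
      refine Finset.sum_congr rfl fun i _ ↦ ?_
      rw [Finset.sum_ite_eq']
      by_cases h : i = k
      · simp [h]
      · simp [h, Ne.symm h]
    have h6 : ∑ i, ∑ j ∈ Finset.univ.erase i, (if i = k then G j else 0) =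
        ∑ i, if i = k then 0 else G i := by
      rw [Finset.sum_eq_single k (by intro i _ hi; simp [hi]) (by simp)]
      simp only [if_true]
      rw [← Finset.sum_erase (a := k) (f := fun i ↦ if i = k then 0 else G i) _ (by simp)]
      exact Finset.sum_congr rfl fun j hj ↦ by simp [Finset.ne_of_mem_erase hj]
    rw [h4]
    simp only [Finset.sum_add_distrib, h5, h6, ← Finset.mul_sum]
    ring
  have h7 : algebraMap ℝ C (1 / 2) * 2 = 1 := by
    rw [← map_ofNat (algebraMap ℝ C) 2, ← map_mul]; norm_num
  simp only [h1, Finset.sum_add_distrib, ← Finset.mul_sum, h3, smul_eq_mul]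
  linear_combination (-∑ i, if i = k then 0 else G i) * h7

theorem koszulFormula_eq_zero {br : Γ → Γ → Γ} {ρ : Γ → C → C}
    (anti : ∀ a b, br a b = -br b a) (br_self : ∀ a, br a a = 0) (ρ_zero : ∀ a, ρ a 0 = 0)
    (ρ_neg : ∀ a f, ρ a (-f) = -ρ a f)
    (v : Fin (n + 1) → Γ) {p q : Fin (n + 1)} (hv : v p = v q) (hpq : p ≠ q) :
    koszulFormula br ρ w v = 0 := by
  have hrem : ∀ (u : Fin (n + 1) → Γ) (i : Fin (n + 1)), i ≠ p → i ≠ q → u p = u q →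
      w (i.removeNth u) = 0 := by
    intro u i hip hiq hu
    obtain ⟨p', rfl⟩ := Fin.exists_succAbove_eq hip.symm
    obtain ⟨q', rfl⟩ := Fin.exists_succAbove_eq hiq.symm
    exact w.map_eq_zero_of_eq _ hu (fun h ↦ hpq (by rw [h]))
  have hpair : ∀ (u : Fin (n + 1) → Γ), u p = u q →
      (-1) ^ (p : ℕ) * w (p.removeNth u) = -((-1) ^ (q : ℕ) * w (q.removeNth u)) := by
    intro u hu
    have := w.neg_one_pow_smul_map_removeNth_add_eq_zero_of_eq hu hpq
    rw [eq_neg_iff_add_eq_zero]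
    simpa [zsmul_eq_mul] using this
  have hsgn : ∀ i : Fin (n + 1), (-1 : C) ^ (i : ℕ) * (-1) ^ (i : ℕ) = 1 := by
    intro i
    rw [← mul_pow]; simp
  -- the terms in which `ρ` acts
  have h1 : ∑ i : Fin (n + 1), (-1) ^ (i : ℕ) * ρ (v i) (w (i.removeNth v)) = 0 := by
    rw [Finset.sum_eq_add p q hpq]
    · have h2 := hpair v hv
      have h3 : w (p.removeNth v) = -((-1) ^ (p : ℕ) * (-1) ^ (q : ℕ) * w (q.removeNth v)) := by
        linear_combination (-1) ^ (p : ℕ) * h2 - w (p.removeNth v) * hsgn p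
      have h4 : ∀ (k : ℕ) (a : Γ) (x : C), ρ a ((-1) ^ k * x) = (-1) ^ k * ρ a x := by
        intro k a x
        rcases neg_one_pow_eq_or C k with h | h <;> simp [h, ρ_neg]
      rw [h3, hv, ρ_neg, mul_assoc, h4, h4]
      linear_combination (-(-1) ^ (q : ℕ) * ρ (v q) (w (q.removeNth v))) * hsgn p
    · rintro i - ⟨hip, hiq⟩
      rw [hrem v i hip hiq hv, ρ_zero, mul_zero]
    · simp
    · simp
  -- the terms with a bracket
  have h2 : ∀ i, i ≠ p → i ≠ q → koszulTerm w br v i p + koszulTerm w br v i q = 0 := by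
    intro i hip hiq
    unfold koszulTerm
    rw [← mul_add, hv]
    obtain ⟨p', rfl⟩ := Fin.exists_succAbove_eq hip.symm
    obtain ⟨q', rfl⟩ := Fin.exists_succAbove_eq hiq.symm
    have hpq' : p' ≠ q' := fun h ↦ hpq (by rw [h])
    have h3 : i.removeNth (Function.update v (i.succAbove q') (br (v i) (v (i.succAbove q')))) =
        i.removeNth (Function.update v (i.succAbove p') (br (v i) (v (i.succAbove q')))) ∘
          Equiv.swap p' q' := by
      ext j
      have hinj : ∀ a b, i.succAbove a = i.succAbove b ↔ a = b :=
        fun a b ↦ Fin.succAbove_right_injective.eq_iff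
      simp only [Fin.removeNth, Function.comp_apply]
      rcases eq_or_ne j p' with rfl | hjp
      · rw [Equiv.swap_apply_left, Function.update_of_ne (by simpa [hinj] using hpq'),
          Function.update_of_ne (by simpa [hinj] using hpq'.symm), hv]
      · rcases eq_or_ne j q' with rfl | hjq
        · simp
        · rw [Equiv.swap_apply_of_ne_of_ne hjp hjq, Function.update_of_ne (by simpa [hinj]),
            Function.update_of_ne (by simpa [hinj])]
    rw [h3, w.map_swap _ hpq']
    ring
  have h3 : ∀ i j, i ≠ j → i ≠ p → i ≠ q → j ≠ p → j ≠ q → koszulTerm w br v i j = 0 := by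
    intro i j hij hip hiq hjp hjq
    unfold koszulTerm
    rw [hrem _ i hip hiq, mul_zero]
    rw [Function.update_of_ne hjp.symm, Function.update_of_ne hjq.symm, hv]
  have h4 : koszulTerm w br v p q = 0 := by
    unfold koszulTerm
    rw [hv, br_self]
    obtain ⟨k', hk⟩ := removeNth_update_ne (Γ := Γ) hpq.symm
    rw [hk, w.map_update_zero, mul_zero]
  have h5 : ∀ i, i ≠ p → i ≠ q → ∑ j ∈ Finset.univ.erase i, koszulTerm w br v i j = 0 := by
    intro i hip hiq
    rw [Finset.sum_eq_add p q hpq]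
    · exact h2 i hip hiq
    · rintro j hj ⟨hjp, hjq⟩
      exact h3 i j (Finset.ne_of_mem_erase hj).symm hip hiq hjp hjq
    · intro h; simp [hip.symm] at h
    · intro h; simp [hiq.symm] at h
  have h6 : ∑ j ∈ Finset.univ.erase p, koszulTerm w br v p j +
      ∑ j ∈ Finset.univ.erase q, koszulTerm w br v q j = 0 := by
    have hp : ∑ j ∈ Finset.univ.erase p, koszulTerm w br v p j =
        ∑ j ∈ (Finset.univ.erase p).erase q, koszulTerm w br v p j := by
      rw [← Finset.sum_erase (a := q) _ h4]
    have hq : ∑ j ∈ Finset.univ.erase q, koszulTerm w br v q j =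
        ∑ j ∈ (Finset.univ.erase p).erase q, koszulTerm w br v q j := by
      rw [Finset.erase_right_comm]
      rw [← Finset.sum_erase (a := p) _ ((koszulTerm_symm w anti v hpq.symm).trans h4)]
    rw [hp, hq, ← Finset.sum_add_distrib]
    refine Finset.sum_eq_zero fun j hj ↦ ?_
    have hjq := Finset.ne_of_mem_erase hj
    have hjp := Finset.ne_of_mem_erase (Finset.mem_of_mem_erase hj)
    rw [koszulTerm_symm w anti v hjp.symm, koszulTerm_symm w anti v hjq.symm]
    exact h2 j hjp hjq
  rw [koszulFormula_eq w anti, h1, Finset.sum_eq_add p q hpq, h6]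
  · simp
  · rintro i - ⟨hip, hiq⟩
    exact h5 i hip hiq
  · simp
  · simp

theorem koszulFormula_add {br : Γ → Γ → Γ} {ρ : Γ → C → C}
    (ρ_add : ∀ a f g, ρ a (f + g) = ρ a f + ρ a g) (w' : Γ [⋀^Fin n]→ₗ[C] C)
    (v : Fin (n + 1) → Γ) :
    koszulFormula br ρ (w + w') v = koszulFormula br ρ w v + koszulFormula br ρ w' v := by
  simp only [koszulFormula, AlternatingMap.add_apply, ρ_add, mul_add, Finset.sum_add_distrib]
  ring

theorem koszulFormula_smul {br : Γ → Γ → Γ} {ρ : Γ → C → C}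
    (ρ_smul : ∀ a (r : ℝ) f, ρ a (r • f) = r • ρ a f) (r : ℝ) (v : Fin (n + 1) → Γ) :
    koszulFormula br ρ (r • w) v = r • koszulFormula br ρ w v := by
  simp only [koszulFormula, AlternatingMap.smul_apply, ρ_smul, mul_smul_comm,
    ← Finset.smul_sum, ← smul_sub]

end Koszul

end LieAlgebroid

/-! ### Quotients of subspaces -/

section SubQuotients

variable {W : Type*} [AddCommGroup W] [Module ℝ W]

/-- The quotient `Z / (Z ∩ B)` for subspaces `Z` and `B` of a real vector space. -/
def SubQuotient (Z B : Submodule ℝ W) : Type _ :=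
  Z ⧸ B.submoduleOf Z

instance SubQuotient.addCommGroup (Z B : Submodule ℝ W) : AddCommGroup (SubQuotient Z B) :=
  inferInstanceAs (AddCommGroup (Z ⧸ B.submoduleOf Z))

instance SubQuotient.module (Z B : Submodule ℝ W) : Module ℝ (SubQuotient Z B) :=
  inferInstanceAs (Module ℝ (Z ⧸ B.submoduleOf Z))

/-- The class of an element of `Z`. -/
def SubQuotient.mk {Z B : Submodule ℝ W} : Z →ₗ[ℝ] SubQuotient Z B :=
  (B.submoduleOf Z).mkQ

theorem SubQuotient.mk_eq_zero {Z B : Submodule ℝ W} {z : Z} :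
    (SubQuotient.mk z : SubQuotient Z B) = 0 ↔ (z : W) ∈ B :=
  Submodule.Quotient.mk_eq_zero (B.submoduleOf Z)

end SubQuotients

/-! ### Lie algebroids -/

section LieAlgebroids

variable {EM : Type*} [NormedAddCommGroup EM] [NormedSpace ℝ EM]
  {H : Type*} [TopologicalSpace H]

/-- A smooth vector bundle morphism `ρ : A → TM` over the identity of `M`. -/
structure AnchoredBundle (I : ModelWithCorners ℝ EM H) {M : Type*} [TopologicalSpace M]
    [ChartedSpace H M] [IsManifold I ∞ M]
    (FA : Type*) [NormedAddCommGroup FA] [NormedSpace ℝ FA]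
    (A : M → Type*) [TopologicalSpace (TotalSpace FA A)]
    [∀ x, AddCommGroup (A x)] [∀ x, Module ℝ (A x)] [∀ x, TopologicalSpace (A x)]
    [FiberBundle FA A] [VectorBundle ℝ FA A] where
  /-- The anchor in each fibre. -/
  anchor : ∀ x, A x →ₗ[ℝ] TangentSpace I x
  /-- The anchor maps smooth sections to smooth vector fields. -/
  contMDiff_anchor : ∀ a : Cₛ^∞⟮I; FA, A⟯,
    ContMDiff I I.tangent ∞ fun x ↦ (⟨x, anchor x (a x)⟩ : TangentBundle I M)

variable {I : ModelWithCorners ℝ EM H} {M : Type*} [TopologicalSpace M]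
  [ChartedSpace H M] [IsManifold I ∞ M]
  {FA : Type*} [NormedAddCommGroup FA] [NormedSpace ℝ FA]
  {A : M → Type*} [TopologicalSpace (TotalSpace FA A)]
  [∀ x, AddCommGroup (A x)] [∀ x, Module ℝ (A x)] [∀ x, TopologicalSpace (A x)]
  [FiberBundle FA A] [VectorBundle ℝ FA A]

namespace AnchoredBundle

variable (R : AnchoredBundle I FA A)

/-- The vector field `ρ(a)` of a section `a` of `A`. -/
def vectorField (a : Cₛ^∞⟮I; FA, A⟯) : Cₛ^∞⟮I; EM, (TangentSpace I : M → Type _)⟯ :=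
  ⟨fun x ↦ R.anchor x (a x), R.contMDiff_anchor a⟩

/-- The derivative `ρ(a)(f)` of a smooth function `f` along `ρ(a)`. -/
def deriv (a : Cₛ^∞⟮I; FA, A⟯) (f : SmoothFun I M) : SmoothFun I M :=
  smoothLieDeriv (R.vectorField a) f

theorem deriv_apply (a : Cₛ^∞⟮I; FA, A⟯) (f : SmoothFun I M) (x : M) :
    R.deriv a f x = mvfderiv I f x (R.anchor x (a x)) :=
  rfl

theorem add_deriv (a b : Cₛ^∞⟮I; FA, A⟯) (f : SmoothFun I M) :
    R.deriv (a + b) f = R.deriv a f + R.deriv b f := by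
  ext x
  change mvfderiv I f x (R.anchor x ((a + b) x)) =
    mvfderiv I f x (R.anchor x (a x)) + mvfderiv I f x (R.anchor x (b x))
  simp

theorem smul_deriv (g : SmoothFun I M) (a : Cₛ^∞⟮I; FA, A⟯) (f : SmoothFun I M) :
    R.deriv (g • a) f = g * R.deriv a f := by
  ext x
  change mvfderiv I f x (R.anchor x ((g • a) x)) = g x * mvfderiv I f x (R.anchor x (a x))
  simp

theorem deriv_add (a : Cₛ^∞⟮I; FA, A⟯) (f g : SmoothFun I M) :
    R.deriv a (f + g) = R.deriv a f + R.deriv a g := by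
  ext x
  change mvfderiv I (⇑f + ⇑g) x (R.anchor x (a x)) =
    mvfderiv I f x (R.anchor x (a x)) + mvfderiv I g x (R.anchor x (a x))
  rw [mvfderiv_add (f.contMDiff.mdifferentiableAt (by simp))
    (g.contMDiff.mdifferentiableAt (by simp))]
  rfl

theorem deriv_mul (a : Cₛ^∞⟮I; FA, A⟯) (f g : SmoothFun I M) :
    R.deriv a (f * g) = f * R.deriv a g + R.deriv a f * g := by
  ext x
  change mvfderiv I (⇑f * ⇑g) x (R.anchor x (a x)) =
    f x * mvfderiv I g x (R.anchor x (a x)) + mvfderiv I f x (R.anchor x (a x)) * g x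
  rw [mvfderiv_mul (f.contMDiff.mdifferentiableAt (by simp))
    (g.contMDiff.mdifferentiableAt (by simp))]
  simp [mul_comm]

theorem deriv_const (a : Cₛ^∞⟮I; FA, A⟯) (r : ℝ) :
    R.deriv a (algebraMap ℝ (SmoothFun I M) r) = 0 := by
  ext x
  change mvfderiv I (fun _ : M ↦ r) x (R.anchor x (a x)) = 0
  simp [mvfderiv_const]

theorem deriv_zero (a : Cₛ^∞⟮I; FA, A⟯) : R.deriv a 0 = 0 := by
  simpa using R.deriv_const a 0

theorem deriv_real_smul (a : Cₛ^∞⟮I; FA, A⟯) (r : ℝ) (f : SmoothFun I M) :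
    R.deriv a (r • f) = r • R.deriv a f := by
  rw [Algebra.smul_def, Algebra.smul_def, deriv_mul, deriv_const, zero_mul, add_zero]

theorem deriv_neg (a : Cₛ^∞⟮I; FA, A⟯) (f : SmoothFun I M) :
    R.deriv a (-f) = -R.deriv a f := by
  simpa using R.deriv_real_smul a (-1) f

end AnchoredBundle

variable (I FA A) in
/-- A Lie algebroid `(A → M, ρ, [·,·])`: an anchored vector bundle with an `ℝ`-Lie bracket on its
smooth sections which satisfies the Leibniz rule. -/
structure LieAlgebroid extends AnchoredBundle I FA A where
  /-- The Lie bracket on `Γ(A)`. -/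
  bracket : Cₛ^∞⟮I; FA, A⟯ →ₗ[ℝ] Cₛ^∞⟮I; FA, A⟯ →ₗ[ℝ] Cₛ^∞⟮I; FA, A⟯
  bracket_self : ∀ a, bracket a a = 0
  jacobi : ∀ a b c,
    bracket a (bracket b c) + bracket b (bracket c a) + bracket c (bracket a b) = 0
  leibniz : ∀ (a : Cₛ^∞⟮I; FA, A⟯) (f : SmoothFun I M) (b : Cₛ^∞⟮I; FA, A⟯),
    bracket a (f • b) = f • bracket a b + toAnchoredBundle.deriv a f • b
  /-- The anchor maps the bracket of sections to the Lie bracket of vector fields, the latter being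
  the commutator of derivations of `C^∞(M)`. -/
  anchor_bracket : ∀ (a b : Cₛ^∞⟮I; FA, A⟯) (f : SmoothFun I M),
    toAnchoredBundle.deriv (bracket a b) f =
      toAnchoredBundle.deriv a (toAnchoredBundle.deriv b f) -
        toAnchoredBundle.deriv b (toAnchoredBundle.deriv a f)

namespace LieAlgebroid

variable (L : LieAlgebroid I FA A)

theorem bracket_anti (a b : Cₛ^∞⟮I; FA, A⟯) : L.bracket a b = -L.bracket b a := by
  have h := L.bracket_self (a + b)
  simp only [map_add, LinearMap.add_apply, L.bracket_self, zero_add, add_zero] at h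
  exact eq_neg_of_add_eq_zero_right h

/-! ### Differential forms and cohomology -/

/-- `Ω^n(A) = Γ(⋀^n A^*)`, the alternating `C^∞(M)`-multilinear `n`-forms on `Γ(A)`. -/
abbrev Form (_L : LieAlgebroid I FA A) (n : ℕ) : Type _ :=
  Cₛ^∞⟮I; FA, A⟯ [⋀^Fin n]→ₗ[SmoothFun I M] SmoothFun I M

/-- The Lie algebroid differential `d_A w` of a form `w`, given by the Koszul formula. -/
def dForm {n : ℕ} (w : L.Form n) : L.Form (n + 1) where
  toFun := koszulFormula (fun a b ↦ L.bracket a b) L.deriv w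
  map_update_add' := by
    intro inst v k x y
    rw [Subsingleton.elim inst (instDecidableEqFin (n + 1))]
    exact koszulFormula_update_add w (fun a b c ↦ map_add (L.bracket a) b c)
      (fun a b c ↦ by rw [map_add, LinearMap.add_apply]) L.add_deriv L.deriv_add v k x y
  map_update_smul' := by
    intro inst v k f x
    rw [Subsingleton.elim inst (instDecidableEqFin (n + 1))]
    exact koszulFormula_update_smul w L.bracket_anti L.leibniz L.smul_deriv L.deriv_mul v k f x
  map_eq_zero_of_eq' := fun v p q hv hpq ↦
    koszulFormula_eq_zero w L.bracket_anti L.bracket_self L.deriv_zero L.deriv_neg v hv hpq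

theorem dForm_apply {n : ℕ} (w : L.Form n) (v : Fin (n + 1) → Cₛ^∞⟮I; FA, A⟯) :
    L.dForm w v = koszulFormula (fun a b ↦ L.bracket a b) L.deriv w v :=
  rfl

/-- The Lie algebroid differential `d_A : Ω^n(A) → Ω^(n+1)(A)`. -/
def d (n : ℕ) : L.Form n →ₗ[ℝ] L.Form (n + 1) where
  toFun := L.dForm
  map_add' w w' := by
    ext1 v
    rw [AlternatingMap.add_apply, dForm_apply, dForm_apply, dForm_apply]
    exact koszulFormula_add w L.deriv_add w' v
  map_smul' r w := by
    ext1 v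
    rw [RingHom.id_apply, AlternatingMap.smul_apply, dForm_apply, dForm_apply]
    exact koszulFormula_smul w L.deriv_real_smul r v

theorem d_apply {n : ℕ} (w : L.Form n) (v : Fin (n + 1) → Cₛ^∞⟮I; FA, A⟯) :
    L.d n w v = koszulFormula (fun a b ↦ L.bracket a b) L.deriv w v :=
  rfl

/-- The closed forms. -/
def closedForms (n : ℕ) : Submodule ℝ (L.Form n) :=
  LinearMap.ker (L.d n)

/-- The exact forms. -/
def exactForms : ∀ n : ℕ, Submodule ℝ (L.Form n)
  | 0 => ⊥
  | n + 1 => LinearMap.range (L.d n)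

/-- The Lie algebroid cohomology `H^n(A)`: closed forms modulo exact forms. -/
abbrev Cohomology (n : ℕ) : Type _ :=
  SubQuotient (L.closedForms n) (L.exactForms n)

/-- The cohomology class of a closed form. -/
def cohomologyClass {n : ℕ} (w : L.Form n) (hw : w ∈ L.closedForms n) : L.Cohomology n :=
  SubQuotient.mk ⟨w, hw⟩

/-! ### Wedge products -/

/-- The wedge product of forms with values in a `C^∞(M)`-algebra `S`:
`(u ∧ w)(a 1, …, a (m+n))` is the sum over all `(m,n)`-shuffles `σ` of
`sign σ * u(a (σ 1), …, a (σ m)) * w(a (σ (m+1)), …, a (σ (m+n)))`. -/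
def wedge (_L : LieAlgebroid I FA A) {S : Type*} [Ring S] [Algebra (SmoothFun I M) S] {m n : ℕ}
    (u : Cₛ^∞⟮I; FA, A⟯ [⋀^Fin m]→ₗ[SmoothFun I M] S)
    (w : Cₛ^∞⟮I; FA, A⟯ [⋀^Fin n]→ₗ[SmoothFun I M] S) :
    Cₛ^∞⟮I; FA, A⟯ [⋀^Fin (m + n)]→ₗ[SmoothFun I M] S :=
  ((LinearMap.mul' (SmoothFun I M) S).compAlternatingMap (u.domCoprod w)).domDomCongr
    finSumFinEquiv

end LieAlgebroid

end LieAlgebroids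

/-! ### Lie subalgebroids -/

section Subalgebroids

variable {EM : Type*} [NormedAddCommGroup EM] [NormedSpace ℝ EM]
  {H : Type*} [TopologicalSpace H]
  {I : ModelWithCorners ℝ EM H} {M : Type*} [TopologicalSpace M]
  [ChartedSpace H M] [IsManifold I ∞ M]
  {FA : Type*} [NormedAddCommGroup FA] [NormedSpace ℝ FA]
  {A : M → Type*} [TopologicalSpace (TotalSpace FA A)]
  [∀ x, AddCommGroup (A x)] [∀ x, Module ℝ (A x)] [∀ x, TopologicalSpace (A x)]
  [FiberBundle FA A] [VectorBundle ℝ FA A]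
  {F : Type*} [NormedAddCommGroup F] [NormedSpace ℝ F]
  {V : M → Type*} [TopologicalSpace (TotalSpace F V)]
  [∀ x, AddCommGroup (V x)] [∀ x, Module ℝ (V x)] [∀ x, TopologicalSpace (V x)]
  [FiberBundle F V] [VectorBundle ℝ F V]

/-- A Lie subalgebroid `B ⊆ A` over the same base: a smooth vector subbundle of constant rank whose
smooth sections are closed under the bracket. Smoothness of the subbundle means that near every
point it is spanned by a frame of smooth sections of `A`. -/
structure LieSubalgebroid (L : LieAlgebroid I FA A) where
  /-- The rank of `B`. -/
  rank : ℕ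
  /-- The fibre `B x` as a subspace of `A x`. -/
  fiber : ∀ x, Submodule ℝ (A x)
  exists_frame : ∀ x₀ : M, ∃ b : Fin rank → Cₛ^∞⟮I; FA, A⟯, ∀ᶠ x in 𝓝 x₀,
    LinearIndependent ℝ (fun i ↦ b i x) ∧ Submodule.span ℝ (Set.range fun i ↦ b i x) = fiber x
  bracket_mem : ∀ a b : Cₛ^∞⟮I; FA, A⟯, (∀ x, a x ∈ fiber x) → (∀ x, b x ∈ fiber x) →
    ∀ x, L.bracket a b x ∈ fiber x

namespace LieSubalgebroid

variable {L : LieAlgebroid I FA A} (B : LieSubalgebroid L)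

/-- `Γ(B)`, the smooth sections of `A` with values in `B`. -/
def sections : Submodule (SmoothFun I M) Cₛ^∞⟮I; FA, A⟯ where
  carrier := {a | ∀ x, a x ∈ B.fiber x}
  add_mem' ha hb x := (B.fiber x).add_mem (ha x) (hb x)
  zero_mem' x := (B.fiber x).zero_mem
  smul_mem' f _ ha x := (B.fiber x).smul_mem (f x) (ha x)

/-- The bracket of `Γ(B)`. -/
def bracket (a b : B.sections) : B.sections :=
  ⟨L.bracket a b, B.bracket_mem a b a.2 b.2⟩

end LieSubalgebroid

/-! ### Connections -/

/-- An `A`-connection on a vector bundle `V`. -/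
structure LieAlgebroid.Connection (L : LieAlgebroid I FA A) (F : Type*) [NormedAddCommGroup F]
    [NormedSpace ℝ F] (V : M → Type*) [TopologicalSpace (TotalSpace F V)]
    [∀ x, AddCommGroup (V x)] [∀ x, Module ℝ (V x)] [∀ x, TopologicalSpace (V x)]
    [FiberBundle F V] [VectorBundle ℝ F V] where
  /-- The covariant derivative `∇_a e`, which is `C^∞(M)`-linear in `a` and `ℝ`-linear in `e`. -/
  nabla : Cₛ^∞⟮I; FA, A⟯ →ₗ[SmoothFun I M] Cₛ^∞⟮I; F, V⟯ →ₗ[ℝ] Cₛ^∞⟮I; F, V⟯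
  leibniz : ∀ (a : Cₛ^∞⟮I; FA, A⟯) (f : SmoothFun I M) (e : Cₛ^∞⟮I; F, V⟯),
    nabla a (f • e) = f • nabla a e + L.deriv a f • e

/-- A `B`-connection on a vector bundle `V`, for a Lie subalgebroid `B`. -/
structure LieSubalgebroid.Connection {L : LieAlgebroid I FA A} (B : LieSubalgebroid L)
    (F : Type*) [NormedAddCommGroup F] [NormedSpace ℝ F]
    (V : M → Type*) [TopologicalSpace (TotalSpace F V)]
    [∀ x, AddCommGroup (V x)] [∀ x, Module ℝ (V x)] [∀ x, TopologicalSpace (V x)]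
    [FiberBundle F V] [VectorBundle ℝ F V] where
  /-- The covariant derivative `∇_b e`, which is `C^∞(M)`-linear in `b` and `ℝ`-linear in `e`. -/
  nabla : B.sections →ₗ[SmoothFun I M] Cₛ^∞⟮I; F, V⟯ →ₗ[ℝ] Cₛ^∞⟮I; F, V⟯
  leibniz : ∀ (b : B.sections) (f : SmoothFun I M) (e : Cₛ^∞⟮I; F, V⟯),
    nabla b (f • e) = f • nabla b e + L.deriv (b : Cₛ^∞⟮I; FA, A⟯) f • e

/-- A `B`-connection is flat if its curvature vanishes. -/
def LieSubalgebroid.Connection.IsFlat {L : LieAlgebroid I FA A} {B : LieSubalgebroid L}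
    (D : B.Connection F V) : Prop :=
  ∀ (a b : B.sections) (e : Cₛ^∞⟮I; F, V⟯),
    D.nabla a (D.nabla b e) - D.nabla b (D.nabla a e) - D.nabla (B.bracket a b) e = 0

namespace LieAlgebroid.Connection

variable {L : LieAlgebroid I FA A} (D : L.Connection F V)

/-- The `A`-connection `D` extends the `B`-connection `D₀`. -/
def Extends {B : LieSubalgebroid L} (D₀ : B.Connection F V) : Prop :=
  ∀ (b : B.sections) (e : Cₛ^∞⟮I; F, V⟯), D.nabla b e = D₀.nabla b e

/-- The endomorphism `R(a, b) = ∇_a ∇_b - ∇_b ∇_a - ∇_[a, b]`. -/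
def curvatureEnd (a b : Cₛ^∞⟮I; FA, A⟯) : Module.End (SmoothFun I M) Cₛ^∞⟮I; F, V⟯ where
  toFun e := D.nabla a (D.nabla b e) - D.nabla b (D.nabla a e) - D.nabla (L.bracket a b) e
  map_add' e e' := by
    simp only [map_add]
    abel
  map_smul' f e := by
    simp only [D.leibniz, map_add, L.anchor_bracket, RingHom.id_apply, smul_sub, sub_smul]
    abel

theorem curvatureEnd_apply (a b : Cₛ^∞⟮I; FA, A⟯) (e : Cₛ^∞⟮I; F, V⟯) :
    D.curvatureEnd a b e =
      D.nabla a (D.nabla b e) - D.nabla b (D.nabla a e) - D.nabla (L.bracket a b) e :=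
  rfl

theorem curvatureEnd_self (a : Cₛ^∞⟮I; FA, A⟯) : D.curvatureEnd a a = 0 := by
  ext1 e
  simp [curvatureEnd_apply, L.bracket_self]

theorem curvatureEnd_anti (a b : Cₛ^∞⟮I; FA, A⟯) :
    D.curvatureEnd a b = -D.curvatureEnd b a := by
  ext1 e
  rw [LinearMap.neg_apply, curvatureEnd_apply, curvatureEnd_apply, L.bracket_anti a b, map_neg,
    LinearMap.neg_apply]
  abel

theorem curvatureEnd_add (a b c : Cₛ^∞⟮I; FA, A⟯) :
    D.curvatureEnd a (b + c) = D.curvatureEnd a b + D.curvatureEnd a c := by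
  ext1 e
  simp only [curvatureEnd_apply, LinearMap.add_apply, map_add]
  abel

theorem curvatureEnd_smul (a : Cₛ^∞⟮I; FA, A⟯) (f : SmoothFun I M) (b : Cₛ^∞⟮I; FA, A⟯) :
    D.curvatureEnd a (f • b) = f • D.curvatureEnd a b := by
  ext1 e
  simp only [curvatureEnd_apply, LinearMap.smul_apply, map_smul, L.leibniz, map_add,
    LinearMap.add_apply, D.leibniz, smul_sub]
  abel

theorem curvatureEnd_add_left (a b c : Cₛ^∞⟮I; FA, A⟯) :
    D.curvatureEnd (a + b) c = D.curvatureEnd a c + D.curvatureEnd b c := by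
  rw [curvatureEnd_anti, curvatureEnd_add, neg_add, ← curvatureEnd_anti, ← curvatureEnd_anti]

theorem curvatureEnd_smul_left (f : SmoothFun I M) (a b : Cₛ^∞⟮I; FA, A⟯) :
    D.curvatureEnd (f • a) b = f • D.curvatureEnd a b := by
  rw [curvatureEnd_anti, curvatureEnd_smul, ← smul_neg, ← curvatureEnd_anti]

/-- The curvature `R ∈ Ω²(A; End V)`. -/
def curvature :
    Cₛ^∞⟮I; FA, A⟯ [⋀^Fin 2]→ₗ[SmoothFun I M] Module.End (SmoothFun I M) Cₛ^∞⟮I; F, V⟯ where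
  toFun v := D.curvatureEnd (v 0) (v 1)
  map_update_add' := by
    intro inst v k x y
    rw [Subsingleton.elim inst (instDecidableEqFin 2)]
    fin_cases k <;> simp [curvatureEnd_add, curvatureEnd_add_left]
  map_update_smul' := by
    intro inst v k f x
    rw [Subsingleton.elim inst (instDecidableEqFin 2)]
    fin_cases k <;> simp [curvatureEnd_smul, curvatureEnd_smul_left]
  map_eq_zero_of_eq' := by
    intro v i j hv hij
    have h : v 0 = v 1 := by
      fin_cases i <;> fin_cases j <;> simp_all
    change D.curvatureEnd (v 0) (v 1) = 0
    rw [h, curvatureEnd_self]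

/-- The powers `R^i ∈ Ω^(2i)(A; End V)` of the curvature, for the product of `End V`-valued forms
which combines the wedge product with the composition of endomorphisms. -/
def curvaturePow : ∀ i : ℕ,
    Cₛ^∞⟮I; FA, A⟯ [⋀^Fin (2 * i)]→ₗ[SmoothFun I M] Module.End (SmoothFun I M) Cₛ^∞⟮I; F, V⟯
  | 0 => AlternatingMap.constOfIsEmpty (SmoothFun I M) Cₛ^∞⟮I; FA, A⟯ (Fin 0) 1
  | i + 1 => L.wedge (curvaturePow i) D.curvature

end LieAlgebroid.Connection

end Subalgebroids

/-! ### Pontryagin spaces and invariant polynomials -/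

section Pontryagin

variable {EM : Type*} [NormedAddCommGroup EM] [NormedSpace ℝ EM] [FiniteDimensional ℝ EM]
  {H : Type*} [TopologicalSpace H]
  {I : ModelWithCorners ℝ EM H} {M : Type*} [TopologicalSpace M]
  [ChartedSpace H M] [IsManifold I ∞ M] [T2Space M]
  {FA : Type*} [NormedAddCommGroup FA] [NormedSpace ℝ FA]
  {A : M → Type*} [TopologicalSpace (TotalSpace FA A)]
  [∀ x, AddCommGroup (A x)] [∀ x, Module ℝ (A x)] [∀ x, TopologicalSpace (A x)]
  [FiberBundle FA A] [VectorBundle ℝ FA A]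
  {F : Type*} [NormedAddCommGroup F] [NormedSpace ℝ F] [FiniteDimensional ℝ F]
  {V : M → Type*} [TopologicalSpace (TotalSpace F V)]
  [∀ x, AddCommGroup (V x)] [∀ x, Module ℝ (V x)] [∀ x, TopologicalSpace (V x)]
  [FiberBundle F V] [VectorBundle ℝ F V] [ContMDiffVectorBundle ∞ F V I]
  {L : LieAlgebroid I FA A}

namespace LieAlgebroid.Connection

variable (D : L.Connection F V)

/-- The form `tr(R^i) ∈ Ω^(2i)(A)`. -/
def traceForm (i : ℕ) : L.Form (2 * i) :=
  bundleTrace.compAlternatingMap (D.curvaturePow i)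

/-- `w` is a wedge product of forms `tr(R^i)` with `i ≥ 1`. -/
inductive IsTraceMonomial : ∀ l : ℕ, L.Form l → Prop
  | one : IsTraceMonomial 0
      (AlternatingMap.constOfIsEmpty (SmoothFun I M) Cₛ^∞⟮I; FA, A⟯ (Fin 0) 1)
  | mul {l : ℕ} {w : L.Form l} (hw : IsTraceMonomial l w) {i : ℕ} (hi : 1 ≤ i) :
      IsTraceMonomial (l + 2 * i) (L.wedge w (D.traceForm i))

end LieAlgebroid.Connection

variable (L F V) in
/-- The degree `l` part `Pont^l_A(V) ⊆ H^l(A)` of the `ℝ`-subalgebra of `H(A)` generated by the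
classes `[tr(R^i)]`, `i ≥ 1`, where `R` is the curvature of an `A`-connection on `V`: it is spanned
by the classes of the wedge products of these forms. -/
def LieAlgebroid.pontryaginSpace (l : ℕ) : Submodule ℝ (L.Cohomology l) :=
  Submodule.span ℝ {c | ∃ (D : L.Connection F V) (w : L.Form l) (hw : w ∈ L.closedForms l),
    D.IsTraceMonomial l w ∧ c = L.cohomologyClass w hw}

/-- A real polynomial in the entries of a `k × k` matrix is invariant if it is constant on the
conjugacy classes of `GL(k, ℝ)`. -/
def IsInvariantPolynomial {k : ℕ} (p : MvPolynomial (Fin k × Fin k) ℝ) : Prop :=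
  ∀ (g : GL (Fin k) ℝ) (X : Matrix (Fin k) (Fin k) ℝ),
    MvPolynomial.eval (fun ij ↦ ((g : Matrix (Fin k) (Fin k) ℝ) * X *
      ((g⁻¹ : GL (Fin k) ℝ) : Matrix (Fin k) (Fin k) ℝ)) ij.1 ij.2) p =
    MvPolynomial.eval (fun ij ↦ X ij.1 ij.2) p

/-- The polarization of a homogeneous polynomial `p` of degree `d`: the symmetric `d`-linear
function `P` of matrices with `P(X, …, X) = p(X)`, given by the polarization formula
`P(X 1, …, X d) = (1/d!) ∑_S (-1)^(d - #S) p(∑ i ∈ S, X i)`. -/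
def polarization {k d : ℕ} (p : MvPolynomial (Fin k × Fin k) ℝ)
    (X : Fin d → Matrix (Fin k) (Fin k) ℝ) : ℝ :=
  (d.factorial : ℝ)⁻¹ * ∑ S : Finset (Fin d), (-1) ^ (d - S.card) *
    MvPolynomial.eval (fun ij ↦ ∑ i ∈ S, X i ij.1 ij.2) p

namespace LieAlgebroid.Connection

variable (D : L.Connection F V)

/-- The value `p(R)(a 0, …, a (2d-1))` at the point `x` of the `2d`-form obtained by evaluating a
homogeneous polynomial `p` of degree `d` on the curvature `R`. A basis `b` of the fibre `V x` turns
the endomorphisms `R(a i, a j)_x` into matrices; the form is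
`2^(-d) ∑_σ sign σ * P(R(a (σ 0), a (σ 1)), …, R(a (σ (2d-2)), a (σ (2d-1))))`
with `σ` in the permutations of `2d` letters and `P` the polarization of `p`. -/
def polynomialForm {d : ℕ} (p : MvPolynomial (Fin (finrank ℝ F) × Fin (finrank ℝ F)) ℝ)
    (a : Fin (2 * d) → Cₛ^∞⟮I; FA, A⟯) (x : M) (b : Basis (Fin (finrank ℝ F)) ℝ (V x)) : ℝ :=
  ((2 : ℝ) ^ d)⁻¹ * ∑ σ : Equiv.Perm (Fin (2 * d)), ((Equiv.Perm.sign σ : ℤ) : ℝ) *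
    polarization p fun i : Fin d ↦ LinearMap.toMatrix b b (fibreMap x
      (D.curvatureEnd (a (σ ⟨2 * i, by omega⟩)) (a (σ ⟨2 * i + 1, by omega⟩))))

end LieAlgebroid.Connection

end Pontryagin

end

/-! The vanishing is a counting argument. If `∇` extends the flat `∇^B`, its curvature `R` is zero
as soon as both arguments lie in `B`, so each factor `R` in a product needs an argument outside `B`.
At a point, an alternating form is determined by its values on distinct members of a basis adapted
to `B`, and at most `q` of these lie outside `B`. Hence a product of more than `q` curvatures is
zero. The count is carried by `ListCochain.VanishesOn.mul` and `LieSubalgebroid.form_eq_zero` for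
wedge products of traces, and is made directly on pairs of arguments in
`Extends.polynomialForm_eq_zero` for polynomials.

An extension exists locally: split a multiple of `a` into a part in `B` and a remainder, use `∇^B`
along the first and differentiate the coefficients in a frame of the bundle along the second
(`exists_local_extension`). These local pieces satisfy the Leibniz rule only up to a function
factor, which the weights absorb when a partition of unity glues them (`exists_extension`).

The Pontryagin space is spanned by classes from all connections, so the vanishing for one extension
has to be carried over to the others by transgression. For `D = D₁ + α` the family `R_X = R₁ + X dα
+ X² α²` joins the two curvatures, satisfies `d_X R_X = 0` and `R_X' = d_X α`, and therefore
`tr(R_X^(i+1))' = (i+1) d tr(α R_X^i)`. Integrating over `[0, 1]` shows that the two trace forms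
differ by an exact form (`exists_map_trace_pow_sub_eq`). The family is a polynomial in a formal
variable and the integral sends `X^n` to `1/(n+1)`, so no analysis is involved.

All of this is computed in one noncommutative ring: forms of every degree are read as functions on
lists of sections, and product, Lie derivative and differential are defined by recursion on the
list. The recursions are the Cartan relations, so the algebraic identities follow by induction on
the list. The dictionary with alternating maps is `toListCochain_wedge` for the wedge product and
`d_toListCochain` for the Koszul differential. -/

noncomputable section

/-! ### Cochains on lists and the shuffle product -/

/-- Functions on lists; an `n`-form gives such a function which is supported on the lists of
length `n`. -/
@[ext]
structure ListCochain (Γ S : Type*) where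
  /-- The value at a list. -/
  toFun : List Γ → S

namespace ListCochain

instance (Γ S : Type*) : CoeFun (ListCochain Γ S) fun _ ↦ List Γ → S := ⟨toFun⟩

section Ring

variable {Γ S T : Type*} [Ring S] [Ring T]

theorem ext_apply {u w : ListCochain Γ S} (h : ∀ l, u l = w l) : u = w :=
  ListCochain.ext (funext h)

instance : Zero (ListCochain Γ S) := ⟨⟨fun _ ↦ 0⟩⟩
instance : Add (ListCochain Γ S) := ⟨fun u w ↦ ⟨fun l ↦ u l + w l⟩⟩
instance : Sub (ListCochain Γ S) := ⟨fun u w ↦ ⟨fun l ↦ u l - w l⟩⟩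
instance : Neg (ListCochain Γ S) := ⟨fun u ↦ ⟨fun l ↦ -u l⟩⟩
instance : SMul ℕ (ListCochain Γ S) := ⟨fun n u ↦ ⟨fun l ↦ n • u l⟩⟩
instance : SMul ℤ (ListCochain Γ S) := ⟨fun n u ↦ ⟨fun l ↦ n • u l⟩⟩

theorem toFun_injective : Function.Injective (toFun : ListCochain Γ S → List Γ → S) :=
  fun _ _ ↦ ListCochain.ext

instance : AddCommGroup (ListCochain Γ S) :=
  toFun_injective.addCommGroup toFun rfl (fun _ _ ↦ rfl) (fun _ ↦ rfl) (fun _ _ ↦ rfl)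
    (fun _ _ ↦ rfl) (fun _ _ ↦ rfl)

@[simp] theorem zero_apply (l : List Γ) : (0 : ListCochain Γ S) l = 0 := rfl

@[simp] theorem add_apply (u w : ListCochain Γ S) (l : List Γ) : (u + w) l = u l + w l := rfl

@[simp] theorem sub_apply (u w : ListCochain Γ S) (l : List Γ) : (u - w) l = u l - w l := rfl

@[simp] theorem neg_apply (u : ListCochain Γ S) (l : List Γ) : (-u) l = -u l := rfl

@[simp] theorem zsmul_apply (n : ℤ) (u : ListCochain Γ S) (l : List Γ) : (n • u) l = n • u l := rfl

/-- The contraction with `a`. -/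
def contract (a : Γ) : ListCochain Γ S →+ ListCochain Γ S where
  toFun u := ⟨fun l ↦ u (a :: l)⟩
  map_zero' := rfl
  map_add' _ _ := rfl

@[simp] theorem contract_apply (a : Γ) (u : ListCochain Γ S) (l : List Γ) :
    contract a u l = u (a :: l) := rfl

/-- The grading involution. -/
def invol : ListCochain Γ S →+ ListCochain Γ S where
  toFun u := ⟨fun l ↦ (-1) ^ l.length * u l⟩
  map_zero' := ext_apply fun _ ↦ mul_zero _
  map_add' u w := ext_apply fun l ↦ mul_add _ (u l) (w l)

theorem invol_apply (u : ListCochain Γ S) (l : List Γ) :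
    invol u l = (-1) ^ l.length * u l := rfl

@[simp] theorem invol_nil (u : ListCochain Γ S) : invol u [] = u [] := by simp [invol_apply]

theorem invol_invol (u : ListCochain Γ S) : invol (invol u) = u := by
  refine ext_apply fun l ↦ ?_
  rcases neg_one_pow_eq_or S l.length with h | h <;> simp [invol_apply, h]

/-- Contraction lowers the degree by one, which flips the sign of the grading involution. All signs
below come from this rule. -/
theorem contract_invol (a : Γ) (u : ListCochain Γ S) :
    contract a (invol u) = -invol (contract a u) := by
  refine ext_apply fun l ↦ ?_
  simp [invol_apply, pow_succ]

/-- The shuffle product, by recursion on the list. -/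
def shuffle : List Γ → ListCochain Γ S → ListCochain Γ S → S
  | [], u, w => u [] * w []
  | a :: l, u, w => shuffle l (contract a u) w + shuffle l (invol u) (contract a w)

instance : Mul (ListCochain Γ S) := ⟨fun u w ↦ ⟨fun l ↦ shuffle l u w⟩⟩

@[simp] theorem mul_nil (u w : ListCochain Γ S) : (u * w) [] = u [] * w [] := rfl

theorem mul_cons (u w : ListCochain Γ S) (a : Γ) (l : List Γ) :
    (u * w) (a :: l) = (contract a u * w) l + (invol u * contract a w) l := rfl

/-- The recursion of `shuffle` is chosen so that contraction is a graded derivation by definition.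
With the value on the empty list this determines the product, so identities between products are
proved by contracting both sides and induction on the list. -/
theorem contract_mul (a : Γ) (u w : ListCochain Γ S) :
    contract a (u * w) = contract a u * w + invol u * contract a w := rfl

/-- The cochain with the value `s` on the empty list. -/
def const : S →+ ListCochain Γ S where
  toFun s := ⟨fun l ↦ if l = [] then s else 0⟩
  map_zero' := ext_apply fun l ↦ ite_self 0
  map_add' s t := ext_apply fun l ↦ by
    change (if l = [] then s + t else 0) = (if l = [] then s else 0) + if l = [] then t else 0
    split_ifs <;> simp

@[simp] theorem const_nil (s : S) : const s ([] : List Γ) = s :=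
  if_pos (c := ([] : List Γ) = []) (e := 0) rfl

@[simp] theorem const_cons (s : S) (a : Γ) (l : List Γ) : const s (a :: l) = 0 :=
  if_neg (c := a :: l = []) (t := s) (List.cons_ne_nil a l)

@[simp] theorem contract_const (a : Γ) (s : S) : contract a (const s) = 0 := by
  refine ext_apply fun l ↦ ?_; simp

@[simp] theorem invol_const (s : S) : invol (const s : ListCochain Γ S) = const s := by
  refine ext_apply fun l ↦ ?_
  cases l <;> simp [invol_apply]

protected theorem zero_mul' (w : ListCochain Γ S) : 0 * w = 0 := by
  refine ext_apply fun l ↦ ?_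
  induction l generalizing w with
  | nil => simp
  | cons a l ih => simp [mul_cons, ih]

protected theorem mul_zero' (u : ListCochain Γ S) : u * 0 = 0 := by
  refine ext_apply fun l ↦ ?_
  induction l generalizing u with
  | nil => simp
  | cons a l ih => simp [mul_cons, ih]

protected theorem add_mul' (u v w : ListCochain Γ S) : (u + v) * w = u * w + v * w := by
  refine ext_apply fun l ↦ ?_
  induction l generalizing u v w with
  | nil => simp [add_mul]
  | cons a l ih => simp only [mul_cons, map_add, ih, add_apply]; abel

protected theorem mul_add' (u v w : ListCochain Γ S) : u * (v + w) = u * v + u * w := by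
  refine ext_apply fun l ↦ ?_
  induction l generalizing u v w with
  | nil => simp [mul_add]
  | cons a l ih => simp only [mul_cons, map_add, ih, add_apply]; abel

theorem const_mul_apply (s : S) (u : ListCochain Γ S) (l : List Γ) :
    (const s * u : ListCochain Γ S) l = s * u l := by
  induction l generalizing u with
  | nil => simp
  | cons a l ih => simp [mul_cons, ih, ListCochain.zero_mul']

theorem mul_const_apply (u : ListCochain Γ S) (s : S) (l : List Γ) :
    (u * const s : ListCochain Γ S) l = u l * s := by
  induction l generalizing u with
  | nil => simp
  | cons a l ih => simp [mul_cons, ih, ListCochain.mul_zero']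

protected theorem neg_mul' (u w : ListCochain Γ S) : -u * w = -(u * w) := by
  rw [eq_neg_iff_add_eq_zero, ← ListCochain.add_mul', neg_add_cancel, ListCochain.zero_mul']

protected theorem mul_neg' (u w : ListCochain Γ S) : u * -w = -(u * w) := by
  rw [eq_neg_iff_add_eq_zero, ← ListCochain.mul_add', neg_add_cancel, ListCochain.mul_zero']

theorem invol_mul (u w : ListCochain Γ S) : invol (u * w) = invol u * invol w := by
  refine ext_apply fun l ↦ ?_
  induction l generalizing u w with
  | nil => simp
  | cons a l ih =>
    rw [← contract_apply, ← contract_apply]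
    rw [contract_invol, contract_mul, contract_mul, map_add, contract_invol, contract_invol,
      ListCochain.neg_mul', ListCochain.mul_neg', neg_apply, add_apply, add_apply, ih, ih,
      neg_apply, neg_apply]
    abel

/-- Contraction of either side gives the three terms in which `u`, `v` or `w` is contracted;
`invol_mul` makes the signs in front of the last one agree. -/
protected theorem mul_assoc' (u v w : ListCochain Γ S) : u * v * w = u * (v * w) := by
  refine ext_apply fun l ↦ ?_
  induction l generalizing u v w with
  | nil => simp [mul_assoc]
  | cons a l ih =>
    rw [← contract_apply, ← contract_apply]
    simp only [contract_mul, ListCochain.add_mul', ListCochain.mul_add', add_apply, ih, invol_mul]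
    abel

instance : One (ListCochain Γ S) := ⟨const 1⟩

theorem one_eq_const : (1 : ListCochain Γ S) = const 1 := rfl

/-- Degrees are not part of the type, so powers and commutators of forms with noncommuting values
can be treated by ring identities, without casts between degrees. -/
instance : Ring (ListCochain Γ S) where
  zero_mul := ListCochain.zero_mul'
  mul_zero := ListCochain.mul_zero'
  left_distrib := ListCochain.mul_add'
  right_distrib := ListCochain.add_mul'
  mul_assoc := ListCochain.mul_assoc'
  one_mul u := by refine ext_apply fun l ↦ ?_; rw [one_eq_const, const_mul_apply, one_mul]
  mul_one u := by refine ext_apply fun l ↦ ?_; rw [one_eq_const, mul_const_apply, mul_one]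
  zsmul := (· • ·)
  zsmul_zero' := zero_zsmul
  zsmul_succ' n u := SubNegMonoid.zsmul_succ' n u
  zsmul_neg' n u := SubNegMonoid.zsmul_neg' n u
  neg_add_cancel := neg_add_cancel
  sub_eq_add_neg := sub_eq_add_neg

@[simp] theorem invol_one : invol (1 : ListCochain Γ S) = 1 := invol_const 1

/-- The push-forward of cochains along an additive map of the values. -/
def map (f : S →+ T) : ListCochain Γ S →+ ListCochain Γ T where
  toFun u := ⟨fun l ↦ f (u l)⟩
  map_zero' := ext_apply fun _ ↦ map_zero f
  map_add' u w := ext_apply fun l ↦ map_add f (u l) (w l)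

@[simp] theorem map_apply (f : S →+ T) (u : ListCochain Γ S) (l : List Γ) :
    map f u l = f (u l) := rfl

theorem contract_map (f : S →+ T) (a : Γ) (u : ListCochain Γ S) :
    contract a (map f u) = map f (contract a u) := rfl

theorem invol_map (f : S →+ T) (u : ListCochain Γ S) : invol (map f u) = map f (invol u) := by
  refine ext_apply fun l ↦ ?_
  rcases neg_one_pow_eq_or S l.length with h | h <;>
  rcases neg_one_pow_eq_or T l.length with h' | h' <;>
  rcases Nat.even_or_odd l.length with h'' | h'' <;>
  simp [invol_apply, h''.neg_one_pow]

theorem map_ringHom_mul (f : S →+* T) (u w : ListCochain Γ S) :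
    map (f : S →+ T) (u * w) = map (f : S →+ T) u * map (f : S →+ T) w := by
  refine ext_apply fun l ↦ ?_
  induction l generalizing u w with
  | nil => simp
  | cons a l ih =>
    rw [← contract_apply, ← contract_apply]
    rw [contract_mul, contract_map, contract_mul, map_add, add_apply, add_apply, ih, ih,
      invol_map, contract_map, contract_map]

theorem map_ringHom_one (f : S →+* T) : map (f : S →+ T) (1 : ListCochain Γ S) = 1 := by
  refine ext_apply fun l ↦ ?_
  cases l <;> simp [one_eq_const]

/-- No sign appears because `map f` preserves degrees and commutes with `invol`. It is applied to
the derivative in the parameter of a family. -/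
theorem map_derivation_mul (f : S →+ S) (hf : ∀ s t, f (s * t) = f s * t + s * f t)
    (u w : ListCochain Γ S) : map f (u * w) = map f u * w + u * map f w := by
  refine ext_apply fun l ↦ ?_
  induction l generalizing u w with
  | nil => simp [hf]
  | cons a l ih =>
    rw [← contract_apply, ← contract_apply]
    simp only [contract_mul, contract_map, map_add, add_apply, ih, invol_map]
    abel

/-! ### Cyclicity of traces -/

/-- A trace is graded commutative on products. -/
theorem map_trace_mul (τ : S →+ T) (hτ : ∀ s t, τ (s * t) = τ (t * s)) (p q : ℕ)
    (u w : ListCochain Γ S) (hu : invol u = (-1 : ℤ) ^ p • u) (hw : invol w = (-1 : ℤ) ^ q • w) :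
    map τ (u * w) = (-1 : ℤ) ^ (p * q) • map τ (w * u) := by
  refine ext_apply fun l ↦ ?_
  induction l generalizing u w p q with
  | nil =>
    have hp := congrArg (fun v : ListCochain Γ S ↦ v []) hu
    have hq := congrArg (fun v : ListCochain Γ S ↦ v []) hw
    beta_reduce at hp hq
    rw [invol_nil, zsmul_apply] at hp hq
    rcases Nat.even_or_odd p with h | h
    · simp [hτ (u [])  (w []), (h.mul_right q).neg_one_pow]
    · rcases Nat.even_or_odd q with h' | h'
      · simp [hτ (u [])  (w []), (h'.mul_left p).neg_one_pow]
      -- Here both factors are odd and the claim has a sign, which oddness supplies: the scalar part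
      -- satisfies `u [] = -u []`.
      · rw [h.neg_one_pow, neg_one_smul] at hp
        rw [map_apply, mul_nil, zsmul_apply, map_apply, mul_nil, hτ (u []) (w []),
          (h.mul h').neg_one_pow, neg_one_smul, ← map_neg, ← mul_neg, ← hp]
  | cons a l ih =>
    -- Only the parity of `p` matters, so the drop of the degree by one is written as `p + 1`,
    -- avoiding subtraction.
    have hu' : invol (contract a u) = (-1 : ℤ) ^ (p + 1) • contract a u := by
      rw [← neg_eq_iff_eq_neg.2 (contract_invol a u), hu, map_zsmul, pow_succ, mul_neg_one,
        neg_smul]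
    have hw' : invol (contract a w) = (-1 : ℤ) ^ (q + 1) • contract a w := by
      rw [← neg_eq_iff_eq_neg.2 (contract_invol a w), hw, map_zsmul, pow_succ, mul_neg_one,
        neg_smul]
    have h1 := ih (p + 1) q (contract a u) w hu' hw
    have h2 := ih p (q + 1) u (contract a w) hu hw'
    rw [zsmul_apply] at h1 h2
    rw [← contract_apply, ← contract_apply]
    simp only [contract_map, contract_mul, map_add, add_apply, hu, hw, smul_mul_assoc, map_zsmul,
      zsmul_apply, h1, h2, smul_add, smul_smul]
    rw [add_comm]
    have e1 : (-1 : ℤ) ^ ((p + 1) * q) = (-1) ^ (p * q) * (-1) ^ q := by ring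
    have e2 : (-1 : ℤ) ^ p * (-1) ^ (p * (q + 1)) = (-1) ^ (p * q) := by
      rw [← pow_add, show p + p * (q + 1) = p * q + 2 * p by ring, pow_add, pow_mul]
      simp
    rw [e1, e2]

theorem map_trace_mul_of_even (τ : S →+ T) (hτ : ∀ s t, τ (s * t) = τ (t * s))
    {u w : ListCochain Γ S} (hu : invol u = u) (hw : invol w = w) :
    map τ (u * w) = map τ (w * u) := by
  simpa using map_trace_mul τ hτ 0 0 u w (by simpa) (by simpa)

/-- The derivative of a power of an even cochain `r` under a trace. -/
theorem map_trace_derivation_pow (τ : S →+ T) (hτ : ∀ s t, τ (s * t) = τ (t * s))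
    (δ : ListCochain Γ S →+ ListCochain Γ S) (hδ : ∀ u w, δ (u * w) = δ u * w + u * δ w)
    {r : ListCochain Γ S} (hr : invol r = r) (hr' : invol (δ r) = δ r) (i : ℕ) :
    map τ (δ (r ^ (i + 1))) = (i + 1) • map τ (δ r * r ^ i) := by
  have hpow : ∀ j, invol (r ^ j) = r ^ j := by
    intro j
    induction j with
    | zero => simp
    | succ j ih => rw [pow_succ, invol_mul, ih, hr]
  -- The spare factor `r ^ j` makes the induction close: splitting off one `r` leaves it to the
  -- right of the differentiated power, and cyclicity moves `δ r` to the front.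
  have key : ∀ i j, map τ (δ (r ^ (i + 1)) * r ^ j) = (i + 1) • map τ (δ r * r ^ (i + j)) := by
    intro i
    induction i with
    | zero => intro j; simp
    | succ i ih =>
      intro j
      rw [pow_succ r (i + 1), hδ, add_mul, map_add, mul_assoc, ← pow_succ', ih, mul_assoc,
        map_trace_mul_of_even τ hτ (hpow _) (by rw [invol_mul, hr', hpow]), mul_assoc, ← pow_add,
        add_smul, add_smul, one_smul, show i + (j + 1) = i + 1 + j by ring,
        show j + (i + 1) = i + 1 + j by ring]
      simp [add_smul]
  simpa using key i 0

/-! ### Orders of vanishing -/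

/-- `u` vanishes on the lists with less than `p` entries outside of `P`. -/
def VanishesOn (P : Γ → Prop) [DecidablePred P] (p : ℕ) (u : ListCochain Γ S) : Prop :=
  ∀ l : List Γ, l.countP (fun a ↦ ¬P a) < p → u l = 0

theorem VanishesOn.contract_of_mem {P : Γ → Prop} [DecidablePred P] {p : ℕ}
    {u : ListCochain Γ S} (hu : VanishesOn P p u) {a : Γ} (ha : P a) :
    VanishesOn P p (contract a u) := fun l hl ↦ hu _ (by simpa [ha] using hl)

theorem VanishesOn.contract {P : Γ → Prop} [DecidablePred P] {p : ℕ}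
    {u : ListCochain Γ S} (hu : VanishesOn P p u) (a : Γ) :
    VanishesOn P (p - 1) (contract a u) := by
  refine fun l hl ↦ hu _ ?_
  rw [List.countP_cons]
  split_ifs <;> omega

theorem VanishesOn.invol {P : Γ → Prop} [DecidablePred P] {p : ℕ}
    {u : ListCochain Γ S} (hu : VanishesOn P p u) :
    VanishesOn P p (invol u) := fun l hl ↦ by rw [invol_apply, hu l hl, mul_zero]

theorem VanishesOn.map {P : Γ → Prop} [DecidablePred P] {p : ℕ}
    {u : ListCochain Γ S} (hu : VanishesOn P p u) (f : S →+ T) :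
    VanishesOn P p (map f u) := fun l hl ↦ by rw [map_apply, hu l hl, map_zero]

/-- A shuffle distributes the entries outside of `P` over the two factors; if there are fewer than
`p + q`, then `u` gets fewer than `p` or `w` fewer than `q`. In the recursion each such entry lowers
the order of one factor by at most one. -/
theorem VanishesOn.mul {P : Γ → Prop} [DecidablePred P] {p q : ℕ}
    {u w : ListCochain Γ S} (hu : VanishesOn P p u) (hw : VanishesOn P q w) :
    VanishesOn P (p + q) (u * w) := by
  intro l
  induction l generalizing u w p q with
  | nil =>
    intro hl
    rcases Nat.eq_zero_or_pos p with rfl | hp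
    · rw [mul_nil, hw [] (by simpa using hl), mul_zero]
    · rw [mul_nil, hu [] (by simpa using hp), zero_mul]
  | cons a l ih =>
    intro hl
    rw [mul_cons]
    by_cases ha : P a
    · have hl' : l.countP (fun a ↦ ¬P a) < p + q := by simpa [ha] using hl
      rw [ih (hu.contract_of_mem ha) hw hl', ih hu.invol (hw.contract_of_mem ha) hl', add_zero]
    · have hl' : l.countP (fun a ↦ ¬P a) + 1 < p + q := by simpa [ha] using hl
      rw [ih (hu.contract a) hw (by omega), ih hu.invol (hw.contract a) (by omega), add_zero]

end Ring

/-! ### The differential of cochains on lists -/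

section Differential

variable {Γ S T : Type*} [Ring S] [Ring T] (br : Γ → Γ → Γ) (ρ : Γ → S →+ S)

/-- The Lie derivative, by recursion on the list. -/
def lieAux (a : Γ) : List Γ → ListCochain Γ S → S
  | [], u => ρ a (u [])
  | b :: l, u => lieAux a l (contract b u) - u (br a b :: l)

theorem lieAux_add (a : Γ) (l : List Γ) (u w : ListCochain Γ S) :
    lieAux br ρ a l (u + w) = lieAux br ρ a l u + lieAux br ρ a l w := by
  induction l generalizing u w with
  | nil => simp [lieAux]
  | cons b l ih => simp only [lieAux, map_add, ih, add_apply]; abel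

/-- The Lie derivative along `a`. -/
def lie (a : Γ) : ListCochain Γ S →+ ListCochain Γ S :=
  AddMonoidHom.mk' (fun u ↦ ⟨fun l ↦ lieAux br ρ a l u⟩) fun u w ↦ by
    refine ext_apply fun l ↦ ?_; exact lieAux_add br ρ a l u w

@[simp] theorem lie_nil (a : Γ) (u : ListCochain Γ S) : lie br ρ a u [] = ρ a (u []) := rfl

/-- The relation `i_b L_a = L_a i_b - i_[a,b]`, built into the recursion for the Lie derivative. -/
theorem contract_lie (a b : Γ) (u : ListCochain Γ S) :
    contract b (lie br ρ a u) = lie br ρ a (contract b u) - contract (br a b) u := rfl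

theorem lie_invol (a : Γ) (u : ListCochain Γ S) :
    lie br ρ a (invol u) = invol (lie br ρ a u) := by
  refine ext_apply fun l ↦ ?_
  induction l generalizing u with
  | nil => simp
  | cons b l ih =>
    rw [← contract_apply, ← contract_apply]
    simp only [contract_lie, contract_invol, map_neg, map_sub, sub_apply, neg_apply, ih]
    abel

theorem lie_mul (hρ : ∀ a s t, ρ a (s * t) = ρ a s * t + s * ρ a t) (a : Γ)
    (u w : ListCochain Γ S) : lie br ρ a (u * w) = lie br ρ a u * w + u * lie br ρ a w := by
  refine ext_apply fun l ↦ ?_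
  induction l generalizing u w with
  | nil => simp [hρ]
  | cons b l ih =>
    rw [← contract_apply, ← contract_apply]
    simp only [contract_lie, contract_mul, map_add, add_apply, sub_apply, ih, sub_mul, mul_sub,
      lie_invol]
    abel

/-- The differential, by recursion on the list. -/
def dAux : List Γ → ListCochain Γ S → S
  | [], _ => 0
  | a :: l, u => lie br ρ a u l - dAux l (contract a u)

theorem dAux_add (l : List Γ) (u w : ListCochain Γ S) :
    dAux br ρ l (u + w) = dAux br ρ l u + dAux br ρ l w := by
  induction l generalizing u w with
  | nil => simp [dAux]
  | cons b l ih => simp only [dAux, map_add, ih, add_apply]; abel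

/-- The differential of cochains for the bracket `br` and the action `ρ`. -/
def d : ListCochain Γ S →+ ListCochain Γ S :=
  AddMonoidHom.mk' (fun u ↦ ⟨fun l ↦ dAux br ρ l u⟩) fun u w ↦ by
    refine ext_apply fun l ↦ ?_; exact dAux_add br ρ l u w

@[simp] theorem d_nil (u : ListCochain Γ S) : d br ρ u [] = 0 := rfl

/-- Cartan's formula `i_a d = L_a - d i_a`, here the definition of `d`. That it gives the Koszul
differential on forms is `d_toListCochain`. -/
theorem contract_d (a : Γ) (u : ListCochain Γ S) :
    contract a (d br ρ u) = lie br ρ a u - d br ρ (contract a u) := rfl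

theorem d_invol (u : ListCochain Γ S) : d br ρ (invol u) = -invol (d br ρ u) := by
  refine ext_apply fun l ↦ ?_
  induction l generalizing u with
  | nil => simp
  | cons a l ih =>
    rw [← contract_apply, ← contract_apply]
    rw [map_neg, contract_d, contract_invol, contract_invol, contract_d, map_sub, map_neg,
      lie_invol]
    simp [ih, sub_eq_add_neg]

/-- After contraction, Cartan's formula and the derivation properties of `L_a` and `i_a` reduce the
claim to shorter lists. Neither the Jacobi identity nor `d ∘ d = 0` enters. -/
theorem d_mul (hρ : ∀ a s t, ρ a (s * t) = ρ a s * t + s * ρ a t) (u w : ListCochain Γ S) :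
    d br ρ (u * w) = d br ρ u * w + invol u * d br ρ w := by
  refine ext_apply fun l ↦ ?_
  induction l generalizing u w with
  | nil => simp
  | cons a l ih =>
    rw [← contract_apply, ← contract_apply]
    simp only [contract_d, contract_mul, map_add, add_apply, sub_apply, ih, lie_mul br ρ hρ,
      d_invol, contract_invol, sub_mul, mul_sub, neg_mul, neg_apply, invol_invol]
    abel

theorem d_const_of_eq_zero {s : S} (hs : ∀ a, ρ a s = 0) : d br ρ (const s) = 0 := by
  have hlie : ∀ a, lie br ρ a (const s) = 0 := by
    intro a
    refine ext_apply fun l ↦ ?_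
    cases l with
    | nil => simp [hs]
    | cons b l =>
      rw [← contract_apply, ← contract_apply]
      simp [contract_lie]
  refine ext_apply fun l ↦ ?_
  cases l with
  | nil => simp
  | cons a l =>
    rw [← contract_apply, ← contract_apply]
    simp [contract_d, hlie]

variable {br ρ}

/-- The differential is natural in the values. The instances that matter are the trace, its integral
over a family, and the inclusion of constants into polynomials. -/
theorem map_d {ρ' : Γ → T →+ T} (f : S →+ T) (hf : ∀ a s, f (ρ a s) = ρ' a (f s))
    (u : ListCochain Γ S) : map f (d br ρ u) = d br ρ' (map f u) := by
  have hlie : ∀ a (u : ListCochain Γ S), map f (lie br ρ a u) = lie br ρ' a (map f u) := by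
    intro a u
    refine ext_apply fun l ↦ ?_
    induction l generalizing u with
    | nil => simp [hf]
    | cons b l ih =>
      rw [← contract_apply, ← contract_apply]
      simp only [contract_map, contract_lie, map_sub, sub_apply, ih]
  refine ext_apply fun l ↦ ?_
  induction l generalizing u with
  | nil => simp
  | cons a l ih =>
    rw [← contract_apply, ← contract_apply]
    simp only [contract_map, contract_d, map_sub, sub_apply, ih, hlie]

/-- The differential for an action which is changed by an inner derivation. -/
theorem d_twist {ρ' : Γ → S →+ S} {β : ListCochain Γ S}
    (hβ : ∀ a, contract a β = const (β [a])) (hβ₀ : β [] = 0)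
    (hρ : ∀ a s, ρ' a s = ρ a s + (β [a] * s - s * β [a])) (u : ListCochain Γ S) :
    d br ρ' u = d br ρ u + (β * u - invol u * β) := by
  -- The hypotheses on `β` say that it lives in degree one, hence is odd: contractions of it are
  -- constants, and it is zero on the empty list.
  have hβ₁ : invol β = -β := by
    refine ext_apply fun l ↦ ?_
    match l with
    | [] => simp [hβ₀]
    | [a] => simp [invol_apply]
    | a :: b :: l =>
      have : contract a β (b :: l) = 0 := by rw [hβ, const_cons]
      rw [contract_apply] at this
      simp [invol_apply, this]
  have hlie : ∀ a (u : ListCochain Γ S), lie br ρ' a u =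
      lie br ρ a u + (const (β [a]) * u - u * const (β [a])) := by
    intro a u
    refine ext_apply fun l ↦ ?_
    induction l generalizing u with
    | nil => simp [hρ]
    | cons b l ih =>
      rw [← contract_apply, ← contract_apply]
      simp only [contract_lie, map_add, map_sub, contract_mul, sub_apply, add_apply, ih,
        contract_const, zero_mul, mul_zero, invol_const]
      simp
      abel
  refine ext_apply fun l ↦ ?_
  induction l generalizing u with
  | nil => simp [hβ₀]
  | cons a l ih =>
    rw [← contract_apply, ← contract_apply]
    simp only [contract_d, map_add, map_sub, contract_mul, sub_apply, add_apply, ih, hlie, hβ,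
      hβ₁, contract_invol, invol_invol, neg_mul, neg_apply]
    abel

end Differential

end ListCochain

/-! ### Alternating maps as cochains on lists -/

namespace AlternatingMap

open ListCochain

section ToListCochain

variable {C Γ S T : Type*} [CommRing C] [AddCommGroup Γ] [Module C Γ] [Ring S] [Algebra C S]
  [Ring T] [Algebra C T] {n : ℕ}

/-- The cochain on lists given by an alternating map. -/
def toListCochain (u : Γ [⋀^Fin n]→ₗ[C] S) : ListCochain Γ S where
  toFun l := if h : l.length = n then u fun i ↦ l.get (i.cast h.symm) else 0

theorem exists_eq_ofFn {l : List Γ} (h : l.length = n) : ∃ v : Fin n → Γ, l = List.ofFn v := by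
  subst h
  exact ⟨l.get, (List.ofFn_get l).symm⟩

@[simp] theorem toListCochain_ofFn (u : Γ [⋀^Fin n]→ₗ[C] S) (v : Fin n → Γ) :
    u.toListCochain (List.ofFn v) = u v := by
  have h : (List.ofFn v).length = n := List.length_ofFn
  refine (dif_pos h).trans (congrArg u ?_)
  ext i
  simp

theorem toListCochain_of_length_ne (u : Γ [⋀^Fin n]→ₗ[C] S) {l : List Γ} (h : l.length ≠ n) :
    u.toListCochain l = 0 :=
  dif_neg h

theorem toListCochain_cons (u : Γ [⋀^Fin (n + 1)]→ₗ[C] S) (a : Γ) (v : Fin n → Γ) :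
    u.toListCochain (a :: List.ofFn v) = u (Fin.cons a v) := by
  rw [← toListCochain_ofFn u (Fin.cons a v), List.ofFn_succ]
  simp

/-- Closedness and exactness of forms can therefore be tested in the ring of cochains. -/
theorem toListCochain_injective :
    Function.Injective (toListCochain : (Γ [⋀^Fin n]→ₗ[C] S) → ListCochain Γ S) := by
  intro u w h
  ext v
  rw [← toListCochain_ofFn, h, toListCochain_ofFn]

/-- A cochain which is supported on lists of length `n` and agrees there with an alternating
map. -/
theorem toListCochain_eq {u : Γ [⋀^Fin n]→ₗ[C] S} {w : ListCochain Γ S}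
    (h : ∀ l : List Γ, l.length ≠ n → w l = 0) (h' : ∀ v : Fin n → Γ, w (List.ofFn v) = u v) :
    u.toListCochain = w := by
  refine ext_apply fun l ↦ ?_
  by_cases hl : l.length = n
  · obtain ⟨v, rfl⟩ := exists_eq_ofFn hl
    rw [toListCochain_ofFn, h']
  · rw [toListCochain_of_length_ne u hl, h l hl]

theorem toListCochain_add (u w : Γ [⋀^Fin n]→ₗ[C] S) :
    (u + w).toListCochain = u.toListCochain + w.toListCochain :=
  toListCochain_eq (fun l hl ↦ by simp [toListCochain_of_length_ne _ hl]) fun v ↦ by simp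

theorem toListCochain_zero : (0 : Γ [⋀^Fin n]→ₗ[C] S).toListCochain = 0 :=
  toListCochain_eq (fun l hl ↦ by simp) fun v ↦ by simp

theorem toListCochain_sub (u w : Γ [⋀^Fin n]→ₗ[C] S) :
    (u - w).toListCochain = u.toListCochain - w.toListCochain :=
  toListCochain_eq (fun l hl ↦ by simp [toListCochain_of_length_ne _ hl]) fun v ↦ by simp

theorem toListCochain_compAlternatingMap (f : S →ₗ[C] T) (u : Γ [⋀^Fin n]→ₗ[C] S) :
    (f.compAlternatingMap u).toListCochain = ListCochain.map (f : S →+ T) u.toListCochain :=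
  toListCochain_eq (fun l hl ↦ by simp [toListCochain_of_length_ne _ hl]) fun v ↦ by simp

theorem toListCochain_constOfIsEmpty (s : S) :
    (constOfIsEmpty C Γ (Fin 0) s).toListCochain = ListCochain.const s :=
  toListCochain_eq (fun l hl ↦ by
    cases l with
    | nil => simp at hl
    | cons a l => simp) fun v ↦ by simp

theorem contract_toListCochain (a : Γ) (u : Γ [⋀^Fin (n + 1)]→ₗ[C] S) :
    contract a u.toListCochain = (u.curryLeft a).toListCochain := by
  refine (toListCochain_eq (fun l hl ↦ ?_) fun v ↦ ?_).symm
  · rw [contract_apply, toListCochain_of_length_ne]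
    simpa using hl
  · rw [contract_apply, toListCochain_cons]
    rfl

theorem contract_toListCochain_zero (a : Γ) (u : Γ [⋀^Fin 0]→ₗ[C] S) :
    contract a u.toListCochain = 0 := by
  refine ext_apply fun l ↦ ?_
  rw [contract_apply, toListCochain_of_length_ne _ (by simp), ListCochain.zero_apply]

theorem invol_toListCochain (u : Γ [⋀^Fin n]→ₗ[C] S) :
    invol u.toListCochain = (-1 : ℤ) ^ n • u.toListCochain := by
  refine ext_apply fun l ↦ ?_
  by_cases hl : l.length = n
  · rw [invol_apply, hl, zsmul_apply, zsmul_eq_mul]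
    push_cast
    rfl
  · rw [invol_apply, zsmul_apply, toListCochain_of_length_ne u hl, mul_zero, _root_.smul_zero]

end ToListCochain

/-! ### The shuffle product and the wedge product -/

section Wedge

variable {Γ S : Type*}

/-- A permutation is recorded by the place `p` where `a` lands and by the order of the other
entries; bringing `a` from the front to the place `p` is a cycle of sign `(-1)^p`. -/
theorem sum_perm_cons [AddCommGroup S] {n : ℕ} (g : (Fin (n + 1) → Γ) → S) (a : Γ)
    (v : Fin n → Γ) :
    ∑ σ : Equiv.Perm (Fin (n + 1)), Equiv.Perm.sign σ • g (Fin.cons a v ∘ σ) =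
      ∑ p : Fin (n + 1), (-1 : ℤˣ) ^ (p : ℕ) • ∑ τ : Equiv.Perm (Fin n),
        Equiv.Perm.sign τ • g (p.insertNth a (v ∘ τ)) := by
  let φ : Fin (n + 1) × Equiv.Perm (Fin n) → Equiv.Perm (Fin (n + 1)) := fun x ↦
    Equiv.Perm.decomposeFin.symm (0, x.2) * x.1.cycleRange
  have hφ : Function.Bijective φ := by
    rw [Fintype.bijective_iff_injective_and_card]
    constructor
    · rintro ⟨p, τ⟩ ⟨p', τ'⟩ h
      have h0 : ∀ x : Fin (n + 1) × Equiv.Perm (Fin n), (φ x).symm 0 = x.1 := by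
        rintro ⟨p, τ⟩
        rw [Equiv.symm_apply_eq]
        simp [φ]
      have hp : p = p' := by
        have := h0 (p, τ)
        rw [h, h0] at this
        exact this.symm
      subst hp
      simpa [φ] using h
    · simp [Fintype.card_perm, Nat.factorial_succ]
  rw [← Equiv.sum_comp (Equiv.ofBijective φ hφ), Fintype.sum_prod_type]
  refine Finset.sum_congr rfl fun p _ ↦ ?_
  rw [Finset.smul_sum]
  refine Finset.sum_congr rfl fun τ _ ↦ ?_
  have h1 : Equiv.Perm.sign (φ (p, τ)) = (-1) ^ (p : ℕ) * Equiv.Perm.sign τ := by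
    simp [φ, Fin.sign_cycleRange, mul_comm]
  have h2 : (Fin.cons a v : Fin (n + 1) → Γ) ∘ φ (p, τ) = p.insertNth a (v ∘ τ) := by
    ext i
    rcases Fin.eq_self_or_eq_succAbove p i with rfl | ⟨j, rfl⟩
    · simp [φ]
    · simp [φ]
  rw [Equiv.ofBijective_apply, h1, h2, smul_smul]

variable {C : Type*} [CommRing C] [AddCommGroup Γ] [Module C Γ] [Ring S] [Algebra C S]

/-- This and the next three lemmas are the index bookkeeping for `sum_perm_eq_shuffle`: an entry
inserted at a place of one block of arguments is inserted into that block and leaves the other block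
unchanged. -/
theorem insertNth_castAdd {m n N : ℕ} (h : m + 1 + n = N + 1) (h' : m + n = N) (i : Fin (m + 1))
    (a : Γ) (v : Fin N → Γ) :
    (fun j : Fin (m + 1) ↦ (Fin.insertNth (Fin.cast h (Fin.castAdd n i)) a v : Fin (N + 1) → Γ)
      (Fin.cast h (Fin.castAdd n j))) =
      i.insertNth a fun j ↦ v (Fin.cast h' (Fin.castAdd n j)) := by
  ext j
  rcases Fin.eq_self_or_eq_succAbove i j with rfl | ⟨j, rfl⟩
  · simp
  · have : Fin.cast h (Fin.castAdd n (i.succAbove j)) =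
        (Fin.cast h (Fin.castAdd n i)).succAbove (Fin.cast h' (Fin.castAdd n j)) := by
      ext
      simp only [Fin.succAbove, Fin.lt_def, Fin.val_cast, Fin.val_castAdd, Fin.val_castSucc]
      split_ifs <;> simp
    simp [this]

theorem insertNth_castAdd_natAdd {m n N : ℕ} (h : m + 1 + n = N + 1) (h' : m + n = N)
    (i : Fin (m + 1)) (a : Γ) (v : Fin N → Γ) :
    (fun j : Fin n ↦ (Fin.insertNth (Fin.cast h (Fin.castAdd n i)) a v : Fin (N + 1) → Γ)
      (Fin.cast h (Fin.natAdd (m + 1) j))) = fun j ↦ v (Fin.cast h' (Fin.natAdd m j)) := by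
  ext j
  have : Fin.cast h (Fin.natAdd (m + 1) j) =
      (Fin.cast h (Fin.castAdd n i)).succAbove (Fin.cast h' (Fin.natAdd m j)) := by
    ext
    simp only [Fin.succAbove, Fin.lt_def, Fin.val_cast, Fin.val_castAdd, Fin.val_castSucc,
      Fin.val_natAdd]
    split_ifs <;> simp <;> omega
  simp [this]

theorem insertNth_natAdd {m n N : ℕ} (h : m + (n + 1) = N + 1) (h' : m + n = N) (i : Fin (n + 1))
    (a : Γ) (v : Fin N → Γ) :
    (fun j : Fin (n + 1) ↦ (Fin.insertNth (Fin.cast h (Fin.natAdd m i)) a v : Fin (N + 1) → Γ)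
      (Fin.cast h (Fin.natAdd m j))) =
      i.insertNth a fun j ↦ v (Fin.cast h' (Fin.natAdd m j)) := by
  ext j
  rcases Fin.eq_self_or_eq_succAbove i j with rfl | ⟨j, rfl⟩
  · simp
  · have : Fin.cast h (Fin.natAdd m (i.succAbove j)) =
        (Fin.cast h (Fin.natAdd m i)).succAbove (Fin.cast h' (Fin.natAdd m j)) := by
      ext
      simp only [Fin.succAbove, Fin.lt_def, Fin.val_cast, Fin.val_natAdd, Fin.val_castSucc]
      split_ifs <;> simp <;> omega
    simp [this]

theorem insertNth_natAdd_castAdd {m n N : ℕ} (h : m + (n + 1) = N + 1) (h' : m + n = N)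
    (i : Fin (n + 1)) (a : Γ) (v : Fin N → Γ) :
    (fun j : Fin m ↦ (Fin.insertNth (Fin.cast h (Fin.natAdd m i)) a v : Fin (N + 1) → Γ)
      (Fin.cast h (Fin.castAdd (n + 1) j))) = fun j ↦ v (Fin.cast h' (Fin.castAdd n j)) := by
  ext j
  have : Fin.cast h (Fin.castAdd (n + 1) j) =
      (Fin.cast h (Fin.natAdd m i)).succAbove (Fin.cast h' (Fin.castAdd n j)) := by
    ext
    simp only [Fin.succAbove, Fin.lt_def, Fin.val_cast, Fin.val_castAdd, Fin.val_castSucc,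
      Fin.val_natAdd]
    split_ifs <;> simp <;> omega
  simp [this]

/-- The shuffle product is the normalised antisymmetrisation of the tensor product. -/
theorem sum_perm_eq_shuffle {N m n : ℕ} (h : m + n = N) (u : Γ [⋀^Fin m]→ₗ[C] S)
    (w : Γ [⋀^Fin n]→ₗ[C] S) (v : Fin N → Γ) :
    ∑ σ : Equiv.Perm (Fin N), Equiv.Perm.sign σ •
        (u (fun i ↦ (v ∘ σ) (Fin.cast h (Fin.castAdd n i))) *
          w fun j ↦ (v ∘ σ) (Fin.cast h (Fin.natAdd m j))) =
      (m.factorial * n.factorial) • (u.toListCochain * w.toListCochain) (List.ofFn v) := by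
  induction N generalizing m n with
  | zero =>
    obtain ⟨rfl, rfl⟩ : m = 0 ∧ n = 0 := by omega
    have h1 : List.ofFn v = [] := by simp
    rw [h1, mul_nil, ← List.ofFn_zero (f := (v : Fin 0 → Γ)), toListCochain_ofFn,
      toListCochain_ofFn, Fintype.sum_unique]
    rw [Subsingleton.elim default (1 : Equiv.Perm (Fin 0)), Equiv.Perm.sign_one, one_smul,
      Nat.factorial_zero, mul_one, one_smul]
    congr 2 <;> exact Subsingleton.elim _ _
  | succ N ih =>
    obtain ⟨a, v, rfl⟩ : ∃ a v', v = Fin.cons a v' := ⟨v 0, Fin.tail v, (Fin.cons_self_tail v).symm⟩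
    have hl : List.ofFn (Fin.cons a v : Fin (N + 1) → Γ) = a :: List.ofFn v := by
      rw [List.ofFn_succ]; simp
    -- The sum over the place of the first entry `a` splits into the places in the block of `u` and
    -- those in the block of `w`, matching the two terms of `mul_cons`.
    rw [hl, mul_cons, invol_toListCochain, sum_perm_cons (fun v ↦
      u (fun i ↦ v (Fin.cast h (Fin.castAdd n i))) * w fun j ↦ v (Fin.cast h (Fin.natAdd m j))),
      ← Equiv.sum_comp (finCongr h), Fin.sum_univ_add, smul_add]
    congr 1
    · cases m with
      | zero => simp [contract_toListCochain_zero]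
      | succ m =>
        have h' : m + n = N := by omega
        -- Each of the `m + 1` places in the block contributes the same amount: the sign of the
        -- place cancels the sign of moving `a` to the front of `u`.
        rw [contract_toListCochain, Nat.factorial_succ, mul_assoc, mul_smul,
          ← ih h' (u.curryLeft a) w v, ← Fin.sum_const (m + 1)]
        refine Finset.sum_congr rfl fun i _ ↦ ?_
        rw [Finset.smul_sum]
        refine Finset.sum_congr rfl fun τ _ ↦ ?_
        rw [finCongr_apply, insertNth_castAdd h h', insertNth_castAdd_natAdd h h', map_insertNth]
        rw [smul_comm, Fin.val_cast, Fin.val_castAdd, smul_mul_assoc]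
        rcases Nat.even_or_odd (i : ℕ) with hi | hi <;>
          simp [hi.neg_one_pow, curryLeft_apply_apply]
    · cases n with
      | zero => simp [contract_toListCochain_zero]
      | succ n =>
        have h' : m + n = N := by omega
        rw [contract_toListCochain, Nat.factorial_succ, mul_left_comm, mul_smul, smul_mul_assoc,
          zsmul_apply, smul_comm _ ((-1 : ℤ) ^ m),
          ← ih h' u (w.curryLeft a) v, ← Fin.sum_const (n + 1)]
        refine Finset.sum_congr rfl fun i _ ↦ ?_
        rw [Finset.smul_sum, Finset.smul_sum]
        refine Finset.sum_congr rfl fun τ _ ↦ ?_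
        rw [finCongr_apply, insertNth_natAdd h h', insertNth_natAdd_castAdd h h', map_insertNth]
        -- Of the sign `(-1)^(m+i)`, the factor `(-1)^i` moves `a` to the front of `w`, and `(-1)^m`
        -- is the one in `invol u`.
        rw [Fin.val_cast, Fin.val_natAdd, pow_add]
        rcases Nat.even_or_odd (i : ℕ) with hi | hi <;>
        rcases Nat.even_or_odd m with hm | hm <;>
          simp [hi.neg_one_pow, hm.neg_one_pow, curryLeft_apply_apply]

theorem nsmul_cancel [Algebra ℝ C] {k : ℕ} (hk : k ≠ 0) {s t : S} (h : k • s = k • t) :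
    s = t := by
  have h1 : algebraMap ℝ C (k : ℝ)⁻¹ * (k : C) = 1 := by
    rw [← map_natCast (algebraMap ℝ C) k, ← map_mul, inv_mul_cancel₀ (by exact_mod_cast hk),
      map_one]
  have h2 : ∀ r : S, algebraMap ℝ C (k : ℝ)⁻¹ • k • r = r := by
    intro r
    rw [← Nat.cast_smul_eq_nsmul C, smul_smul, h1, one_smul]
  rw [← h2 s, h, h2]

/-- Multiplied by `m! n!`, both sides are the antisymmetrised tensor product: one by
`MultilinearMap.domCoprod_alternization_eq`, the other by `sum_perm_eq_shuffle`. The factor cancels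
since `C` is a real algebra. On lists of other lengths the shuffle product is zero because each
contraction lowers the degree of one factor. -/
theorem toListCochain_wedge [Algebra ℝ C] {m n : ℕ} (u : Γ [⋀^Fin m]→ₗ[C] S)
    (w : Γ [⋀^Fin n]→ₗ[C] S) :
    (((LinearMap.mul' C S).compAlternatingMap (u.domCoprod w)).domDomCongr
      finSumFinEquiv).toListCochain = u.toListCochain * w.toListCochain := by
  refine toListCochain_eq (fun l hl ↦ ?_) fun v ↦ ?_
  · induction l generalizing m n with
    | nil =>
      rw [mul_nil]
      by_cases hm : m = 0
      · rw [toListCochain_of_length_ne w, mul_zero]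
        rintro h
        simp [hm, ← h] at hl
      · rw [toListCochain_of_length_ne u (by simpa using Ne.symm hm), zero_mul]
    | cons a l ih =>
      rw [mul_cons, invol_toListCochain, smul_mul_assoc, zsmul_apply]
      have h1 : (contract a u.toListCochain * w.toListCochain) l = 0 := by
        cases m with
        | zero => rw [contract_toListCochain_zero, zero_mul, ListCochain.zero_apply]
        | succ m =>
          rw [contract_toListCochain, ih]
          simp at hl
          omega
      have h2 : (u.toListCochain * contract a w.toListCochain) l = 0 := by
        cases n with
        | zero => rw [contract_toListCochain_zero, mul_zero, ListCochain.zero_apply]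
        | succ n =>
          rw [contract_toListCochain, ih]
          simp at hl
          omega
      rw [h1, h2, smul_zero, add_zero]
  · refine nsmul_cancel (C := C) (k := m.factorial * n.factorial) (by positivity) ?_
    rw [← sum_perm_eq_shuffle rfl]
    have h1 := congrArg (fun f ↦ f (v ∘ finSumFinEquiv))
      (MultilinearMap.domCoprod_alternization_eq u w)
    rw [Fintype.card_fin, Fintype.card_fin] at h1
    have h2 := congrArg (LinearMap.mul' C S) h1
    simp only [AlternatingMap.smul_apply, map_nsmul] at h2
    rw [AlternatingMap.domDomCongr_apply, LinearMap.compAlternatingMap_apply]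
    refine Eq.trans ?_ h2
    rw [MultilinearMap.alternatization_apply, map_sum,
      ← Equiv.sum_comp (Equiv.permCongr finSumFinEquiv)]
    refine Finset.sum_congr rfl fun σ _ ↦ ?_
    rw [Equiv.Perm.sign_permCongr, Units.smul_def, Units.smul_def, map_zsmul]
    simp [Equiv.permCongr_apply]

end Wedge

/-! ### The Koszul formula -/

section Koszul

variable {C Γ : Type*} [CommRing C] [AddCommGroup Γ] [Module C Γ]
  (br : Γ → Γ → Γ) (ρ : Γ → C →+ C)

theorem lie_toListCochain_ofFn {n : ℕ} (w : Γ [⋀^Fin n]→ₗ[C] C) (a : Γ) (v : Fin n → Γ) :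
    lie br ρ a w.toListCochain (List.ofFn v) =
      ρ a (w v) - ∑ j, w (Function.update v j (br a (v j))) := by
  induction n with
  | zero =>
    rw [List.ofFn_zero, lie_nil, ← List.ofFn_zero (f := v), toListCochain_ofFn]
    simp
  | succ n ih =>
    obtain ⟨b, v, rfl⟩ : ∃ b v', v = Fin.cons b v' := ⟨v 0, Fin.tail v, (Fin.cons_self_tail v).symm⟩
    have hl : List.ofFn (Fin.cons b v : Fin (n + 1) → Γ) = b :: List.ofFn v := by
      rw [List.ofFn_succ]; simp
    rw [hl, ← contract_apply, contract_lie, ListCochain.sub_apply, contract_toListCochain, ih, contract_apply,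
      toListCochain_cons, Fin.sum_univ_succ]
    simp only [Fin.cons_zero, Fin.update_cons_zero, Fin.cons_succ, ← Fin.cons_update,
      curryLeft_apply_apply, Matrix.vecCons]
    abel

theorem lie_apply_eq_zero {S : Type*} [Ring S] {ρ : Γ → S →+ S} (a : Γ) {u : ListCochain Γ S}
    {l : List Γ} (h : ∀ l' : List Γ, l'.length = l.length → u l' = 0) : lie br ρ a u l = 0 := by
  induction l generalizing u with
  | nil => rw [lie_nil, h [] rfl, _root_.map_zero]
  | cons b l ih =>
    rw [← contract_apply, contract_lie, ListCochain.sub_apply, ih (u := contract b u) fun l' hl' ↦ h _ (by simp [hl']),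
      contract_apply, h _ (by simp), sub_zero]

theorem d_apply_eq_zero {S : Type*} [Ring S] {ρ : Γ → S →+ S} {u : ListCochain Γ S}
    {l : List Γ} (h : ∀ l' : List Γ, l'.length + 1 = l.length → u l' = 0) : d br ρ u l = 0 := by
  induction l generalizing u with
  | nil => rfl
  | cons b l ih =>
    rw [← contract_apply, contract_d, ListCochain.sub_apply, ih (u := contract b u) fun l' hl' ↦ h _ (by simp [hl']),
      lie_apply_eq_zero br b fun l' hl' ↦ h _ (by simp [hl']), sub_zero]

/-- The terms of the Koszul formula with `i = 0` form the Lie derivative along the first entry. The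
terms with `i > 0` are, up to sign, the Koszul formula of the contraction, so Cartan's formula gives
the induction step. -/
theorem d_toListCochain_ofFn {n : ℕ} (w : Γ [⋀^Fin n]→ₗ[C] C) (v : Fin (n + 1) → Γ) :
    d br ρ w.toListCochain (List.ofFn v) =
      LieAlgebroid.koszulFormula br (fun a ↦ ρ a) w v := by
  induction n with
  | zero =>
    obtain ⟨a, v, rfl⟩ : ∃ b v', v = Fin.cons b v' := ⟨v 0, Fin.tail v, (Fin.cons_self_tail v).symm⟩
    have hl : List.ofFn (Fin.cons a v : Fin (0 + 1) → Γ) = a :: List.ofFn v := by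
      rw [List.ofFn_succ]; simp
    rw [hl, ← contract_apply, contract_d, ListCochain.sub_apply, lie_toListCochain_ofFn,
      contract_toListCochain_zero, _root_.map_zero]
    simp [LieAlgebroid.koszulFormula]
  | succ n ih =>
    obtain ⟨a, v, rfl⟩ : ∃ b v', v = Fin.cons b v' := ⟨v 0, Fin.tail v, (Fin.cons_self_tail v).symm⟩
    have hl : List.ofFn (Fin.cons a v : Fin (n + 1 + 1) → Γ) = a :: List.ofFn v := by
      rw [List.ofFn_succ]; simp
    have hrem : ∀ (i : Fin (n + 1)) (v : Fin (n + 1) → Γ),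
        i.succ.removeNth (Fin.cons a v : Fin (n + 1 + 1) → Γ) =
          (Fin.cons a (i.removeNth v) : Fin (n + 1) → Γ) := by
      intro i v
      ext j
      cases j using Fin.cases with
      | zero => simp [Fin.removeNth]
      | succ j => simp [Fin.removeNth]
    rw [hl, ← contract_apply, contract_d, ListCochain.sub_apply, lie_toListCochain_ofFn,
      contract_toListCochain, ih]
    simp only [LieAlgebroid.koszulFormula]
    rw [Fin.sum_univ_succ (n := n + 1), Fin.sum_univ_succ (n := n + 1)]
    simp only [Fin.sum_Ioi_zero, Fin.sum_Ioi_succ, Fin.cons_zero, Fin.cons_succ, ← Fin.cons_update,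
      hrem, curryLeft_apply_apply, Matrix.vecCons]
    have h0 : ∀ v : Fin (n + 1) → Γ,
        Fin.removeNth 0 (Fin.cons a v : Fin (n + 1 + 1) → Γ) = v := by
      intro v; ext j; simp [Fin.removeNth]
    simp only [h0, Fin.val_zero, pow_zero, one_mul, Fin.val_succ, pow_succ, mul_neg_one, neg_mul,
      Finset.sum_neg_distrib]
    ring

theorem d_toListCochain {n : ℕ} {w : Γ [⋀^Fin n]→ₗ[C] C} {w' : Γ [⋀^Fin (n + 1)]→ₗ[C] C}
    (h : ∀ v, w' v = LieAlgebroid.koszulFormula br (fun a ↦ ρ a) w v) :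
    w'.toListCochain = d br ρ w.toListCochain :=
  toListCochain_eq (fun l hl ↦ d_apply_eq_zero br fun l' hl' ↦
    toListCochain_of_length_ne w (by omega)) fun v ↦ by rw [h, d_toListCochain_ofFn]

end Koszul

end AlternatingMap

/-! ### The cochain of the curvature -/

section Curvature

variable {EM : Type*} [NormedAddCommGroup EM] [NormedSpace ℝ EM]
  {H : Type*} [TopologicalSpace H]
  {I : ModelWithCorners ℝ EM H} {M : Type*} [TopologicalSpace M]
  [ChartedSpace H M] [IsManifold I ∞ M]
  {FA : Type*} [NormedAddCommGroup FA] [NormedSpace ℝ FA]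
  {A : M → Type*} [TopologicalSpace (TotalSpace FA A)]
  [∀ x, AddCommGroup (A x)] [∀ x, Module ℝ (A x)] [∀ x, TopologicalSpace (A x)]
  [FiberBundle FA A] [VectorBundle ℝ FA A]
  {F : Type*} [NormedAddCommGroup F] [NormedSpace ℝ F]
  {V : M → Type*} [TopologicalSpace (TotalSpace F V)]
  [∀ x, AddCommGroup (V x)] [∀ x, Module ℝ (V x)] [∀ x, TopologicalSpace (V x)]
  [FiberBundle F V] [VectorBundle ℝ F V]

namespace LieAlgebroid

variable (L : LieAlgebroid I FA A)

/-- The derivative along a section, as an additive map. -/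
def derivHom (a : Cₛ^∞⟮I; FA, A⟯) : SmoothFun I M →+ SmoothFun I M :=
  AddMonoidHom.mk' (L.deriv a) (L.deriv_add a)

@[simp] theorem derivHom_apply (a : Cₛ^∞⟮I; FA, A⟯) (f : SmoothFun I M) :
    L.derivHom a f = L.deriv a f := rfl

theorem derivHom_mul (a : Cₛ^∞⟮I; FA, A⟯) (f g : SmoothFun I M) :
    L.derivHom a (f * g) = L.derivHom a f * g + f * L.derivHom a g := by
  rw [derivHom_apply, L.deriv_mul, add_comm]
  rfl

theorem deriv_one (a : Cₛ^∞⟮I; FA, A⟯) : L.deriv a 1 = 0 := by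
  simpa using L.deriv_const a 1

theorem deriv_sum {ι : Type*} (a : Cₛ^∞⟮I; FA, A⟯) (t : Finset ι) (f : ι → SmoothFun I M) :
    L.deriv a (∑ i ∈ t, f i) = ∑ i ∈ t, L.deriv a (f i) :=
  map_sum (L.derivHom a) f t

/-- Needed because the frame formula for the trace holds only near a point, and it has to be
differentiated there. -/
theorem deriv_congr (a : Cₛ^∞⟮I; FA, A⟯) {f g : SmoothFun I M} {x : M}
    (h : ∀ᶠ y in 𝓝 x, f y = g y) : L.deriv a f x = L.deriv a g x := by
  have h1 : mfderiv I 𝓘(ℝ, ℝ) f x = mfderiv I 𝓘(ℝ, ℝ) g x := EventuallyEq.mfderiv_eq h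
  have h2 : mvfderiv I f x = mvfderiv I g x := by
    ext v
    have h3 := congrArg (fun φ : TangentSpace I x →L[ℝ] ℝ ↦ φ v) h1
    exact h3
  rw [L.deriv_apply, L.deriv_apply, h2]

/-- The differential of cochains with values in `C^∞(M)`. -/
def listD : ListCochain Cₛ^∞⟮I; FA, A⟯ (SmoothFun I M) →+
    ListCochain Cₛ^∞⟮I; FA, A⟯ (SmoothFun I M) :=
  ListCochain.d (fun a b ↦ L.bracket a b) L.derivHom

theorem listD_mul (u w : ListCochain Cₛ^∞⟮I; FA, A⟯ (SmoothFun I M)) :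
    L.listD (u * w) = L.listD u * w + ListCochain.invol u * L.listD w :=
  ListCochain.d_mul _ _ L.derivHom_mul u w

theorem toListCochain_d {n : ℕ} (w : L.Form n) :
    (L.d n w).toListCochain = L.listD w.toListCochain :=
  AlternatingMap.d_toListCochain _ _ fun v ↦ L.d_apply w v

theorem mem_closedForms_iff {n : ℕ} (w : L.Form n) :
    w ∈ L.closedForms n ↔ L.listD w.toListCochain = 0 := by
  rw [← toListCochain_d, closedForms, LinearMap.mem_ker,
    ← AlternatingMap.toListCochain_injective.eq_iff, AlternatingMap.toListCochain_zero]

theorem toListCochain_wedge {S : Type*} [Ring S] [Algebra (SmoothFun I M) S] {m n : ℕ}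
    (u : Cₛ^∞⟮I; FA, A⟯ [⋀^Fin m]→ₗ[SmoothFun I M] S)
    (w : Cₛ^∞⟮I; FA, A⟯ [⋀^Fin n]→ₗ[SmoothFun I M] S) :
    (L.wedge u w).toListCochain = u.toListCochain * w.toListCochain :=
  AlternatingMap.toListCochain_wedge u w

namespace Connection

variable {L} (D : L.Connection F V)

/-- The covariant derivative of endomorphisms, `φ ↦ ∇_a ∘ φ - φ ∘ ∇_a`. -/
def actEnd (a : Cₛ^∞⟮I; FA, A⟯) : Module.End (SmoothFun I M) Cₛ^∞⟮I; F, V⟯ →+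
    Module.End (SmoothFun I M) Cₛ^∞⟮I; F, V⟯ where
  toFun φ :=
    { toFun := fun e ↦ D.nabla a (φ e) - φ (D.nabla a e)
      map_add' := fun e e' ↦ by simp only [map_add]; abel
      map_smul' := fun f e ↦ by
        simp only [map_smul, D.leibniz, map_add, RingHom.id_apply, smul_sub]; abel }
  map_zero' := by ext1 e; simp
  map_add' φ χ := by
    ext1 e
    simp only [LinearMap.coe_mk, AddHom.coe_mk, LinearMap.add_apply, map_add]
    abel

theorem actEnd_apply (a : Cₛ^∞⟮I; FA, A⟯) (φ : Module.End (SmoothFun I M) Cₛ^∞⟮I; F, V⟯)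
    (e : Cₛ^∞⟮I; F, V⟯) : D.actEnd a φ e = D.nabla a (φ e) - φ (D.nabla a e) := rfl

theorem actEnd_mul (a : Cₛ^∞⟮I; FA, A⟯) (φ χ : Module.End (SmoothFun I M) Cₛ^∞⟮I; F, V⟯) :
    D.actEnd a (φ * χ) = D.actEnd a φ * χ + φ * D.actEnd a χ := by
  ext1 e
  simp only [actEnd_apply, LinearMap.add_apply, Module.End.mul_apply, map_sub]
  abel

/-- The differential of cochains with values in the endomorphisms. -/
def listD : ListCochain Cₛ^∞⟮I; FA, A⟯ (Module.End (SmoothFun I M) Cₛ^∞⟮I; F, V⟯) →+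
    ListCochain Cₛ^∞⟮I; FA, A⟯ (Module.End (SmoothFun I M) Cₛ^∞⟮I; F, V⟯) :=
  ListCochain.d (fun a b ↦ L.bracket a b) D.actEnd

theorem listD_mul
    (u w : ListCochain Cₛ^∞⟮I; FA, A⟯ (Module.End (SmoothFun I M) Cₛ^∞⟮I; F, V⟯)) :
    D.listD (u * w) = D.listD u * w + ListCochain.invol u * D.listD w :=
  ListCochain.d_mul _ _ D.actEnd_mul u w

/-- The curvature as a cochain on lists. -/
def listCurvature :
    ListCochain Cₛ^∞⟮I; FA, A⟯ (Module.End (SmoothFun I M) Cₛ^∞⟮I; F, V⟯) :=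
  D.curvature.toListCochain

theorem listCurvature_pair (a b : Cₛ^∞⟮I; FA, A⟯) :
    D.listCurvature [a, b] = D.curvatureEnd a b := by
  have := AlternatingMap.toListCochain_ofFn D.curvature ![a, b]
  rw [List.ofFn_succ, List.ofFn_succ] at this
  exact this

theorem listCurvature_of_length_ne {l : List Cₛ^∞⟮I; FA, A⟯} (hl : l.length ≠ 2) :
    D.listCurvature l = 0 :=
  AlternatingMap.toListCochain_of_length_ne _ hl

theorem invol_listCurvature : ListCochain.invol D.listCurvature = D.listCurvature := by
  rw [listCurvature, AlternatingMap.invol_toListCochain]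
  simp

/-- The Bianchi identity. -/
theorem listD_listCurvature : D.listD D.listCurvature = 0 := by
  refine ListCochain.ext_apply fun l ↦ ?_
  by_cases hl : l.length = 3
  · obtain ⟨a, b, c, rfl⟩ := List.length_eq_three.1 hl
    -- The recursion unfolded on three entries; the terms are those of the Koszul formula.
    have h : D.listD D.listCurvature [a, b, c] =
        D.actEnd a (D.listCurvature [b, c]) - D.listCurvature [b, L.bracket a c]
          - D.listCurvature [L.bracket a b, c]
          - (D.actEnd b (D.listCurvature [a, c]) - D.listCurvature [a, L.bracket b c]
            - (D.actEnd c (D.listCurvature [a, b]) - 0)) := rfl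
    rw [h]
    simp only [listCurvature_pair, ListCochain.zero_apply]
    ext1 e
    -- The terms without a double bracket cancel among themselves; the double brackets cancel by the
    -- Jacobi identity of the algebroid.
    have hj : D.nabla (L.bracket a (L.bracket b c)) e + D.nabla (L.bracket b (L.bracket c a)) e +
        D.nabla (L.bracket c (L.bracket a b)) e = 0 := by
      rw [← LinearMap.add_apply, ← LinearMap.add_apply, ← map_add, ← map_add, L.jacobi]
      simp
    rw [L.bracket_anti c a, L.bracket_anti c (L.bracket a b), map_neg, map_neg, map_neg,
      LinearMap.neg_apply, LinearMap.neg_apply] at hj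
    simp only [LinearMap.sub_apply, actEnd_apply, curvatureEnd_apply, map_sub, sub_zero,
      LinearMap.zero_apply]
    rw [← neg_eq_zero, ← hj]
    abel
  · exact AlternatingMap.d_apply_eq_zero _ fun l' hl' ↦ D.listCurvature_of_length_ne (by omega)

theorem listD_listCurvature_pow (i : ℕ) : D.listD (D.listCurvature ^ i) = 0 := by
  induction i with
  | zero =>
    rw [pow_zero, ListCochain.one_eq_const]
    refine ListCochain.d_const_of_eq_zero _ _ fun a ↦ ?_
    ext1 e
    simp [actEnd_apply]
  | succ i ih => rw [pow_succ, listD_mul, ih, listD_listCurvature]; simp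

theorem toListCochain_curvaturePow (i : ℕ) :
    (D.curvaturePow i).toListCochain = D.listCurvature ^ i := by
  induction i with
  | zero => exact AlternatingMap.toListCochain_constOfIsEmpty _
  | succ i ih =>
    rw [pow_succ, ← ih]
    exact L.toListCochain_wedge _ _

end Connection

end LieAlgebroid

end Curvature

/-! ### Traces -/

section Trace

variable {EM : Type*} [NormedAddCommGroup EM] [NormedSpace ℝ EM] [FiniteDimensional ℝ EM]
  {H : Type*} [TopologicalSpace H]
  {I : ModelWithCorners ℝ EM H} {M : Type*} [TopologicalSpace M]
  [ChartedSpace H M] [IsManifold I ∞ M] [T2Space M]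
  {FA : Type*} [NormedAddCommGroup FA] [NormedSpace ℝ FA]
  {A : M → Type*} [TopologicalSpace (TotalSpace FA A)]
  [∀ x, AddCommGroup (A x)] [∀ x, Module ℝ (A x)] [∀ x, TopologicalSpace (A x)]
  [FiberBundle FA A] [VectorBundle ℝ FA A]
  {F : Type*} [NormedAddCommGroup F] [NormedSpace ℝ F] [FiniteDimensional ℝ F]
  {V : M → Type*} [TopologicalSpace (TotalSpace F V)]
  [∀ x, AddCommGroup (V x)] [∀ x, Module ℝ (V x)] [∀ x, TopologicalSpace (V x)]
  [FiberBundle F V] [VectorBundle ℝ F V] [ContMDiffVectorBundle ∞ F V I]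
  {L : LieAlgebroid I FA A}

theorem bundleTrace_apply (φ : Module.End (SmoothFun I M) Cₛ^∞⟮I; F, V⟯) (x : M) :
    bundleTrace φ x = LinearMap.trace ℝ (V x) (fibreMap x φ) := rfl

theorem fibreMap_mul (φ χ : Module.End (SmoothFun I M) Cₛ^∞⟮I; F, V⟯) (x : M) :
    fibreMap x (φ * χ) = fibreMap x φ * fibreMap x χ := by
  ext v
  obtain ⟨e, rfl⟩ := exists_section_apply_eq (I := I) (F := F) x v
  simp [fibreMap_apply]

theorem bundleTrace_mul_comm (φ χ : Module.End (SmoothFun I M) Cₛ^∞⟮I; F, V⟯) :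
    bundleTrace (φ * χ) = bundleTrace (χ * φ) := by
  ext x
  rw [bundleTrace_apply, bundleTrace_apply, fibreMap_mul, fibreMap_mul, LinearMap.trace_mul_comm]

namespace LieAlgebroid.Connection

variable (D : L.Connection F V)

/-- The trace is compatible with the covariant derivative. -/
theorem bundleTrace_actEnd (a : Cₛ^∞⟮I; FA, A⟯)
    (φ : Module.End (SmoothFun I M) Cₛ^∞⟮I; F, V⟯) :
    bundleTrace (D.actEnd a φ) = L.deriv a (bundleTrace φ) := by
  ext x₀
  obtain ⟨s, c, ψ, U, hU, hψ, hsum, -, hb⟩ := exists_globalFrame (I := I) (F := F) (V := V) x₀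
  have hsum_apply : ∀ (f : Fin (finrank ℝ F) → SmoothFun I M) (x : M),
      (∑ i, f i) x = ∑ i, f i x := fun f x ↦
    map_sum (ContMDiffMap.evalRingHom (I := I) (n := ∞) (R := ℝ) (I' := 𝓘(ℝ, ℝ)) x)
      f Finset.univ
  -- The formula is needed on all of `U`, since the trace is to be differentiated at `x₀`.
  have htr : ∀ (χ : Module.End (SmoothFun I M) Cₛ^∞⟮I; F, V⟯), ∀ x ∈ U,
      bundleTrace χ x = (∑ i, c i (χ (s i))) x := by
    intro χ x hx
    obtain ⟨b, hbs, hbc⟩ := hb x hx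
    rw [bundleTrace_apply, LinearMap.trace_eq_matrix_trace ℝ b, hsum_apply, Matrix.trace]
    refine Finset.sum_congr rfl fun i _ ↦ ?_
    rw [Matrix.diag_apply, LinearMap.toMatrix_apply, hbs, fibreMap_apply, hbc]
  have hx₀ : x₀ ∈ U := mem_of_mem_nhds hU
  have hnabla : ∀ e : Cₛ^∞⟮I; F, V⟯, D.nabla a e x₀ =
      ∑ i, (c i e x₀ • D.nabla a (s i) x₀ + L.deriv a (c i e) x₀ • s i x₀) := by
    intro e
    -- As `ψ = 1` near `x₀`, replacing `e` by `ψ • e`, which has a global expansion in the frame,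
    -- does not change `∇_a e` at `x₀`.
    have hd : L.deriv a ψ x₀ = 0 := by
      rw [L.deriv_congr (g := 1) a (mem_of_superset hU fun y hy ↦ hψ y hy), L.deriv_one]
      rfl
    have h1 : D.nabla a (ψ • e) x₀ = D.nabla a e x₀ := by
      rw [D.leibniz, ContMDiffSection.coe_add, Pi.add_apply,
        ContMDiffSection.smulSmoothFun_apply, ContMDiffSection.smulSmoothFun_apply,
        hψ x₀ hx₀, hd, one_smul, zero_smul, add_zero]
    rw [← h1, hsum, map_sum, ContMDiffSection.finsetSum_apply]
    refine Finset.sum_congr rfl fun i _ ↦ ?_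
    rw [D.leibniz]
    rfl
  have hφ : ∀ e : Cₛ^∞⟮I; F, V⟯, φ e x₀ = ∑ i, c i e x₀ • φ (s i) x₀ := by
    intro e
    have h1 : φ (ψ • e) x₀ = φ e x₀ := by
      rw [map_smul, ContMDiffSection.smulSmoothFun_apply, hψ x₀ hx₀, one_smul]
    rw [← h1, hsum, map_sum, ContMDiffSection.finsetSum_apply]
    refine Finset.sum_congr rfl fun i _ ↦ ?_
    rw [map_smul]
    rfl
  obtain ⟨b, hbs, hbc⟩ := hb x₀ hx₀
  rw [htr _ x₀ hx₀, L.deriv_congr a (mem_of_superset hU (htr φ)), L.deriv_sum, hsum_apply,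
    hsum_apply]
  -- The diagonal entries of the derivative of the matrix of `φ` plus its commutator with the
  -- connection matrix. The commutator has trace zero, by exchanging the two sums below.
  have hterm : ∀ j, c j (D.actEnd a φ (s j)) x₀ = L.deriv a (c j (φ (s j))) x₀ +
      (∑ i, c i (φ (s j)) x₀ * c j (D.nabla a (s i)) x₀ -
        ∑ i, c i (D.nabla a (s j)) x₀ * c j (φ (s i)) x₀) := by
    intro j
    rw [← hbc, actEnd_apply, ContMDiffSection.coe_sub, Pi.sub_apply, hnabla, hφ (D.nabla a (s j))]
    simp only [map_sub, map_sum, map_add, map_smul, Finsupp.sub_apply, Finsupp.finsetSum_apply,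
      Finsupp.add_apply, Finsupp.smul_apply, hbc, ← hbs, Basis.repr_self, smul_eq_mul,
      Finset.sum_add_distrib, Finsupp.single_apply]
    simp
    ring
  simp only [hterm, Finset.sum_add_distrib, Finset.sum_sub_distrib]
  rw [Finset.sum_comm (f := fun j i ↦ c i (D.nabla a (s j)) x₀ * c j (φ (s i)) x₀)]
  simp [mul_comm]

/-- The trace as an additive map. -/
abbrev traceHom : Module.End (SmoothFun I M) Cₛ^∞⟮I; F, V⟯ →+ SmoothFun I M :=
  (bundleTrace : Module.End (SmoothFun I M) Cₛ^∞⟮I; F, V⟯ →ₗ[SmoothFun I M] SmoothFun I M)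

theorem map_trace_listD
    (u : ListCochain Cₛ^∞⟮I; FA, A⟯ (Module.End (SmoothFun I M) Cₛ^∞⟮I; F, V⟯)) :
    ListCochain.map traceHom (D.listD u) = L.listD (ListCochain.map traceHom u) :=
  ListCochain.map_d _ (fun a φ ↦ D.bundleTrace_actEnd a φ) u

theorem toListCochain_traceForm (i : ℕ) :
    (D.traceForm i).toListCochain = ListCochain.map traceHom (D.listCurvature ^ i) := by
  rw [← toListCochain_curvaturePow]
  exact AlternatingMap.toListCochain_compAlternatingMap _ _

theorem listD_traceForm (i : ℕ) : L.listD (D.traceForm i).toListCochain = 0 := by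
  rw [toListCochain_traceForm, ← map_trace_listD, listD_listCurvature_pow, map_zero]

variable {D}

theorem IsTraceMonomial.even {l : ℕ} {w : L.Form l} (hw : D.IsTraceMonomial l w) : Even l := by
  induction hw with
  | one => exact Even.zero
  | mul hw hi ih => exact ih.add (even_two_mul _)

theorem IsTraceMonomial.invol {l : ℕ} {w : L.Form l} (hw : D.IsTraceMonomial l w) :
    ListCochain.invol w.toListCochain = w.toListCochain := by
  rw [AlternatingMap.invol_toListCochain, hw.even.neg_one_pow, one_smul]

/-- Each `tr(R^i)` is closed, because the trace commutes with the differentials and `R^i` is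
covariantly closed by the Bianchi identity; the Leibniz rule does the rest. -/
theorem IsTraceMonomial.listD {l : ℕ} {w : L.Form l} (hw : D.IsTraceMonomial l w) :
    L.listD w.toListCochain = 0 := by
  induction hw with
  | one =>
    rw [AlternatingMap.toListCochain_constOfIsEmpty]
    exact ListCochain.d_const_of_eq_zero _ _ L.deriv_one
  | mul hw hi ih =>
    rw [toListCochain_wedge, LieAlgebroid.listD_mul, ih, listD_traceForm, zero_mul, mul_zero, add_zero]

theorem IsTraceMonomial.mem_closedForms {l : ℕ} {w : L.Form l} (hw : D.IsTraceMonomial l w) :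
    w ∈ L.closedForms l :=
  (L.mem_closedForms_iff w).2 hw.listD

end LieAlgebroid.Connection

end Trace

/-! ### Cochains which come from alternating maps -/

namespace ListCochain

/-- The push-forward along a ring homomorphism. -/
def mapRingHom {Γ S T : Type*} [Ring S] [Ring T] (f : S →+* T) :
    ListCochain Γ S →+* ListCochain Γ T :=
  { map (f : S →+ T) with
    map_one' := map_ringHom_one f
    map_mul' := map_ringHom_mul f }

@[simp] theorem mapRingHom_apply {Γ S T : Type*} [Ring S] [Ring T] (f : S →+* T)
    (u : ListCochain Γ S) (l : List Γ) : mapRingHom f u l = f (u l) := rfl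

section IsForm

variable (C : Type*) {Γ S T : Type*} [CommRing C] [Algebra ℝ C] [AddCommGroup Γ] [Module C Γ]
  [Ring S] [Algebra C S] [Ring T] [Algebra C T]

/-- `u` comes from an alternating map of degree `n`. -/
def IsForm (n : ℕ) (u : ListCochain Γ S) : Prop :=
  ∃ w : Γ [⋀^Fin n]→ₗ[C] S, w.toListCochain = u

variable {C} {m n : ℕ} {u v : ListCochain Γ S}

theorem isForm_toListCochain (w : Γ [⋀^Fin n]→ₗ[C] S) : IsForm C n w.toListCochain := ⟨w, rfl⟩

theorem isForm_zero : IsForm C n (0 : ListCochain Γ S) := ⟨0, AlternatingMap.toListCochain_zero⟩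

theorem isForm_const (s : S) : IsForm C 0 (const s : ListCochain Γ S) :=
  ⟨_, AlternatingMap.toListCochain_constOfIsEmpty s⟩

theorem IsForm.add (hu : IsForm C n u) (hv : IsForm C n v) : IsForm C n (u + v) := by
  obtain ⟨u, rfl⟩ := hu
  obtain ⟨v, rfl⟩ := hv
  exact ⟨u + v, AlternatingMap.toListCochain_add u v⟩

theorem IsForm.sub (hu : IsForm C n u) (hv : IsForm C n v) : IsForm C n (u - v) := by
  obtain ⟨u, rfl⟩ := hu
  obtain ⟨v, rfl⟩ := hv
  exact ⟨u - v, AlternatingMap.toListCochain_sub u v⟩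

theorem IsForm.nsmul (hu : IsForm C n u) (k : ℕ) : IsForm C n (k • u) := by
  induction k with
  | zero => rw [zero_smul]; exact isForm_zero
  | succ k ih => rw [add_smul, one_smul]; exact ih.add hu

/-- With the closure properties around it, this ensures that a primitive assembled in the ring of
cochains is a genuine form, as exactness in `H(A)` requires. -/
theorem IsForm.mul (hu : IsForm C m u) (hv : IsForm C n v) : IsForm C (m + n) (u * v) := by
  obtain ⟨u, rfl⟩ := hu
  obtain ⟨v, rfl⟩ := hv
  exact ⟨_, AlternatingMap.toListCochain_wedge u v⟩

theorem IsForm.congr (hu : IsForm C m u) (h : m = n) : IsForm C n u := h ▸ hu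

theorem IsForm.pow (hu : IsForm C 2 u) (i : ℕ) : IsForm C (2 * i) (u ^ i) := by
  induction i with
  | zero => exact isForm_const 1
  | succ i ih => rw [pow_succ]; exact ih.mul hu

theorem IsForm.map (hu : IsForm C n u) (f : S →ₗ[C] T) :
    IsForm C n (ListCochain.map (f : S →+ T) u) := by
  obtain ⟨u, rfl⟩ := hu
  exact ⟨_, AlternatingMap.toListCochain_compAlternatingMap f u⟩

end IsForm

end ListCochain

/-! ### Polynomials over a noncommutative ring -/

namespace Polynomial

section MapCoeff

variable {S : Type*} [Ring S]

/-- Apply an additive map to the coefficients of a polynomial. -/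
def mapCoeff (f : S →+ S) : S[X] →+ S[X] :=
  AddMonoidHom.mk' (fun p ↦ p.sum fun n c ↦ monomial n (f c)) fun p q ↦
    sum_add_index p q _ (by simp) (by simp)

@[simp] theorem mapCoeff_monomial (f : S →+ S) (n : ℕ) (c : S) :
    mapCoeff f (monomial n c) = monomial n (f c) :=
  sum_monomial_index c (fun n c ↦ monomial n (f c)) (by simp)

theorem mapCoeff_mul {f : S →+ S} (hf : ∀ s t, f (s * t) = f s * t + s * f t) (p q : S[X]) :
    mapCoeff f (p * q) = mapCoeff f p * q + p * mapCoeff f q := by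
  induction p using Polynomial.induction_on' with
  | add p p' hp hp' => simp only [add_mul, map_add, hp, hp']; abel
  | monomial n a =>
    induction q using Polynomial.induction_on' with
    | add q q' hq hq' => simp only [mul_add, map_add, hq, hq']; abel
    | monomial m b => simp [monomial_mul_monomial, hf]

/-- Evaluation at `r`, an element of the centre. -/
def evalHom (r : S) (hr : ∀ s, Commute s r) : S[X] →+* S :=
  eval₂RingHom' (RingHom.id S) r hr

end MapCoeff

end Polynomial

/-! ### Transgression for polynomial families -/

namespace ListCochain

open Polynomial

section Family

variable {Γ S : Type*} [Ring S]

/-- The cochain `X`. -/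
abbrev polyX : ListCochain Γ S[X] := const X

/-- Constant families. -/
abbrev polyC : ListCochain Γ S →+* ListCochain Γ S[X] := mapRingHom Polynomial.C

/-- The parameter is central and has degree zero, so it passes other cochains without a sign. -/
theorem mul_polyX_mul (u w : ListCochain Γ S[X]) : u * (polyX * w) = polyX * (u * w) := by
  have h : u * polyX = polyX * u := by
    refine ext_apply fun l ↦ ?_
    rw [mul_const_apply, const_mul_apply, X_mul]
  rw [← mul_assoc, h, mul_assoc]

theorem invol_polyC (u : ListCochain Γ S) : invol (polyC u) = polyC (invol u) :=
  invol_map _ u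

/-- The derivative of families. -/
abbrev polyDerivative : ListCochain Γ S[X] →+ ListCochain Γ S[X] :=
  map (derivative (R := S)).toAddMonoidHom

theorem polyDerivative_mul (u w : ListCochain Γ S[X]) :
    polyDerivative (u * w) = polyDerivative u * w + u * polyDerivative w :=
  map_derivation_mul _ (fun _ _ ↦ derivative_mul) u w

theorem polyDerivative_polyC (u : ListCochain Γ S) : polyDerivative (polyC u) = 0 :=
  ext_apply fun _ ↦ derivative_C

theorem polyDerivative_polyX : polyDerivative (polyX : ListCochain Γ S[X]) = 1 := by
  refine ext_apply fun l ↦ ?_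
  rw [one_eq_const, map_apply]
  cases l <;> simp

/-- The value of a family at a central element. -/
abbrev polyEval (r : S) (hr : ∀ s, Commute s r) : ListCochain Γ S[X] →+* ListCochain Γ S :=
  mapRingHom (Polynomial.evalHom r hr)

theorem polyEval_polyC (r : S) (hr : ∀ s, Commute s r) (u : ListCochain Γ S) :
    polyEval r hr (polyC u) = u :=
  ext_apply fun _ ↦ eval₂_C _ _

theorem polyEval_polyX (r : S) (hr : ∀ s, Commute s r) :
    polyEval r hr (polyX : ListCochain Γ S[X]) = const r := by
  refine ext_apply fun l ↦ ?_
  rw [mapRingHom_apply]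
  cases l <;> simp [Polynomial.evalHom]

/-- The curvature `r + X e + X² α²` of a family of connections. -/
def familyCurvature (r e α : ListCochain Γ S) : ListCochain Γ S[X] :=
  polyC r + polyX * polyC e + polyX * (polyX * (polyC α * polyC α))

theorem polyEval_zero_familyCurvature (r e α : ListCochain Γ S) :
    polyEval 0 Commute.zero_right (familyCurvature r e α) = r := by
  rw [familyCurvature, map_add, map_add, map_mul, map_mul, polyEval_polyX, polyEval_polyC]
  simp

theorem polyEval_one_familyCurvature (r e α : ListCochain Γ S) :
    polyEval 1 Commute.one_right (familyCurvature r e α) = r + e + α * α := by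
  rw [familyCurvature, map_add, map_add, map_mul, map_mul, map_mul, map_mul, polyEval_polyX,
    polyEval_polyC, polyEval_polyC, polyEval_polyC, ← one_eq_const, one_mul, one_mul, one_mul]

theorem polyDerivative_familyCurvature (r e α : ListCochain Γ S) :
    polyDerivative (familyCurvature r e α) =
      polyC e + (polyX * (polyC α * polyC α) + polyX * (polyC α * polyC α)) := by
  rw [familyCurvature, map_add, map_add, polyDerivative_polyC, polyDerivative_mul,
    polyDerivative_mul, polyDerivative_mul, polyDerivative_mul, polyDerivative_polyC,
    polyDerivative_polyC, polyDerivative_polyX]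
  simp

theorem invol_familyCurvature {r e α : ListCochain Γ S} (hr : invol r = r) (he : invol e = e)
    (hα : invol α = -α) : invol (familyCurvature r e α) = familyCurvature r e α := by
  rw [familyCurvature, map_add, map_add, invol_mul, invol_mul, invol_mul, invol_mul, invol_polyC,
    invol_polyC, invol_polyC, invol_const, hr, he, hα, map_neg, neg_mul_neg]

/-- The action of the family `ρ + X ad(α)`. -/
def familyAct (ρ : Γ → S →+ S) (α : ListCochain Γ S) (a : Γ) : S[X] →+ S[X] :=
  mapCoeff (ρ a) + (AddMonoidHom.mulLeft (X * Polynomial.C (α [a])) -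
    AddMonoidHom.mulRight (X * Polynomial.C (α [a])))

theorem familyAct_apply (ρ : Γ → S →+ S) (α : ListCochain Γ S) (a : Γ) (p : S[X]) :
    familyAct ρ α a p = mapCoeff (ρ a) p +
      (X * Polynomial.C (α [a]) * p - p * (X * Polynomial.C (α [a]))) := rfl

variable (br : Γ → Γ → Γ) {ρ : Γ → S →+ S} {α r : ListCochain Γ S}

theorem familyAct_mul
    (hρ : ∀ a s t, ρ a (s * t) = ρ a s * t + s * ρ a t) (a : Γ) (p q : S[X]) :
    familyAct ρ α a (p * q) = familyAct ρ α a p * q + p * familyAct ρ α a q := by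
  simp only [familyAct_apply, mapCoeff_mul (hρ a), mul_add, add_mul, mul_sub, sub_mul, mul_assoc]
  abel

theorem familyD_mul (hρ : ∀ a s t, ρ a (s * t) = ρ a s * t + s * ρ a t)
    (u w : ListCochain Γ S[X]) : d br (familyAct ρ α) (u * w) =
    d br (familyAct ρ α) u * w + invol u * d br (familyAct ρ α) w :=
  d_mul _ _ (familyAct_mul hρ) u w

theorem mapCoeff_act_one (hρ : ∀ a s t, ρ a (s * t) = ρ a s * t + s * ρ a t) (a : Γ) : mapCoeff (ρ a) 1 = 0 ∧ mapCoeff (ρ a) X = 0 := by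
  have h : ρ a 1 = 0 := by simpa using hρ a 1 1
  rw [← monomial_zero_one, ← monomial_one_one_eq_X, mapCoeff_monomial, mapCoeff_monomial, h]
  simp

theorem familyD_polyX (hρ : ∀ a s t, ρ a (s * t) = ρ a s * t + s * ρ a t) : d br (familyAct ρ α) polyX = 0 := by
  refine d_const_of_eq_zero _ _ fun a ↦ ?_
  rw [familyAct_apply, (mapCoeff_act_one hρ a).2, X_mul (p := X * _), sub_self, add_zero]

/-- This is `d_twist` with the inner part `X α`, since the untwisted differential commutes with the
inclusion of constants. -/
theorem familyD_polyC (hα₀ : α [] = 0) (hα : ∀ a, contract a α = const (α [a]))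
    (u : ListCochain Γ S) : d br (familyAct ρ α) (polyC u) =
    polyC (d br ρ u) + (polyX * polyC α * polyC u - invol (polyC u) * (polyX * polyC α)) := by
  have h1 : polyC (d br ρ u) = d br (fun a ↦ mapCoeff (ρ a)) (polyC u) :=
    map_d (ρ' := fun a ↦ mapCoeff (ρ a)) (Polynomial.C : S →+* S[X]).toAddMonoidHom
      (fun a s ↦ (mapCoeff_monomial (ρ a) 0 s).symm) u
  have hβ : ∀ a, (polyX * polyC α : ListCochain Γ S[X]) [a] = X * Polynomial.C (α [a]) := by
    intro a
    rw [const_mul_apply, mapRingHom_apply]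
  rw [h1]
  refine d_twist (fun a ↦ ?_) (by simp [hα₀]) (fun a s ↦ by rw [hβ]; rfl) _
  refine ext_apply fun l ↦ ?_
  rw [hβ, contract_apply, const_mul_apply, mapRingHom_apply, ← contract_apply, hα]
  cases l <;> simp

/-- As `α` is odd, its graded commutator with itself is `2 α²`. The right hand side is thus that of
`polyDerivative_familyCurvature` with `e = d α`: the curvature of the family moves by `d_X α`. -/
theorem familyD_polyC_self (hα₀ : α [] = 0)
    (hα : ∀ a, contract a α = const (α [a])) (hα₁ : invol α = -α) : d br (familyAct ρ α) (polyC α) =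
    polyC (d br ρ α) + (polyX * (polyC α * polyC α) + polyX * (polyC α * polyC α)) := by
  rw [familyD_polyC br hα₀ hα, invol_polyC, hα₁, map_neg, neg_mul, sub_neg_eq_add, mul_assoc,
    mul_polyX_mul]

theorem invol_d_of_odd (hα₁ : invol α = -α) : invol (d br ρ α) = d br ρ α := by
  have h := d_invol br ρ α
  rw [hα₁, map_neg] at h
  exact (neg_injective h).symm

/-- The Bianchi identity along the family, by powers of `X`: `d r = 0`; then `d d α` cancels `α r -
r α`; then `d(α²)` cancels `α dα - dα α`; and `α` commutes with `α²`. -/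
theorem familyD_familyCurvature (hρ : ∀ a s t, ρ a (s * t) = ρ a s * t + s * ρ a t)
    (hα₀ : α [] = 0) (hα : ∀ a, contract a α = const (α [a])) (hα₁ : invol α = -α)
    (hr : invol r = r) (hdr : d br ρ r = 0)
    (hddα : d br ρ (d br ρ α) = r * α - α * r) :
    d br (familyAct ρ α) (familyCurvature r (d br ρ α) α) = 0 := by
  have h1 := familyD_polyC br (ρ := ρ) hα₀ hα r
  have h2 := familyD_polyC br (ρ := ρ) hα₀ hα (d br ρ α)
  have h3 := familyD_polyC_self br (ρ := ρ) hα₀ hα hα₁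
  have h4 := familyD_polyX br hρ (α := α)
  have h5 : invol (polyC α) = -polyC α := by rw [invol_polyC, hα₁, map_neg]
  rw [hdr, invol_polyC, hr, map_zero, zero_add] at h1
  rw [hddα, invol_polyC, invol_d_of_odd br hα₁, map_sub, map_mul, map_mul] at h2
  rw [familyCurvature]
  simp only [map_add, familyD_mul br hρ, h1, h2, h3, h4, h5, invol_const]
  have hc := mul_polyX_mul (Γ := Γ) (S := S)
  simp only [mul_add, add_mul, mul_sub, sub_mul, mul_assoc, hc (polyC _), zero_mul, neg_mul,
    mul_neg, mul_zero]
  abel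

theorem familyD_familyCurvature_pow
    (hρ : ∀ a s t, ρ a (s * t) = ρ a s * t + s * ρ a t)
    (hα₀ : α [] = 0) (hα : ∀ a, contract a α = const (α [a])) (hα₁ : invol α = -α)
    (hr : invol r = r) (hdr : d br ρ r = 0)
    (hddα : d br ρ (d br ρ α) = r * α - α * r) (i : ℕ) :
    d br (familyAct ρ α) (familyCurvature r (d br ρ α) α ^ i) = 0 := by
  induction i with
  | zero =>
    rw [pow_zero, one_eq_const]
    refine d_const_of_eq_zero _ _ fun a ↦ ?_
    rw [familyAct_apply, (mapCoeff_act_one hρ a).1, mul_one, one_mul, sub_self, add_zero]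
  | succ i ih =>
    rw [pow_succ, familyD_mul br hρ, ih, familyD_familyCurvature br hρ hα₀ hα hα₁ hr hdr hddα]
    simp

end Family

section Transgression

variable {C Γ S : Type*} [CommRing C] [Algebra ℝ C] [AddCommGroup Γ] [Module C Γ]
  [Ring S] [Algebra C S]

/-- The integral over `[0, 1]` of the trace of a polynomial family. -/
def traceIntegral (tr : S →ₗ[C] C) : S[X] →ₗ[C] C :=
  Polynomial.lsum fun n ↦ algebraMap ℝ C ((n : ℝ) + 1)⁻¹ • tr

theorem traceIntegral_monomial (tr : S →ₗ[C] C) (n : ℕ) (φ : S) :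
    traceIntegral tr (monomial n φ) = algebraMap ℝ C ((n : ℝ) + 1)⁻¹ * tr φ :=
  sum_monomial_index φ (fun n φ ↦ (algebraMap ℝ C ((n : ℝ) + 1)⁻¹ • tr) φ) (by simp)

theorem traceIntegral_mul_comm {tr : S →ₗ[C] C} (htr : ∀ s t, tr (s * t) = tr (t * s))
    (p q : S[X]) : traceIntegral tr (p * q) = traceIntegral tr (q * p) := by
  induction p using Polynomial.induction_on' with
  | add p p' hp hp' => simp only [add_mul, mul_add, map_add, hp, hp']
  | monomial n a =>
    induction q using Polynomial.induction_on' with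
    | add q q' hq hq' => simp only [add_mul, mul_add, map_add, hq, hq']
    | monomial m b =>
      rw [monomial_mul_monomial, monomial_mul_monomial, traceIntegral_monomial,
        traceIntegral_monomial, htr, add_comm n m]

/-- The fundamental theorem of calculus, checked on monomials. -/
theorem traceIntegral_derivative (tr : S →ₗ[C] C) (p : S[X]) :
    traceIntegral tr (derivative p) =
      tr (Polynomial.evalHom 1 Commute.one_right p) -
        tr (Polynomial.evalHom 0 Commute.zero_right p) := by
  induction p using Polynomial.induction_on' with
  | add p p' hp hp' => simp only [map_add, hp, hp']; abel
  | monomial n a =>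
    rw [derivative_monomial, traceIntegral_monomial]
    cases n with
    | zero => simp [Polynomial.evalHom]
    | succ n =>
      have h : algebraMap ℝ C ((n : ℝ) + 1)⁻¹ * ((n + 1 : ℕ) : C) = 1 := by
        rw [← map_natCast (algebraMap ℝ C), ← map_mul, Nat.cast_succ,
          inv_mul_cancel₀ (by positivity), map_one]
      rw [← nsmul_eq_mul', map_nsmul, nsmul_eq_mul, ← mul_assoc, Nat.add_sub_cancel, h]
      simp [Polynomial.evalHom]

/-- The trace does not see the commutator with `X α`, so the integrated trace intertwines the whole
family of covariant derivatives with one action on `C`. -/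
theorem traceIntegral_familyAct {tr : S →ₗ[C] C} (htr : ∀ s t, tr (s * t) = tr (t * s))
    {ρ : Γ → S →+ S} {δ : Γ → C →+ C} (hδ : ∀ a (x : ℝ) f,
      δ a (algebraMap ℝ C x * f) = algebraMap ℝ C x * δ a f)
    (htrδ : ∀ a s, tr (ρ a s) = δ a (tr s)) (α : ListCochain Γ S) (a : Γ) (p : S[X]) :
    traceIntegral tr (familyAct ρ α a p) = δ a (traceIntegral tr p) := by
  rw [familyAct_apply, map_add, map_sub, traceIntegral_mul_comm htr p, sub_self, add_zero]
  induction p using Polynomial.induction_on' with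
  | add p p' hp hp' => simp only [map_add, hp, hp']
  | monomial n φ =>
    rw [mapCoeff_monomial, traceIntegral_monomial, traceIntegral_monomial, hδ, htrδ]

theorem isForm_polyC {n : ℕ} {u : ListCochain Γ S} (hu : IsForm C n u) :
    IsForm C n (polyC u) :=
  hu.map
    { toFun := Polynomial.C
      map_add' := fun _ _ ↦ Polynomial.C_add
      map_smul' := fun f φ ↦ (smul_C f φ).symm }

theorem isForm_familyCurvature {r e α : ListCochain Γ S} (hr : IsForm C 2 r) (he : IsForm C 2 e)
    (hα : IsForm C 1 α) : IsForm C 2 (familyCurvature r e α) := by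
  have hx : IsForm C 0 (polyX : ListCochain Γ S[X]) := isForm_const X
  exact ((isForm_polyC hr).add ((hx.mul (isForm_polyC he)).congr (zero_add 2))).add
    ((hx.mul (hx.mul ((isForm_polyC hα).mul (isForm_polyC hα)))).congr (by norm_num))

/-- The traces of the powers of the curvature change by an exact form if the connection changes. -/
theorem exists_map_trace_pow_sub_eq {tr : S →ₗ[C] C} (htr : ∀ s t, tr (s * t) = tr (t * s))
    (br : Γ → Γ → Γ) {ρ : Γ → S →+ S} (hρ : ∀ a s t, ρ a (s * t) = ρ a s * t + s * ρ a t)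
    {δ : Γ → C →+ C} (hδ : ∀ a (x : ℝ) f, δ a (algebraMap ℝ C x * f) = algebraMap ℝ C x * δ a f)
    (htrδ : ∀ a s, tr (ρ a s) = δ a (tr s))
    {α r : ListCochain Γ S} (hα₀ : α [] = 0) (hα : ∀ a, contract a α = const (α [a]))
    (hα₁ : invol α = -α) (hr : invol r = r) (hdr : d br ρ r = 0)
    (hddα : d br ρ (d br ρ α) = r * α - α * r)
    (hfα : IsForm C 1 α) (hfr : IsForm C 2 r) (hfe : IsForm C 2 (d br ρ α)) (i : ℕ) :
    ∃ u, IsForm C (1 + 2 * i) u ∧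
      map (tr : S →+ C) ((r + d br ρ α + α * α) ^ (i + 1)) - map (tr : S →+ C) (r ^ (i + 1)) =
        d br δ u := by
  set R := familyCurvature r (d br ρ α) α with hR
  let τ : ListCochain Γ S[X] →+ ListCochain Γ C := map (traceIntegral tr : S[X] →+ C)
  -- The Chern–Simons type form `(i+1) ∫ tr(α R_X^i)` over `[0, 1]`.
  refine ⟨(i + 1) • τ (polyC α * R ^ i),
    IsForm.nsmul (((isForm_polyC hfα).mul ((isForm_familyCurvature hfr hfe hfα).pow i)).map _) _,
    ?_⟩
  have h1 : ∀ u : ListCochain Γ S[X], τ (polyDerivative u) =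
      map (tr : S →+ C) (polyEval 1 Commute.one_right u) -
        map (tr : S →+ C) (polyEval 0 Commute.zero_right u) :=
    fun u ↦ ext_apply fun l ↦ traceIntegral_derivative tr (u l)
  have h2 : ∀ u : ListCochain Γ S[X], τ (d br (familyAct ρ α) u) = d br δ (τ u) :=
    fun u ↦ map_d _ (traceIntegral_familyAct htr hδ htrδ α) u
  have h3 : invol R = R := invol_familyCurvature hr (invol_d_of_odd br hα₁) hα₁
  have h4 : polyDerivative R = d br (familyAct ρ α) (polyC α) := by
    rw [hR, polyDerivative_familyCurvature, familyD_polyC_self br hα₀ hα hα₁]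
  have h5 := map_trace_derivation_pow (traceIntegral tr : S[X] →+ C)
    (traceIntegral_mul_comm htr) polyDerivative polyDerivative_mul h3 (by rw [invol_map, h3]) i
  have h6 := h1 (R ^ (i + 1))
  rw [map_pow (polyEval 1 Commute.one_right), map_pow (polyEval 0 Commute.zero_right),
    polyEval_one_familyCurvature, polyEval_zero_familyCurvature] at h6
  -- Since `d_X (R^i) = 0`, the differential of the primitive keeps only `d_X α * R^i`, which is `R'
  -- * R^i`.
  rw [map_nsmul, ← h2, familyD_mul br hρ,
    familyD_familyCurvature_pow br hρ hα₀ hα hα₁ hr hdr hddα, mul_zero, add_zero, ← h4, ← h6]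
  exact h5

end Transgression

end ListCochain

/-! ### Independence of the connection -/

section Transgression

variable {EM : Type*} [NormedAddCommGroup EM] [NormedSpace ℝ EM]
  {H : Type*} [TopologicalSpace H]
  {I : ModelWithCorners ℝ EM H} {M : Type*} [TopologicalSpace M]
  [ChartedSpace H M] [IsManifold I ∞ M]
  {FA : Type*} [NormedAddCommGroup FA] [NormedSpace ℝ FA]
  {A : M → Type*} [TopologicalSpace (TotalSpace FA A)]
  [∀ x, AddCommGroup (A x)] [∀ x, Module ℝ (A x)] [∀ x, TopologicalSpace (A x)]
  [FiberBundle FA A] [VectorBundle ℝ FA A]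
  {F : Type*} [NormedAddCommGroup F] [NormedSpace ℝ F]
  {V : M → Type*} [TopologicalSpace (TotalSpace F V)]
  [∀ x, AddCommGroup (V x)] [∀ x, Module ℝ (V x)] [∀ x, TopologicalSpace (V x)]
  [FiberBundle F V] [VectorBundle ℝ F V]
  {L : LieAlgebroid I FA A}

namespace LieAlgebroid.Connection

open ListCochain Polynomial

variable (D D₁ : L.Connection F V)

/-- The difference of two connections. -/
def diffEnd : Cₛ^∞⟮I; FA, A⟯ →ₗ[SmoothFun I M] Module.End (SmoothFun I M) Cₛ^∞⟮I; F, V⟯ where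
  toFun a :=
    { toFun := fun e ↦ D.nabla a e - D₁.nabla a e
      map_add' := fun e e' ↦ by simp only [map_add]; abel
      map_smul' := fun f e ↦ by
        simp only [D.leibniz, D₁.leibniz, RingHom.id_apply, smul_sub]; abel }
  map_add' a b := by
    ext1 e
    simp only [LinearMap.coe_mk, AddHom.coe_mk, map_add, LinearMap.add_apply]
    abel
  map_smul' f a := by
    ext1 e
    simp [smul_sub]

theorem diffEnd_apply (a : Cₛ^∞⟮I; FA, A⟯) (e : Cₛ^∞⟮I; F, V⟯) :
    D.diffEnd D₁ a e = D.nabla a e - D₁.nabla a e := rfl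

/-- The difference of two connections as a cochain on lists. -/
def listDiff : ListCochain Cₛ^∞⟮I; FA, A⟯ (Module.End (SmoothFun I M) Cₛ^∞⟮I; F, V⟯) :=
  (AlternatingMap.ofSubsingleton (SmoothFun I M) _ _ (0 : Fin 1) (D.diffEnd D₁)).toListCochain

theorem isForm_listDiff : IsForm (SmoothFun I M) 1 (D.listDiff D₁) := ⟨_, rfl⟩

theorem listDiff_nil : D.listDiff D₁ [] = 0 :=
  AlternatingMap.toListCochain_of_length_ne _ (by simp)

theorem listDiff_singleton (a : Cₛ^∞⟮I; FA, A⟯) : D.listDiff D₁ [a] = D.diffEnd D₁ a := by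
  have := AlternatingMap.toListCochain_ofFn
    (AlternatingMap.ofSubsingleton (SmoothFun I M) _ _ (0 : Fin 1) (D.diffEnd D₁)) ![a]
  rw [List.ofFn_succ] at this
  exact this

theorem contract_listDiff (a : Cₛ^∞⟮I; FA, A⟯) :
    contract a (D.listDiff D₁) = const (D.listDiff D₁ [a]) := by
  refine ext_apply fun l ↦ ?_
  cases l with
  | nil => rw [const_nil]; rfl
  | cons b l =>
    rw [const_cons, contract_apply]
    exact AlternatingMap.toListCochain_of_length_ne _ (by simp)

theorem invol_listDiff : invol (D.listDiff D₁) = -D.listDiff D₁ := by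
  rw [listDiff, AlternatingMap.invol_toListCochain]
  simp

theorem listD_eq (u : ListCochain Cₛ^∞⟮I; FA, A⟯ (Module.End (SmoothFun I M) Cₛ^∞⟮I; F, V⟯)) :
    D.listD u = D₁.listD u + (D.listDiff D₁ * u - invol u * D.listDiff D₁) := by
  refine d_twist (D.contract_listDiff D₁) (D.listDiff_nil D₁) (fun a φ ↦ ?_) u
  ext1 e
  simp only [listDiff_singleton, LinearMap.add_apply, LinearMap.sub_apply, actEnd_apply,
    Module.End.mul_apply, diffEnd_apply, map_sub]
  abel

/-- With `α = D - D₁` this is `R = R₁ + d₁ α + α ∧ α`, the value at `1` of the family curvature. -/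
theorem listCurvature_eq : D.listCurvature =
    D₁.listCurvature + D₁.listD (D.listDiff D₁) + D.listDiff D₁ * D.listDiff D₁ := by
  refine ext_apply fun l ↦ ?_
  by_cases hl : l.length = 2
  · obtain ⟨a, b, rfl⟩ := List.length_eq_two.1 hl
    have h1 : D₁.listD (D.listDiff D₁) [a, b] = D₁.actEnd a (D.listDiff D₁ [b]) -
        D.listDiff D₁ [L.bracket a b] - (D₁.actEnd b (D.listDiff D₁ [a]) - 0) := rfl
    rw [ListCochain.add_apply, ListCochain.add_apply, h1, mul_cons, contract_listDiff,
      const_mul_apply, mul_const_apply, invol_listDiff, ListCochain.neg_apply,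
      listCurvature_pair, listCurvature_pair]
    simp only [listDiff_singleton]
    ext1 e
    simp only [LinearMap.add_apply, LinearMap.sub_apply, actEnd_apply, neg_mul,
      LinearMap.neg_apply, curvatureEnd_apply, Module.End.mul_apply, diffEnd_apply, map_sub,
      sub_zero]
    abel
  · have h1 : D₁.listD (D.listDiff D₁) l = 0 :=
      AlternatingMap.d_apply_eq_zero _ fun l' hl' ↦
        AlternatingMap.toListCochain_of_length_ne _ (by omega)
    obtain ⟨w, hw⟩ := (D.isForm_listDiff D₁).mul (D.isForm_listDiff D₁)
    rw [ListCochain.add_apply, ListCochain.add_apply, h1, ← hw,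
      AlternatingMap.toListCochain_of_length_ne w hl, D.listCurvature_of_length_ne hl,
      D₁.listCurvature_of_length_ne hl]
    simp

/-- This is read off from the Bianchi identity of `D`, expressed through `D₁` and the difference, so
the square of the differential need not be computed in general. -/
theorem listD_listD_listDiff : D₁.listD (D₁.listD (D.listDiff D₁)) =
    D₁.listCurvature * D.listDiff D₁ - D.listDiff D₁ * D₁.listCurvature := by
  have h := D.listD_listCurvature
  rw [D.listD_eq D₁, D.invol_listCurvature, D.listCurvature_eq D₁, map_add, map_add,
    D₁.listD_listCurvature, listD_mul, invol_listDiff] at h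
  rw [← sub_eq_zero, ← h]
  noncomm_ring

end LieAlgebroid.Connection

end Transgression

/-! ### Trace forms and Pontryagin classes of two connections -/

section TraceTransgression

variable {EM : Type*} [NormedAddCommGroup EM] [NormedSpace ℝ EM] [FiniteDimensional ℝ EM]
  {H : Type*} [TopologicalSpace H]
  {I : ModelWithCorners ℝ EM H} {M : Type*} [TopologicalSpace M]
  [ChartedSpace H M] [IsManifold I ∞ M] [T2Space M]
  {FA : Type*} [NormedAddCommGroup FA] [NormedSpace ℝ FA]
  {A : M → Type*} [TopologicalSpace (TotalSpace FA A)]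
  [∀ x, AddCommGroup (A x)] [∀ x, Module ℝ (A x)] [∀ x, TopologicalSpace (A x)]
  [FiberBundle FA A] [VectorBundle ℝ FA A]
  {F : Type*} [NormedAddCommGroup F] [NormedSpace ℝ F] [FiniteDimensional ℝ F]
  {V : M → Type*} [TopologicalSpace (TotalSpace F V)]
  [∀ x, AddCommGroup (V x)] [∀ x, Module ℝ (V x)] [∀ x, TopologicalSpace (V x)]
  [FiberBundle F V] [VectorBundle ℝ F V] [ContMDiffVectorBundle ∞ F V I]
  {L : LieAlgebroid I FA A}

namespace LieAlgebroid.Connection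

open ListCochain Polynomial

variable (D D₁ : L.Connection F V)

theorem exists_traceForm_sub_traceForm_eq (i : ℕ) :
    ∃ u, IsForm (SmoothFun I M) (1 + 2 * i) u ∧
      (D.traceForm (i + 1)).toListCochain - (D₁.traceForm (i + 1)).toListCochain =
        L.listD u := by
  have hR : IsForm (SmoothFun I M) 2 D.listCurvature := ⟨_, rfl⟩
  have hR₁ : IsForm (SmoothFun I M) 2 D₁.listCurvature := ⟨_, rfl⟩
  have hα := D.isForm_listDiff D₁
  -- Solved for the derivative of `α`, the curvature formula shows that it is a form of degree two.
  have hd : D₁.listD (D.listDiff D₁) =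
      D.listCurvature - D₁.listCurvature - D.listDiff D₁ * D.listDiff D₁ := by
    rw [D.listCurvature_eq D₁]
    abel
  rw [toListCochain_traceForm, toListCochain_traceForm, D.listCurvature_eq D₁]
  refine exists_map_trace_pow_sub_eq bundleTrace_mul_comm _ D₁.actEnd_mul (fun a x f ↦ ?_)
    D₁.bundleTrace_actEnd (D.listDiff_nil D₁) (D.contract_listDiff D₁) (D.invol_listDiff D₁)
    D₁.invol_listCurvature D₁.listD_listCurvature (D.listD_listD_listDiff D₁) hα hR₁ ?_ i
  · rw [← Algebra.smul_def, ← Algebra.smul_def]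
    exact L.deriv_real_smul a x f
  · have := (hR.sub hR₁).sub (hα.mul hα)
    rwa [← hd] at this

variable {D}

/-- From `w - w₁ = d u` and `t - t₁ = d v` one gets `w t - w₁ t₁ = d(u t + w₁ v)`, as `t` and `w₁`
are closed and `w₁` is even. Degree zero is kept apart: there the monomials agree and no degree is
left for a primitive. -/
theorem IsTraceMonomial.exists_sub_eq {l : ℕ} {w : L.Form l} (hw : D.IsTraceMonomial l w) :
    ∃ w₁ : L.Form l, D₁.IsTraceMonomial l w₁ ∧ ∃ u, (l = 0 → u = 0) ∧
      (∀ n, n + 1 = l → IsForm (SmoothFun I M) n u) ∧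
      w.toListCochain - w₁.toListCochain = L.listD u := by
  induction hw with
  | one => exact ⟨_, IsTraceMonomial.one, 0, fun _ ↦ rfl, fun n hn ↦ isForm_zero, by simp⟩
  | @mul l w hw i hi ih =>
    obtain ⟨w₁, hw₁, u, hu₀, hu, hd⟩ := ih
    obtain ⟨i, rfl⟩ : ∃ j, i = j + 1 := ⟨i - 1, by omega⟩
    obtain ⟨v, hv, hvd⟩ := D.exists_traceForm_sub_traceForm_eq D₁ i
    refine ⟨_, hw₁.mul hi, u * (D.traceForm (i + 1)).toListCochain + w₁.toListCochain * v,
      fun h ↦ by omega, fun n hn ↦ IsForm.add ?_ ?_, ?_⟩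
    · cases l with
      | zero => rw [hu₀ rfl, zero_mul]; exact isForm_zero
      | succ l => exact ((hu l rfl).mul (isForm_toListCochain _)).congr (by omega)
    · exact ((isForm_toListCochain w₁).mul hv).congr (by omega)
    · rw [map_add, LieAlgebroid.listD_mul, LieAlgebroid.listD_mul, listD_traceForm, ← hd, ← hvd,
        hw₁.listD, hw₁.invol, toListCochain_wedge, toListCochain_wedge]
      noncomm_ring

/-- If all trace monomials of one connection vanish in degree `l`, then the Pontryagin space
vanishes in this degree. -/
theorem pontryaginSpace_eq_bot {l : ℕ} (hl : l ≠ 0)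
    (h : ∀ w : L.Form l, D₁.IsTraceMonomial l w → w = 0) : L.pontryaginSpace F V l = ⊥ := by
  rw [pontryaginSpace, Submodule.span_eq_bot]
  rintro _ ⟨D, w, hw, hDw, rfl⟩
  obtain ⟨w₁, hw₁, u, -, hu, hd⟩ := hDw.exists_sub_eq D₁
  obtain ⟨l, rfl⟩ := Nat.exists_eq_succ_of_ne_zero hl
  obtain ⟨v, rfl⟩ := hu l rfl
  rw [h w₁ hw₁, AlternatingMap.toListCochain_zero, sub_zero, ← toListCochain_d] at hd
  exact SubQuotient.mk_eq_zero.2 ⟨v, (AlternatingMap.toListCochain_injective hd).symm⟩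

end LieAlgebroid.Connection

end TraceTransgression

/-! ### Frames with linear coefficients -/

section Frames

variable {EM : Type*} [NormedAddCommGroup EM] [NormedSpace ℝ EM] [FiniteDimensional ℝ EM]
  {H : Type*} [TopologicalSpace H]
  {I : ModelWithCorners ℝ EM H} {M : Type*} [TopologicalSpace M] [ChartedSpace H M]
  [IsManifold I ∞ M] [T2Space M]
  {F : Type*} [NormedAddCommGroup F] [NormedSpace ℝ F] [FiniteDimensional ℝ F]
  {V : M → Type*} [TopologicalSpace (TotalSpace F V)]
  [∀ x, AddCommGroup (V x)] [∀ x, Module ℝ (V x)] [∀ x, TopologicalSpace (V x)]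
  [FiberBundle F V] [VectorBundle ℝ F V] [ContMDiffVectorBundle ∞ F V I]

theorem ContMDiffMap.finsetSum_apply {ι : Type*} (t : Finset ι) (f : ι → SmoothFun I M) (x : M) :
    (∑ i ∈ t, f i) x = ∑ i ∈ t, f i x :=
  map_sum (ContMDiffMap.evalRingHom (I := I) (n := ∞) (R := ℝ) (I' := 𝓘(ℝ, ℝ)) x) f t

theorem exists_smoothFun_eventually_eq_one {x₀ : M} {U : Set M} (hU : U ∈ 𝓝 x₀) :
    ∃ χ : SmoothFun I M, χ x₀ = 1 ∧ ∀ x, x ∉ U → χ x = 0 := by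
  obtain ⟨f, -, hf⟩ := (SmoothBumpFunction.nhds_basis_tsupport (I := I) x₀).mem_iff.1 hU
  exact ⟨⟨f, f.contMDiff⟩, f.eventuallyEq_one.self_of_nhds, fun x hx ↦
    image_eq_zero_of_notMem_tsupport fun h ↦ hx (hf h)⟩

/-- A frame near `x₀` made of global sections, with `C^∞(M)`-linear coefficients. -/
theorem exists_linearFrame (x₀ : M) :
    ∃ (s : Fin (finrank ℝ F) → Cₛ^∞⟮I; F, V⟯)
      (c : Fin (finrank ℝ F) → Cₛ^∞⟮I; F, V⟯ →ₗ[SmoothFun I M] SmoothFun I M)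
      (χ : SmoothFun I M), χ x₀ = 1 ∧ (∀ e, χ • e = ∑ i, c i e • s i) ∧
        (∀ e x, e x = 0 → ∀ i, c i e x = 0) ∧
        ∃ b : Basis (Fin (finrank ℝ F)) ℝ (V x₀),
          (∀ i, b i = s i x₀) ∧ ∀ e i, b.repr (e x₀) i = c i e x₀ := by
  obtain ⟨s, c, ψ, U, hU, hψ, hsum, hc, hb⟩ := exists_globalFrame (I := I) (F := F) (V := V) x₀
  obtain ⟨χ, hχ, hχU⟩ := exists_smoothFun_eventually_eq_one (I := I) hU
  have hx₀ := mem_of_mem_nhds hU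
  -- The functionals of `exists_globalFrame` are known to be linear only on `U`, where they are
  -- coordinates; the cutoff `χ` removes the other points.
  refine ⟨s, fun i ↦
    { toFun := fun e ↦ χ * c i e
      map_add' := fun e e' ↦ ?_
      map_smul' := fun f e ↦ ?_ }, χ * ψ, ?_, fun e ↦ ?_, fun e x hx i ↦ ?_, ?_⟩
  · ext x
    change χ x * c i (e + e') x = χ x * c i e x + χ x * c i e' x
    by_cases hx : x ∈ U
    · obtain ⟨b, -, hbc⟩ := hb x hx
      simp [← hbc, mul_add]
    · simp [hχU x hx]
  · ext x
    change χ x * c i (f • e) x = f x * (χ x * c i e x)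
    by_cases hx : x ∈ U
    · obtain ⟨b, -, hbc⟩ := hb x hx
      simp [← hbc, mul_left_comm]
    · simp [hχU x hx]
  · change χ x₀ * ψ x₀ = 1
    rw [hχ, hψ x₀ hx₀, one_mul]
  · rw [mul_smul, hsum, Finset.smul_sum]
    exact Finset.sum_congr rfl fun i _ ↦ (mul_smul _ _ _).symm
  · change χ x * c i e x = 0
    rw [hc e x hx, mul_zero]
  · obtain ⟨b, hbs, hbc⟩ := hb x₀ hx₀
    refine ⟨b, hbs, fun e i ↦ ?_⟩
    change _ = χ x₀ * c i e x₀
    rw [hbc, hχ, one_mul]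

/-- A `C^∞(M)`-linear functional on sections depends pointwise on the section. -/
theorem functional_apply_eq_zero (φ : Cₛ^∞⟮I; F, V⟯ →ₗ[SmoothFun I M] SmoothFun I M) {x : M}
    {e : Cₛ^∞⟮I; F, V⟯} (he : e x = 0) : φ e x = 0 := by
  obtain ⟨s, c, χ, hχ, hsum, hc, -⟩ := exists_linearFrame (I := I) (F := F) (V := V) x
  have h1 : χ * φ e = ∑ i, c i e * φ (s i) := by
    rw [← smul_eq_mul, ← map_smul, hsum, map_sum]; simp
  have h2 := congrArg (fun f : SmoothFun I M ↦ f x) h1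
  change χ x * φ e x = (∑ i, c i e * φ (s i)) x at h2
  rw [hχ, one_mul, ContMDiffMap.finsetSum_apply] at h2
  rw [h2]
  refine Finset.sum_eq_zero fun i _ ↦ ?_
  change c i e x * φ (s i) x = 0
  rw [hc e x he, zero_mul]

/-- Every linear functional on a fibre is induced by a `C^∞(M)`-linear functional on sections. -/
theorem exists_functional_apply_eq (x : M) (ξ : V x →ₗ[ℝ] ℝ) :
    ∃ φ : Cₛ^∞⟮I; F, V⟯ →ₗ[SmoothFun I M] SmoothFun I M, ∀ e, φ e x = ξ (e x) := by
  obtain ⟨s, c, χ, hχ, hsum, -, b, hbs, hbc⟩ :=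
    exists_linearFrame (I := I) (F := F) (V := V) x
  refine ⟨∑ i, algebraMap ℝ (SmoothFun I M) (ξ (s i x)) • c i, fun e ↦ ?_⟩
  rw [LinearMap.sum_apply, ContMDiffMap.finsetSum_apply]
  conv_rhs => rw [← b.sum_repr (e x)]
  rw [map_sum]
  refine Finset.sum_congr rfl fun i _ ↦ ?_
  rw [map_smul, hbc, hbs, smul_eq_mul, mul_comm]
  rfl

end Frames

/-! ### Extension of connections -/

section Extension

variable {EM : Type*} [NormedAddCommGroup EM] [NormedSpace ℝ EM] [FiniteDimensional ℝ EM]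
  {H : Type*} [TopologicalSpace H]
  {I : ModelWithCorners ℝ EM H} {M : Type*} [TopologicalSpace M]
  [ChartedSpace H M] [IsManifold I ∞ M] [T2Space M]
  {FA : Type*} [NormedAddCommGroup FA] [NormedSpace ℝ FA]
  {A : M → Type*} [TopologicalSpace (TotalSpace FA A)]
  [∀ x, AddCommGroup (A x)] [∀ x, Module ℝ (A x)] [∀ x, TopologicalSpace (A x)]
  [FiberBundle FA A] [VectorBundle ℝ FA A]
  {F : Type*} [NormedAddCommGroup F] [NormedSpace ℝ F] [FiniteDimensional ℝ F]
  {V : M → Type*} [TopologicalSpace (TotalSpace F V)]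
  [∀ x, AddCommGroup (V x)] [∀ x, Module ℝ (V x)] [∀ x, TopologicalSpace (V x)]
  [FiberBundle F V] [VectorBundle ℝ F V] [ContMDiffVectorBundle ∞ F V I]
  {L : LieAlgebroid I FA A} (B : LieSubalgebroid L)

namespace LieSubalgebroid

/-- The local frame of `B` becomes a family in `Γ(B)` after multiplication by a cutoff; where the
cutoff is nonzero the span is unchanged. -/
theorem exists_sections_frame (x₀ : M) :
    ∃ b : Fin B.rank → B.sections,
      LinearIndependent ℝ (fun i ↦ (b i : Cₛ^∞⟮I; FA, A⟯) x₀) ∧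
      ∃ U ∈ 𝓝 x₀, ∀ x ∈ U,
        Submodule.span ℝ (Set.range fun i ↦ (b i : Cₛ^∞⟮I; FA, A⟯) x) = B.fiber x := by
  obtain ⟨b, hb⟩ := B.exists_frame x₀
  obtain ⟨χ, hχ, hχU⟩ := exists_smoothFun_eventually_eq_one (I := I) hb
  have hmem : ∀ i, χ • b i ∈ B.sections := by
    intro i x
    by_cases hx : x ∈ {x | LinearIndependent ℝ (fun i ↦ b i x) ∧
        Submodule.span ℝ (Set.range fun i ↦ b i x) = B.fiber x}
    · refine (B.fiber x).smul_mem _ ?_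
      rw [← hx.2]
      exact Submodule.subset_span ⟨i, rfl⟩
    · rw [ContMDiffSection.smulSmoothFun_apply, hχU x hx, zero_smul]
      exact (B.fiber x).zero_mem
  refine ⟨fun i ↦ ⟨χ • b i, hmem i⟩, ?_, _, inter_mem hb
    (χ.contMDiff.continuous.continuousAt.eventually_ne (y := 0) (by rw [hχ]; exact one_ne_zero)),
    ?_⟩
  · simpa [hχ] using hb.self_of_nhds.1
  · rintro x ⟨⟨-, h1⟩, h2 : χ x ≠ 0⟩
    rw [← h1]
    refine le_antisymm (Submodule.span_le.2 ?_) (Submodule.span_le.2 ?_)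
    · rintro _ ⟨i, rfl⟩
      exact Submodule.smul_mem _ _ (Submodule.subset_span ⟨i, rfl⟩)
    · rintro _ ⟨i, rfl⟩
      have h3 : b i x = (χ x)⁻¹ • ((χ • b i : Cₛ^∞⟮I; FA, A⟯) x) := by
        rw [ContMDiffSection.smulSmoothFun_apply, smul_smul, inv_mul_cancel₀ h2, one_smul]
      change b i x ∈ _
      rw [h3]
      exact Submodule.smul_mem _ _ (Submodule.subset_span ⟨i, rfl⟩)

variable [FiniteDimensional ℝ FA] [ContMDiffVectorBundle ∞ FA A I]

/-- A `C^∞(M)`-linear map `Γ(A) → Γ(B)` which is a multiple of a projection onto `B`, nonzero near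
a given point. -/
theorem exists_projection (x₀ : M) :
    ∃ (T : Cₛ^∞⟮I; FA, A⟯ →ₗ[SmoothFun I M] B.sections) (δ : SmoothFun I M),
      δ x₀ ≠ 0 ∧ ∀ b : B.sections, T b = δ • b := by
  obtain ⟨b, hb, U, hU, hspan⟩ := B.exists_sections_frame x₀
  obtain ⟨χ, hχ, hχU⟩ := exists_smoothFun_eventually_eq_one (I := I) hU
  have hξ : ∀ k, ∃ φ : Cₛ^∞⟮I; FA, A⟯ →ₗ[SmoothFun I M] SmoothFun I M,
      ∀ j, φ (b j) x₀ = if k = j then 1 else 0 := by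
    intro k
    obtain ⟨ξ, hξ⟩ := LinearMap.exists_extend ((Basis.span hb).coord k)
    obtain ⟨φ, hφ⟩ := exists_functional_apply_eq (I := I) (F := FA) x₀ ξ
    refine ⟨φ, fun j ↦ ?_⟩
    have h1 := LinearMap.congr_fun hξ (Basis.span hb j)
    rw [LinearMap.comp_apply, Submodule.subtype_apply, Basis.coord_apply,
      Basis.repr_self, Finsupp.single_apply, Basis.span_apply] at h1
    rw [hφ, h1]
    simp [eq_comm]
  choose φ hφ using hξ
  -- `N` is the identity at `x₀` but may degenerate elsewhere. Using its adjugate instead of an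
  -- inverse makes `T` globally defined and costs only the factor `N.det`.
  let N : Matrix (Fin B.rank) (Fin B.rank) (SmoothFun I M) := fun k j ↦ φ k (b j)
  let T : Cₛ^∞⟮I; FA, A⟯ →ₗ[SmoothFun I M] B.sections :=
    χ • ∑ j, ∑ k, N.adjugate j k • (φ k).smulRight (b j)
  have hT : ∀ a, T a = χ • ∑ j, ∑ k, N.adjugate j k • φ k a • b j := by
    intro a
    simp [T, LinearMap.sum_apply]
  have hTb : ∀ l, T (b l) = (χ * N.det) • b l := by
    intro l
    have h1 : ∀ j, ∑ k, N.adjugate j k • φ k (b l) • b j =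
        (if j = l then N.det else 0) • b j := by
      intro j
      have h2 := congrFun (congrFun N.adjugate_mul j) l
      rw [Matrix.mul_apply, Matrix.smul_apply, Matrix.one_apply, smul_eq_mul, mul_ite, mul_one,
        mul_zero] at h2
      rw [← h2, Finset.sum_smul]
      exact Finset.sum_congr rfl fun k _ ↦ (mul_smul _ _ _).symm
    rw [hT, Finset.sum_congr rfl fun j _ ↦ h1 j]
    simp [ite_smul, mul_smul]
  have hT0 : ∀ (a : Cₛ^∞⟮I; FA, A⟯) (x : M), a x = 0 → (T a : Cₛ^∞⟮I; FA, A⟯) x = 0 := by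
    intro a x hx
    rw [hT]
    simp only [Submodule.coe_smul, Submodule.coe_sum, ContMDiffSection.smulSmoothFun_apply,
      ContMDiffSection.finsetSum_apply, functional_apply_eq_zero (φ _) hx, zero_smul, smul_zero,
      Finset.sum_const_zero]
  refine ⟨T, χ * N.det, ?_, fun a ↦ Subtype.ext (ContMDiffSection.ext fun x ↦ ?_)⟩
  · change χ x₀ * N.det x₀ ≠ 0
    have h1 : N.det x₀ = 1 := by
      have h2 := RingHom.map_det
        (ContMDiffMap.evalRingHom (I := I) (n := ∞) (R := ℝ) (I' := 𝓘(ℝ, ℝ)) x₀) N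
      refine h2.trans ?_
      rw [← Matrix.det_one (n := Fin B.rank) (R := ℝ)]
      congr 1
      ext k j
      rw [Matrix.one_apply]
      exact hφ k j
    rw [h1, hχ, one_mul]
    exact one_ne_zero
  · by_cases hx : x ∈ U
    · have h1 := a.2 x
      rw [← hspan x hx] at h1
      obtain ⟨β, hβ⟩ := (Submodule.mem_span_range_iff_exists_fun ℝ).1 h1
      -- A combination of the frame with constant coefficients agrees with `a` at `x` only, which
      -- suffices because `T` acts pointwise.
      set a' : B.sections := ∑ l, algebraMap ℝ (SmoothFun I M) (β l) • b l with ha'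
      have h2 : ((a - a' : B.sections) : Cₛ^∞⟮I; FA, A⟯) x = 0 := by
        rw [Submodule.coe_sub, ContMDiffSection.coe_sub, Pi.sub_apply, sub_eq_zero, ← hβ, ha',
          Submodule.coe_sum, ContMDiffSection.finsetSum_apply]
        rfl
      have h3 : T a' = (χ * N.det) • a' := by
        rw [ha', Submodule.coe_sum, map_sum, Finset.smul_sum]
        refine Finset.sum_congr rfl fun l _ ↦ ?_
        rw [Submodule.coe_smul, map_smul, hTb, smul_comm]
      have h4 := hT0 _ x h2
      rw [Submodule.coe_sub, map_sub, h3, Submodule.coe_sub, ContMDiffSection.coe_sub,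
        Pi.sub_apply, sub_eq_zero] at h4
      rw [h4, Submodule.coe_smul, Submodule.coe_smul, ContMDiffSection.smulSmoothFun_apply,
        ContMDiffSection.smulSmoothFun_apply]
      rw [Submodule.coe_sub, ContMDiffSection.coe_sub, Pi.sub_apply, sub_eq_zero] at h2
      rw [h2]
    · have h0 := hχU x hx
      rw [hT, Submodule.coe_smul, Submodule.coe_smul, ContMDiffSection.smulSmoothFun_apply,
        ContMDiffSection.smulSmoothFun_apply, h0, zero_smul]
      change 0 = (χ x * N.det x) • _
      rw [h0, zero_mul, zero_smul]

namespace Connection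

variable {B} (D₀ : B.Connection F V)

/-- Near every point there is an extension of a `B`-connection up to a factor. -/
theorem exists_local_extension (x₀ : M) :
    ∃ (N : Cₛ^∞⟮I; FA, A⟯ →ₗ[SmoothFun I M] Cₛ^∞⟮I; F, V⟯ →ₗ[ℝ] Cₛ^∞⟮I; F, V⟯)
      (δ : SmoothFun I M), δ x₀ ≠ 0 ∧
      (∀ a (f : SmoothFun I M) e, N a (f • e) = f • N a e + (δ * L.deriv a f) • e) ∧
      ∀ (b : B.sections) e, N b e = δ • D₀.nabla b e := by
  obtain ⟨T, δ, hδ, hT⟩ := B.exists_projection x₀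
  obtain ⟨s, c, χ, hχ, hsum, -, -⟩ := exists_linearFrame (I := I) (F := F) (V := V) x₀
  -- The remainder of `δ • a` off `B`. It is zero for `a` in `Γ(B)`, so there only the term with
  -- `D₀` survives.
  let W : Cₛ^∞⟮I; FA, A⟯ →ₗ[SmoothFun I M] Cₛ^∞⟮I; FA, A⟯ :=
    δ • LinearMap.id - B.sections.subtype ∘ₗ T
  have hW : ∀ a, W a = δ • a - T a := fun a ↦ rfl
  let N : Cₛ^∞⟮I; FA, A⟯ →ₗ[SmoothFun I M] Cₛ^∞⟮I; F, V⟯ →ₗ[ℝ] Cₛ^∞⟮I; F, V⟯ :=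
    { toFun := fun a ↦
        { toFun := fun e ↦ χ • D₀.nabla (T a) e + ∑ i, L.deriv (W a) (c i e) • s i
          map_add' := fun e e' ↦ by
            simp only [map_add, L.deriv_add, add_smul, smul_add, Finset.sum_add_distrib]
            abel
          map_smul' := fun r e ↦ by
            have h : ∀ i, c i (r • e) = r • c i e := fun i ↦ (c i).map_smul_of_tower r e
            simp only [map_smul, h, L.deriv_real_smul, smul_assoc, RingHom.id_apply, smul_add,
              Finset.smul_sum, smul_comm χ r] }
      map_add' := fun a a' ↦ by
        ext1 e
        simp only [LinearMap.coe_mk, AddHom.coe_mk, LinearMap.add_apply, map_add, L.add_deriv,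
          add_smul, smul_add, Finset.sum_add_distrib]
        abel
      map_smul' := fun f a ↦ by
        ext1 e
        simp only [LinearMap.coe_mk, AddHom.coe_mk, map_smul, LinearMap.smul_apply,
          L.smul_deriv, RingHom.id_apply, smul_add, Finset.smul_sum, mul_smul, smul_comm χ f] }
  have hN : ∀ a e, N a e = χ • D₀.nabla (T a) e + ∑ i, L.deriv (W a) (c i e) • s i :=
    fun a e ↦ rfl
  refine ⟨N, χ * δ, ?_, fun a f e ↦ ?_, fun b e ↦ ?_⟩
  · change χ x₀ * δ x₀ ≠ 0
    rwa [hχ, one_mul]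
  · have h1 : ∑ i, L.deriv (W a) (c i (f • e)) • s i =
        f • ∑ i, L.deriv (W a) (c i e) • s i + L.deriv (W a) f • χ • e := by
      rw [hsum, Finset.smul_sum, Finset.smul_sum, ← Finset.sum_add_distrib]
      refine Finset.sum_congr rfl fun i _ ↦ ?_
      rw [map_smul, smul_eq_mul, L.deriv_mul, add_smul, mul_smul, mul_smul]
    have h2 : δ * L.deriv a f = L.deriv (W a) f + L.deriv (T a : Cₛ^∞⟮I; FA, A⟯) f := by
      rw [← L.add_deriv, hW, sub_add_cancel, L.smul_deriv]
    rw [hN, hN, D₀.leibniz, mul_assoc, h2, h1, smul_add, smul_add, smul_comm χ f, mul_add,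
      add_smul, mul_smul, mul_smul, smul_comm χ (L.deriv (W a) f)]
    abel
  · have h : ∀ f, L.deriv (0 : Cₛ^∞⟮I; FA, A⟯) f = 0 := fun f ↦ by
      have := L.smul_deriv 0 0 f
      rwa [zero_smul, zero_mul] at this
    rw [hN, hW, hT, Submodule.coe_smul, sub_self, map_smul]
    simp [h, mul_smul]

/-- A `B`-connection extends to an `A`-connection. -/
theorem exists_extension [SigmaCompactSpace M] : ∃ D : L.Connection F V, D.Extends D₀ := by
  choose N δ hδ hleib hext using D₀.exists_local_extension
  obtain ⟨f, hf⟩ := SmoothPartitionOfUnity.exists_isSubordinate I isClosed_univ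
    (fun i : M ↦ {x | δ i x ≠ 0})
    (fun i ↦ isOpen_ne_fun (δ i).contMDiff.continuous continuous_const)
    (fun x _ ↦ Set.mem_iUnion.2 ⟨x, hδ x⟩)
  have hfδ : ∀ i x, f i x / δ i x * δ i x = f i x := by
    intro i x
    by_cases hx : δ i x = 0
    · have : f i x = 0 := image_eq_zero_of_notMem_tsupport fun h ↦ hf i h hx
      rw [this, zero_div, zero_mul]
    · exact div_mul_cancel₀ _ hx
  -- The weights `f i / δ i` turn the factors `δ i` of the local extensions into a partition of
  -- unity. They are smooth because `δ i` has no zero on the closed support of `f i`; outside the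
  -- support they are zero.
  let g : M → SmoothFun I M := fun i ↦ ⟨fun x ↦ f i x / δ i x, by
    refine contMDiff_of_tsupport fun x hx ↦ ?_
    have hx' : δ i x ≠ 0 := by
      refine hf i (closure_mono (fun y hy ↦ ?_) hx)
      exact fun h ↦ hy (by simp [h])
    exact (f i).contMDiff.contMDiffAt.div₀ (δ i).contMDiff.contMDiffAt hx'⟩
  have hg : ∀ i x, g i x = f i x / δ i x := fun _ _ ↦ rfl
  have hsum : ∀ (u : M → Cₛ^∞⟮I; F, V⟯) (x : M),
      ∑ᶠ i, (g i • u i) x = ∑ i ∈ f.finsupport x, (g i • u i) x := by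
    intro u x
    refine finsum_eq_sum_of_support_subset _ fun i hi ↦ ?_
    rw [f.coe_finsupport]
    intro (h : f i x = 0)
    refine hi ?_
    change g i x • u i x = 0
    rw [hg, h, zero_div, zero_smul]
  let S : (M → Cₛ^∞⟮I; F, V⟯) → Cₛ^∞⟮I; F, V⟯ := fun u ↦
    ⟨fun x ↦ ∑ᶠ i, (g i • u i) x, by
      refine ContMDiff.finsum_section_of_locallyFinite ?_ fun i ↦ (g i • u i).contMDiff
      refine f.locallyFinite.subset fun i x hx (h : f i x = 0) ↦ hx ?_
      change g i x • u i x = 0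
      rw [hg, h, zero_div, zero_smul]⟩
  have hS : ∀ u x, S u x = ∑ i ∈ f.finsupport x, g i x • u i x := hsum
  have hSadd : ∀ u v, S (u + v) = S u + S v := by
    intro u v
    ext x
    rw [ContMDiffSection.coe_add, Pi.add_apply, hS, hS, hS, ← Finset.sum_add_distrib]
    exact Finset.sum_congr rfl fun i _ ↦ smul_add _ _ _
  have hSsmul : ∀ (h : SmoothFun I M) u, S (fun i ↦ h • u i) = h • S u := by
    intro h u
    ext x
    rw [ContMDiffSection.smulSmoothFun_apply, hS, hS, Finset.smul_sum]
    exact Finset.sum_congr rfl fun i _ ↦ smul_comm _ _ _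
  have hSreal : ∀ (r : ℝ) u, S (fun i ↦ r • u i) = r • S u :=
    fun r u ↦ hSsmul (algebraMap ℝ (SmoothFun I M) r) u
  have hSδ : ∀ e, S (fun i ↦ δ i • e) = e := by
    intro e
    ext x
    rw [hS, ← one_smul ℝ (e x), ← f.sum_finsupport x (Set.mem_univ x), Finset.sum_smul]
    refine Finset.sum_congr rfl fun i _ ↦ ?_
    rw [ContMDiffSection.smulSmoothFun_apply, smul_smul, hg, hfδ]
  refine ⟨⟨
    { toFun := fun a ↦
        { toFun := fun e ↦ S fun i ↦ N i a e
          map_add' := fun e e' ↦ by rw [← hSadd]; congr 1; ext1 i; exact map_add _ _ _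
          map_smul' := fun r e ↦ by
            rw [RingHom.id_apply, ← hSreal]; congr 1; ext1 i; exact map_smul _ _ _ }
      map_add' := fun a a' ↦ by
        ext1 e
        change S (fun i ↦ N i (a + a') e) = S (fun i ↦ N i a e) + S (fun i ↦ N i a' e)
        rw [← hSadd]
        congr 1
        ext1 i
        rw [map_add]
        rfl
      map_smul' := fun h a ↦ by
        ext1 e
        change S (fun i ↦ N i (h • a) e) = h • S (fun i ↦ N i a e)
        rw [← hSsmul]
        congr 1
        ext1 i
        rw [map_smul]
        rfl }, fun a h e ↦ ?_⟩, fun b e ↦ ?_⟩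
  · change S (fun i ↦ N i a (h • e)) = h • S (fun i ↦ N i a e) + L.deriv a h • e
    conv_rhs => rw [← hSδ e, ← hSsmul, ← hSsmul, hSδ, ← hSadd]
    congr 1
    ext1 i
    rw [hleib, mul_comm, mul_smul]
    rfl
  · change S (fun i ↦ N i b e) = D₀.nabla b e
    conv_rhs => rw [← hSδ (D₀.nabla b e)]
    congr 1
    ext1 i
    exact hext i b e

end Connection

end LieSubalgebroid

end Extension

/-! ### Polarization is multilinear -/

section Polarization

/-- The term for `S` expands into a sum over the functions with values in `S`. By
inclusion–exclusion the alternating sum keeps the surjective functions, which on a finite set are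
the permutations. -/
theorem sum_powerset_prod_sum_eq {d : ℕ} (y : Fin d → Fin d → ℝ) :
    ∑ S : Finset (Fin d), (-1) ^ (d - S.card) * ∏ j, ∑ i ∈ S, y i j =
      ∑ σ : Equiv.Perm (Fin d), ∏ i, y i (σ i) := by
  classical
  have h := Finset.inclusion_exclusion_sum_inf_compl (Finset.univ : Finset (Fin d))
    (fun i ↦ ({f : Fin d → Fin d | ∀ j, f j ≠ i} : Finset _)) (fun f ↦ ∏ j, y (f j) j)
  have h1 : ∑ S : Finset (Fin d), (-1) ^ (d - S.card) * ∏ j, ∑ i ∈ S, y i j =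
      ∑ f ∈ Finset.univ.inf fun i ↦ ({f : Fin d → Fin d | ∀ j, f j ≠ i} : Finset _)ᶜ,
        ∏ j, y (f j) j := by
    rw [h, Finset.powerset_univ]
    -- Inclusion–exclusion runs over the set of omitted values, the complement of `S`.
    refine Fintype.sum_equiv (Function.Involutive.toPerm compl compl_involutive) _ _ fun S ↦ ?_
    have h2 : d - S.card = (Sᶜ).card := by rw [Finset.card_compl, Fintype.card_fin]
    rw [Finset.prod_univ_sum, Function.Involutive.coe_toPerm, h2, zsmul_eq_mul]
    push_cast
    congr 1
    refine Finset.sum_congr ?_ fun _ _ ↦ rfl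
    ext f
    simp only [Fintype.mem_piFinset, Finset.mem_inf, Finset.mem_compl, Finset.mem_filter,
      Finset.mem_univ, true_and]
    exact ⟨fun hf i hi j hj ↦ hi (hj ▸ hf j), fun hf j ↦ by_contra fun hj ↦ hf _ hj j rfl⟩
  rw [h1]
  symm
  refine Finset.sum_bij (fun σ _ ↦ ⇑σ⁻¹) (fun σ _ ↦ ?_) (fun σ _ τ _ hστ ↦ ?_)
    (fun f hf ↦ ?_) (fun σ _ ↦ ?_)
  · simp only [Finset.mem_inf, Finset.mem_compl, Finset.mem_filter, Finset.mem_univ, true_and]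
    exact fun i _ hi ↦ hi (σ i) (by simp)
  · exact inv_injective (DFunLike.coe_injective hστ)
  · have hf' : Function.Surjective f := by
      intro i
      simp only [Finset.mem_inf, Finset.mem_compl, Finset.mem_filter, Finset.mem_univ, true_and,
        true_implies, not_forall, not_not] at hf
      exact hf i
    refine ⟨(Equiv.ofBijective f (Finite.injective_iff_surjective.2 hf' |>.bijective_of_finite))⁻¹,
      Finset.mem_univ _, ?_⟩
    rw [inv_inv]
    rfl
  · exact Fintype.prod_equiv σ _ _ fun i ↦ by simp

variable {k d : ℕ}

theorem exists_eval_monomial_eq_prod {ι : Type*} {m : ι →₀ ℕ} (hm : m.degree = d) :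
    ∃ v : Fin d → ι, ∀ (x : ι → ℝ) (r : ℝ),
      MvPolynomial.eval x (MvPolynomial.monomial m r) = r * ∏ j, x (v j) := by
  have hl : (Finsupp.toMultiset m).toList.length = d := by
    rw [Multiset.length_toList, Finsupp.card_toMultiset, ← hm]
    rfl
  subst hl
  refine ⟨fun j ↦ (Finsupp.toMultiset m).toList.get j, fun x r ↦ ?_⟩
  rw [MvPolynomial.eval_monomial]
  congr 1
  have h1 : ∏ j, x ((Finsupp.toMultiset m).toList.get j) =
      ((Finsupp.toMultiset m).toList.map x).prod := by
    rw [← List.prod_ofFn, List.ofFn_comp' , List.ofFn_get]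
  rw [h1, ← Multiset.prod_coe, ← Multiset.map_coe, Multiset.coe_toList, Finsupp.toMultiset_map,
    Finsupp.prod_toMultiset, Finsupp.prod_mapDomain_index (fun _ ↦ pow_zero _)
      (fun _ _ _ ↦ pow_add _ _ _)]

/-- For a monomial of degree `d`, written as a product of `d` matrix entries, the polarization
formula collapses to a multiple of a permanent, which is multilinear. -/
theorem exists_multilinear_eq_polarization {p : MvPolynomial (Fin k × Fin k) ℝ}
    (hp : p.IsHomogeneous d) :
    ∃ P : MultilinearMap ℝ (fun _ : Fin d ↦ Matrix (Fin k) (Fin k) ℝ) ℝ,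
      ∀ X, P X = polarization p X := by
  have h1 : ∀ m ∈ p.support, ∃ P : MultilinearMap ℝ (fun _ : Fin d ↦ Matrix (Fin k) (Fin k) ℝ) ℝ,
      ∀ X, P X = polarization (MvPolynomial.monomial m (p.coeff m)) X := by
    intro m hm
    obtain ⟨v, hv⟩ := exists_eval_monomial_eq_prod
      (d := d) (m := m)
      (by rw [Finsupp.degree_eq_weight_one]; exact hp (MvPolynomial.mem_support_iff.1 hm))
    refine ⟨((d.factorial : ℝ)⁻¹ * p.coeff m) • ∑ σ : Equiv.Perm (Fin d),
      (MultilinearMap.mkPiAlgebra ℝ (Fin d) ℝ).compLinearMap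
        (fun i ↦ Matrix.entryLinearMap ℝ ℝ (v (σ i)).1 (v (σ i)).2), fun X ↦ ?_⟩
    rw [polarization, smul_apply, sum_apply, smul_eq_mul, mul_assoc]
    simp only [hv, MultilinearMap.compLinearMap_apply, MultilinearMap.mkPiAlgebra_apply,
      Matrix.entryLinearMap_apply, mul_left_comm _ (p.coeff m), ← Finset.mul_sum]
    rw [sum_powerset_prod_sum_eq fun i j ↦ X i (v j).1 (v j).2]
  choose! P hP using h1
  refine ⟨∑ m ∈ p.support, P m, fun X ↦ ?_⟩
  rw [sum_apply, Finset.sum_congr rfl fun m hm ↦ hP m hm X]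
  conv_rhs => rw [polarization, p.as_sum]
  simp only [polarization, map_sum, Finset.mul_sum]
  rw [Finset.sum_comm]

/-- Inserting the values of a bilinear map on consecutive pairs into a multilinear map. -/
def MultilinearMap.compPairs {W N : Type*} [AddCommGroup W] [Module ℝ W] [AddCommGroup N]
    [Module ℝ N] (P : MultilinearMap ℝ (fun _ : Fin d ↦ N) ℝ) (M : W →ₗ[ℝ] W →ₗ[ℝ] N) :
    MultilinearMap ℝ (fun _ : Fin (2 * d) ↦ W) ℝ :=
  -- The slot `k` belongs to exactly one pair, the one with index `k / 2`, so changing it changes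
  -- one argument of `P`, linearly.
  have key : ∀ (v : Fin (2 * d) → W) (k : Fin (2 * d)), ∃ (i : Fin d) (φ : W →ₗ[ℝ] N), ∀ y,
      (fun j : Fin d ↦ M (Function.update v k y ⟨2 * j, by omega⟩)
        (Function.update v k y ⟨2 * j + 1, by omega⟩)) =
      Function.update (fun j : Fin d ↦ M (v ⟨2 * j, by omega⟩) (v ⟨2 * j + 1, by omega⟩)) i
        (φ y) := by
    intro v k
    obtain ⟨i, hi | hi⟩ := Nat.even_or_odd' (k : ℕ)
    · have hi' : 2 * i < 2 * d := hi ▸ k.2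
      obtain rfl : k = ⟨2 * i, hi'⟩ := Fin.ext hi
      refine ⟨⟨i, by omega⟩, M.flip (v ⟨2 * i + 1, by omega⟩), fun y ↦ funext fun j ↦ ?_⟩
      have h1 : Function.update v ⟨2 * i, hi'⟩ y ⟨2 * j + 1, by omega⟩ = v _ :=
        Function.update_of_ne (fun h ↦ by have := congrArg Fin.val h; dsimp at this; omega) _ _
      rw [h1]
      by_cases hj : j = ⟨i, by omega⟩
      · subst hj
        rw [Function.update_self, Function.update_self, LinearMap.flip_apply]
      · have hj' : (j : ℕ) ≠ i := fun h ↦ hj (Fin.ext h)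
        rw [Function.update_of_ne hj, Function.update_of_ne
          (fun h ↦ by have := congrArg Fin.val h; dsimp at this; omega)]
    · have hi' : 2 * i + 1 < 2 * d := hi ▸ k.2
      obtain rfl : k = ⟨2 * i + 1, hi'⟩ := Fin.ext hi
      refine ⟨⟨i, by omega⟩, M (v ⟨2 * i, by omega⟩), fun y ↦ funext fun j ↦ ?_⟩
      have h1 : Function.update v ⟨2 * i + 1, hi'⟩ y ⟨2 * j, by omega⟩ = v _ :=
        Function.update_of_ne (fun h ↦ by have := congrArg Fin.val h; dsimp at this; omega) _ _
      rw [h1]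
      by_cases hj : j = ⟨i, by omega⟩
      · subst hj
        rw [Function.update_self, Function.update_self]
      · have hj' : (j : ℕ) ≠ i := fun h ↦ hj (Fin.ext h)
        rw [Function.update_of_ne hj, Function.update_of_ne
          (fun h ↦ by have := congrArg Fin.val h; dsimp at this; omega)]
  { toFun := fun v ↦ P fun j ↦ M (v ⟨2 * j, by omega⟩) (v ⟨2 * j + 1, by omega⟩)
    map_update_add' := by
      intro inst v k x y
      rw [Subsingleton.elim inst (instDecidableEqFin (2 * d))]
      obtain ⟨i, φ, h⟩ := key v k
      rw [h, h, h, map_add, P.map_update_add]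
    map_update_smul' := by
      intro inst v k r x
      rw [Subsingleton.elim inst (instDecidableEqFin (2 * d))]
      obtain ⟨i, φ, h⟩ := key v k
      rw [h, h, map_smul, P.map_update_smul] }

end Polarization

/-! ### Tensoriality -/

section Tensoriality

variable {EM : Type*} [NormedAddCommGroup EM] [NormedSpace ℝ EM] [FiniteDimensional ℝ EM]
  {H : Type*} [TopologicalSpace H]
  {I : ModelWithCorners ℝ EM H} {M : Type*} [TopologicalSpace M]
  [ChartedSpace H M] [IsManifold I ∞ M] [T2Space M]
  {FA : Type*} [NormedAddCommGroup FA] [NormedSpace ℝ FA] [FiniteDimensional ℝ FA]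
  {A : M → Type*} [TopologicalSpace (TotalSpace FA A)]
  [∀ x, AddCommGroup (A x)] [∀ x, Module ℝ (A x)] [∀ x, TopologicalSpace (A x)]
  [FiberBundle FA A] [VectorBundle ℝ FA A] [ContMDiffVectorBundle ∞ FA A I]
  {F : Type*} [NormedAddCommGroup F] [NormedSpace ℝ F] [FiniteDimensional ℝ F]
  {V : M → Type*} [TopologicalSpace (TotalSpace F V)]
  [∀ x, AddCommGroup (V x)] [∀ x, Module ℝ (V x)] [∀ x, TopologicalSpace (V x)]
  [FiberBundle F V] [VectorBundle ℝ F V] [ContMDiffVectorBundle ∞ F V I]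
  {L : LieAlgebroid I FA A}

theorem sectionMap_apply_eq_zero
    (φ : Cₛ^∞⟮I; FA, A⟯ →ₗ[SmoothFun I M] Cₛ^∞⟮I; F, V⟯) {x : M}
    {a : Cₛ^∞⟮I; FA, A⟯} (ha : a x = 0) : φ a x = 0 := by
  obtain ⟨s, c, χ, -, -, -, b, -, hbc⟩ := exists_linearFrame (I := I) (F := F) (V := V) x
  refine b.repr.map_eq_zero_iff.1 (Finsupp.ext fun i ↦ ?_)
  rw [hbc]
  exact functional_apply_eq_zero (c i ∘ₗ φ) ha

/-- The arguments are exchanged one at a time; in each slot the form is a `C^∞(M)`-linear functional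
and so depends only on the value at `x`. -/
theorem LieAlgebroid.form_congr {n : ℕ} (w : L.Form n) {x : M}
    {a a' : Fin n → Cₛ^∞⟮I; FA, A⟯} (h : ∀ i, a i x = a' i x) : w a x = w a' x := by
  have key : ∀ s : Finset (Fin n), w (s.piecewise a' a) x = w a x := by
    intro s
    induction s using Finset.induction_on with
    | empty => rw [Finset.piecewise_empty]
    | insert j s hj ih =>
      rw [← ih, Finset.piecewise_insert]
      have h1 := functional_apply_eq_zero
        (w.toMultilinearMap.toLinearMap (s.piecewise a' a) j) (x := x)
        (e := a' j - s.piecewise a' a j) (by simp [hj, h])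
      rw [map_sub] at h1
      change w (Function.update (s.piecewise a' a) j (a' j)) x -
        w (Function.update (s.piecewise a' a) j (s.piecewise a' a j)) x = 0 at h1
      rwa [Function.update_eq_self, sub_eq_zero] at h1
  rw [← key Finset.univ, Finset.piecewise_univ]

namespace LieAlgebroid.Connection

variable (D : L.Connection F V)

theorem curvatureEnd_apply_eq_zero {a : Cₛ^∞⟮I; FA, A⟯} {x : M} (ha : a x = 0)
    (b : Cₛ^∞⟮I; FA, A⟯) (e : Cₛ^∞⟮I; F, V⟯) : D.curvatureEnd a b e x = 0 :=
  sectionMap_apply_eq_zero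
    { toFun := fun a ↦ D.curvatureEnd a b e
      map_add' := fun a a' ↦ by rw [curvatureEnd_add_left, LinearMap.add_apply]
      map_smul' := fun f a ↦ by rw [curvatureEnd_smul_left, LinearMap.smul_apply]; rfl } ha

theorem fibreMap_curvatureEnd_congr {a a' b b' : Cₛ^∞⟮I; FA, A⟯} {x : M} (ha : a x = a' x)
    (hb : b x = b' x) : fibreMap x (D.curvatureEnd a b) = fibreMap x (D.curvatureEnd a' b') := by
  have h1 : ∀ {a a' : Cₛ^∞⟮I; FA, A⟯} (b : Cₛ^∞⟮I; FA, A⟯) (e : Cₛ^∞⟮I; F, V⟯), a x = a' x →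
      D.curvatureEnd a b e x = D.curvatureEnd a' b e x := by
    intro a a' b e h
    have h2 := D.curvatureEnd_apply_eq_zero (a := a - a') (x := x) (by simp [h]) b e
    rw [← sub_eq_zero, ← h2, sub_eq_add_neg a a', ← neg_one_smul (SmoothFun I M) a',
      curvatureEnd_add_left, curvatureEnd_smul_left, neg_one_smul, ← sub_eq_add_neg]
    rfl
  ext v
  obtain ⟨e, rfl⟩ := exists_section_apply_eq (I := I) (F := F) x v
  rw [fibreMap_apply, fibreMap_apply, h1 b e ha, curvatureEnd_anti, curvatureEnd_anti _ a' b',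
    LinearMap.neg_apply, LinearMap.neg_apply, ContMDiffSection.coe_neg, ContMDiffSection.coe_neg,
    Pi.neg_apply, Pi.neg_apply, h1 a' e hb]

end LieAlgebroid.Connection

/-- A basis of `A x` adapted to `B x`, and sections through it. -/
theorem LieSubalgebroid.exists_adapted_basis (B : LieSubalgebroid L) {q : ℕ}
    (hq : B.rank + q = finrank ℝ FA) (x : M) :
    ∃ (e : Basis (Fin B.rank ⊕ Fin q) ℝ (A x)) (S : A x →ₗ[ℝ] Cₛ^∞⟮I; FA, A⟯),
      (∀ v, S v x = v) ∧ ∀ i, S (e (Sum.inl i)) ∈ B.sections := by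
  obtain ⟨b, hb, -⟩ := B.exists_sections_frame x
  obtain ⟨-, -, -, -, -, -, b₀, -⟩ := exists_linearFrame (I := I) (F := FA) (V := A) x
  have : Module.Finite ℝ (A x) := .of_basis b₀
  have : Finite (Fin B.rank ⊕ Basis.sumExtendIndex hb) := Module.Finite.finite_basis (Basis.sumExtend hb)
  have : Finite (Basis.sumExtendIndex hb) := Finite.sum_right (Fin B.rank)
  have hcard : Nat.card (Basis.sumExtendIndex hb) = q := by
    have h1 := finrank_eq_nat_card_basis (Basis.sumExtend hb)
    rw [Nat.card_sum, finrank_eq_card_basis b₀, Fintype.card_fin, Nat.card_eq_fintype_card,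
      Fintype.card_fin] at h1
    omega
  let e := (Basis.sumExtend hb).reindex
    ((Equiv.refl (Fin B.rank)).sumCongr (Finite.equivFinOfCardEq hcard))
  have he : ∀ i, e (Sum.inl i) = (b i : Cₛ^∞⟮I; FA, A⟯) x := by
    intro i
    simp [e, Basis.sumExtend]
    rfl
  choose t ht using fun v : A x ↦ exists_section_apply_eq (I := I) (F := FA) x v
  -- Linearity of the choice of sections lets forms be pulled back to alternating maps on the fibre;
  -- on the basis vectors in `B` it takes values in `Γ(B)`, not merely in sections tangent to `B` at
  -- `x`.
  refine ⟨e, e.constr ℝ (Sum.elim (fun i ↦ (b i : Cₛ^∞⟮I; FA, A⟯)) fun i ↦ t (e (Sum.inr i))),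
    fun v ↦ ?_, fun i ↦ ?_⟩
  · have h1 : ∀ j, e.constr ℝ (Sum.elim (fun i ↦ (b i : Cₛ^∞⟮I; FA, A⟯))
        fun i ↦ t (e (Sum.inr i))) (e j) x = e j := by
      rintro (i | i)
      · rw [Basis.constr_basis, Sum.elim_inl, he]
      · rw [Basis.constr_basis, Sum.elim_inr, ht]
    conv_lhs => rw [← e.sum_repr v, map_sum, ContMDiffSection.finsetSum_apply]
    conv_rhs => rw [← e.sum_repr v]
    refine Finset.sum_congr rfl fun j _ ↦ ?_
    rw [map_smul, ContMDiffSection.coe_smul, Pi.smul_apply, h1]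
  · rw [Basis.constr_basis, Sum.elim_inl]
    exact (b i).2

/-! ### Vanishing -/

theorem card_isRight_le {n q r : ℕ} {v : Fin n → Fin r ⊕ Fin q} (hv : Function.Injective v) :
    Finset.card {i | (v i).isRight} ≤ q := by
  classical
  have h := Finset.card_le_card_of_injOn (s := ({i | (v i).isRight} : Finset (Fin n)))
    (t := (Finset.univ : Finset (Fin q)).map Function.Embedding.inr) v (fun i hi ↦ by
      obtain ⟨j, hj⟩ := Sum.isRight_iff.1 (Finset.mem_filter.1 hi).2
      simp [hj]) hv.injOn
  simpa using h

/-- On distinct vectors of the adapted basis at most `q < m` of the chosen sections are outside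
`Γ(B)`, so the form is zero there; being alternating, it is zero at `x`. -/
theorem LieSubalgebroid.form_eq_zero (B : LieSubalgebroid L) [DecidablePred (· ∈ B.sections)]
    {q : ℕ} (hq : B.rank + q = finrank ℝ FA) {n m : ℕ} (hm : q < m) {w : L.Form n}
    (hw : ListCochain.VanishesOn (· ∈ B.sections) m w.toListCochain) : w = 0 := by
  ext a x
  obtain ⟨e, S, hS, hSB⟩ := B.exists_adapted_basis hq x
  let u : A x [⋀^Fin n]→ₗ[ℝ] ℝ :=
    { toFun := fun v ↦ w (S ∘ v) x
      map_update_add' := by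
        intro inst v k y z
        rw [Function.comp_update, Function.comp_update, Function.comp_update, map_add,
          w.map_update_add]
        rfl
      map_update_smul' := by
        intro inst v k c y
        have h : S (c • y) = algebraMap ℝ (SmoothFun I M) c • S y := S.map_smul c y
        rw [Function.comp_update, Function.comp_update, h, w.map_update_smul]
        rfl
      map_eq_zero_of_eq' := by
        intro v i j hv hij
        change w (S ∘ v) x = 0
        rw [w.map_eq_zero_of_eq (S ∘ v) (congrArg S hv) hij]
        rfl }
  have hu : u = 0 := by
    refine Basis.ext_alternating e fun v hv ↦ ?_
    change w (fun i ↦ S (e (v i))) x = 0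
    rw [← AlternatingMap.toListCochain_ofFn, hw (List.ofFn _)]
    · rfl
    · refine lt_of_le_of_lt ?_ hm
      refine le_trans ?_ (card_isRight_le hv)
      rw [List.ofFn_eq_map, List.countP_map]
      change List.countP _ (List.finRange n) ≤ _
      have h1 : Finset.card {i | (v i).isRight} =
          (List.finRange n).countP fun i ↦ (v i).isRight := by
        rw [Finset.card_def, Finset.filter_val, ← Multiset.countP_eq_card_filter]
        refine (Multiset.coe_countP (fun i ↦ (v i).isRight = true) (List.finRange n)).trans ?_
        simp
      rw [h1]
      refine List.countP_mono_left fun i _ hi ↦ ?_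
      rcases hvi : v i with j | j
      · simp [hvi, hSB j] at hi
      · simp
  have h := congrArg (fun u : A x [⋀^Fin n]→ₗ[ℝ] ℝ ↦ u fun i ↦ a i x) hu
  change w (fun i ↦ S (a i x)) x = 0 at h
  rw [L.form_congr w (x := x) (a' := fun i ↦ S (a i x)) fun i ↦ (hS _).symm, h]
  rfl

namespace LieAlgebroid.Connection

variable {D : L.Connection F V} {B : LieSubalgebroid L} {D₀ : B.Connection F V}

theorem Extends.curvatureEnd_eq_zero (hD : D.Extends D₀) (hD₀ : D₀.IsFlat)
    {a b : Cₛ^∞⟮I; FA, A⟯} (ha : a ∈ B.sections) (hb : b ∈ B.sections) :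
    D.curvatureEnd a b = 0 := by
  ext1 e
  have h := hD₀ ⟨a, ha⟩ ⟨b, hb⟩ e
  rw [← hD, ← hD, ← hD, ← hD, ← hD] at h
  exact h

theorem Extends.vanishesOn_listCurvature [DecidablePred (· ∈ B.sections)] (hD : D.Extends D₀)
    (hD₀ : D₀.IsFlat) : ListCochain.VanishesOn (· ∈ B.sections) 1 D.listCurvature := by
  intro l hl
  by_cases h2 : l.length = 2
  · obtain ⟨a, b, rfl⟩ := List.length_eq_two.1 h2
    rw [Nat.lt_one_iff, List.countP_eq_zero] at hl
    rw [listCurvature_pair]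
    exact hD.curvatureEnd_eq_zero hD₀ (by simpa using hl a (by simp)) (by simpa using hl b (by simp))
  · exact D.listCurvature_of_length_ne h2

theorem Extends.vanishesOn_listCurvature_pow [DecidablePred (· ∈ B.sections)] (hD : D.Extends D₀)
    (hD₀ : D₀.IsFlat) (i : ℕ) :
    ListCochain.VanishesOn (· ∈ B.sections) i (D.listCurvature ^ i) := by
  induction i with
  | zero => exact fun l hl ↦ absurd hl (Nat.not_lt_zero _)
  | succ i ih =>
    rw [pow_succ]
    exact ih.mul (hD.vanishesOn_listCurvature hD₀)

/-- Each curvature has degree two and vanishing order one, orders add in products, and the trace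
keeps them; this gives half of the degree. -/
theorem Extends.vanishesOn_traceMonomial [DecidablePred (· ∈ B.sections)] (hD : D.Extends D₀)
    (hD₀ : D₀.IsFlat) {l : ℕ} {w : L.Form l} (hw : D.IsTraceMonomial l w) :
    ListCochain.VanishesOn (· ∈ B.sections) (l / 2) w.toListCochain := by
  induction hw with
  | one => exact fun l hl ↦ absurd hl (Nat.not_lt_zero _)
  | mul hw hi ih =>
    rw [toListCochain_wedge, Nat.add_mul_div_left _ _ two_pos, toListCochain_traceForm]
    exact ih.mul ((hD.vanishesOn_listCurvature_pow hD₀ _).map _)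

theorem Extends.traceMonomial_eq_zero (hD : D.Extends D₀) (hD₀ : D₀.IsFlat) {q : ℕ}
    (hq : B.rank + q = finrank ℝ FA) {l : ℕ} (hl : 2 * q < l) {w : L.Form l}
    (hw : D.IsTraceMonomial l w) : w = 0 := by
  classical
  obtain ⟨m, rfl⟩ := hw.even.two_dvd
  exact B.form_eq_zero hq (m := 2 * m / 2) (by omega) (hD.vanishesOn_traceMonomial hD₀ hw)

/-- At `x` the form is a multiple of the antisymmetrisation of a `2d`-linear map on the fibre, so it
can be tested on distinct vectors of an adapted basis. There each summand has a pair of arguments in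
`B`, on which the curvature is zero. -/
theorem Extends.polynomialForm_eq_zero (hD : D.Extends D₀) (hD₀ : D₀.IsFlat) {q : ℕ}
    (hq : B.rank + q = finrank ℝ FA) {d : ℕ} (hd : q < d)
    {p : MvPolynomial (Fin (finrank ℝ F) × Fin (finrank ℝ F)) ℝ} (hp : p.IsHomogeneous d)
    (a : Fin (2 * d) → Cₛ^∞⟮I; FA, A⟯) (x : M) (b : Basis (Fin (finrank ℝ F)) ℝ (V x)) :
    D.polynomialForm p a x b = 0 := by
  obtain ⟨e, S, hS, hSB⟩ := B.exists_adapted_basis hq x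
  obtain ⟨P, hP⟩ := exists_multilinear_eq_polarization hp
  have hreal : ∀ (c : ℝ) (v : A x), S (c • v) = algebraMap ℝ (SmoothFun I M) c • S v :=
    fun c v ↦ S.map_smul c v
  have hadd : ∀ φ χ : Module.End (SmoothFun I M) Cₛ^∞⟮I; F, V⟯,
      fibreMap x (φ + χ) = fibreMap x φ + fibreMap x χ := by
    intro φ χ
    ext v
    obtain ⟨s, rfl⟩ := exists_section_apply_eq (I := I) (F := F) x v
    simp [fibreMap_apply]
  have hsmul : ∀ (c : ℝ) (φ : Module.End (SmoothFun I M) Cₛ^∞⟮I; F, V⟯),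
      fibreMap x (algebraMap ℝ (SmoothFun I M) c • φ) = c • fibreMap x φ := by
    intro c φ
    ext v
    obtain ⟨s, rfl⟩ := exists_section_apply_eq (I := I) (F := F) x v
    rw [LinearMap.smul_apply, fibreMap_apply, fibreMap_apply]
    rfl
  let R : A x →ₗ[ℝ] A x →ₗ[ℝ] Matrix (Fin (finrank ℝ F)) (Fin (finrank ℝ F)) ℝ :=
    LinearMap.mk₂ ℝ (fun u v ↦ LinearMap.toMatrix b b (fibreMap x (D.curvatureEnd (S u) (S v))))
      (fun u u' v ↦ by rw [map_add, curvatureEnd_add_left, hadd, map_add])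
      (fun c u v ↦ by rw [hreal, curvatureEnd_smul_left, hsmul, map_smul])
      (fun u v v' ↦ by rw [map_add, curvatureEnd_add, hadd, map_add])
      (fun c u v ↦ by rw [hreal, curvatureEnd_smul, hsmul, map_smul])
  have hR : ∀ i j, R (e (Sum.inl i)) (e (Sum.inl j)) = 0 := by
    intro i j
    change LinearMap.toMatrix b b (fibreMap x (D.curvatureEnd _ _)) = 0
    rw [hD.curvatureEnd_eq_zero hD₀ (hSB i) (hSB j), ← zero_smul (SmoothFun I M) 0,
      ← map_zero (algebraMap ℝ (SmoothFun I M)), hsmul, zero_smul, map_zero]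
  have h0 : MultilinearMap.alternatization (P.compPairs R) = 0 := by
    refine Basis.ext_alternating e fun v hv ↦ ?_
    rw [MultilinearMap.alternatization_apply]
    refine Finset.sum_eq_zero fun σ _ ↦ ?_
    rw [MultilinearMap.domDomCongr_apply]
    -- Pigeonhole: otherwise each of the `d > q` pairs would contain a basis vector outside `B`, and
    -- these are distinct, while only `q` exist.
    have h1 : ∃ (i : Fin d) (j j' : Fin B.rank), v (σ ⟨2 * i, by omega⟩) = Sum.inl j ∧
        v (σ ⟨2 * i + 1, by omega⟩) = Sum.inl j' := by
      by_contra hne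
      have h2 : ∀ i : Fin d, ∃ (k : Fin (2 * d)) (t : Fin q), (k : ℕ) / 2 = i ∧
          v (σ k) = Sum.inr t := by
        intro i
        rcases h3 : v (σ ⟨2 * i, by omega⟩) with j | t
        · rcases h4 : v (σ ⟨2 * i + 1, by omega⟩) with j' | t
          · exact absurd ⟨i, j, j', h3, h4⟩ hne
          · exact ⟨_, t, by dsimp; omega, h4⟩
        · exact ⟨_, t, by dsimp; omega, h3⟩
      choose k t hk ht using h2
      have hinj : Function.Injective t := by
        intro i i' h
        have h5 : k i = k i' := σ.injective (hv (by rw [ht, ht, h]))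
        exact Fin.ext (by rw [← hk i, ← hk i', h5])
      have h6 := Fintype.card_le_of_injective t hinj
      rw [Fintype.card_fin, Fintype.card_fin] at h6
      omega
    obtain ⟨i, j, j', h2, h3⟩ := h1
    have h4 : P.compPairs R (fun i ↦ e (v (σ i))) = 0 := by
      refine P.map_coord_zero i ?_
      change R (e (v (σ _))) (e (v (σ _))) = 0
      rw [h2, h3, hR]
    rw [h4, smul_zero]
  have h1 := congrArg (fun u : A x [⋀^Fin (2 * d)]→ₗ[ℝ] ℝ ↦ u fun i ↦ a i x) h0
  change MultilinearMap.alternatization (P.compPairs R) (fun i ↦ a i x) = 0 at h1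
  rw [MultilinearMap.alternatization_apply] at h1
  refine mul_eq_zero_of_right _ (Eq.trans (Finset.sum_congr rfl fun σ _ ↦ ?_) h1)
  rw [MultilinearMap.domDomCongr_apply, ← hP, Units.smul_def, zsmul_eq_mul]
  congr 1
  change _ = P fun i : Fin d ↦ LinearMap.toMatrix b b (fibreMap x
      (D.curvatureEnd (S (a (σ ⟨2 * i, by omega⟩) x)) (S (a (σ ⟨2 * i + 1, by omega⟩) x))))
  congr 1
  ext1 i
  -- The curvature at `x` depends only on the values at `x`, so the given sections may be replaced
  -- by those that `S` assigns to their values.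
  rw [D.fibreMap_curvatureEnd_congr (hS _) (hS _)]

end LieAlgebroid.Connection

end Tensoriality

end

theorem mainTheorem3
    {EM : Type*} [NormedAddCommGroup EM] [NormedSpace ℝ EM] [FiniteDimensional ℝ EM]
    {H : Type*} [TopologicalSpace H] (I : ModelWithCorners ℝ EM H)
    {M : Type*} [TopologicalSpace M] [ChartedSpace H M] [IsManifold I ∞ M]
    [BoundarylessManifold I M] [T2Space M] [SigmaCompactSpace M]
    {FA : Type*} [NormedAddCommGroup FA] [NormedSpace ℝ FA] [FiniteDimensional ℝ FA]
    {A : M → Type*} [TopologicalSpace (TotalSpace FA A)]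
    [∀ x, AddCommGroup (A x)] [∀ x, Module ℝ (A x)] [∀ x, TopologicalSpace (A x)]
    [FiberBundle FA A] [VectorBundle ℝ FA A] [ContMDiffVectorBundle ∞ FA A I]
    {F : Type*} [NormedAddCommGroup F] [NormedSpace ℝ F] [FiniteDimensional ℝ F]
    {V : M → Type*} [TopologicalSpace (TotalSpace F V)]
    [∀ x, AddCommGroup (V x)] [∀ x, Module ℝ (V x)] [∀ x, TopologicalSpace (V x)]
    [FiberBundle F V] [VectorBundle ℝ F V] [ContMDiffVectorBundle ∞ F V I]
    (L : LieAlgebroid I FA A) (B : LieSubalgebroid L)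
    (q : ℕ) (hq : B.rank + q = finrank ℝ FA)
    (D₀ : B.Connection F V) (hD₀ : D₀.IsFlat) :
    (∃ D : L.Connection F V, D.Extends D₀) ∧
    (∀ D : L.Connection F V, D.Extends D₀ → ∀ d : ℕ, q < d →
      ∀ p : MvPolynomial (Fin (finrank ℝ F) × Fin (finrank ℝ F)) ℝ,
        p.IsHomogeneous d → IsInvariantPolynomial p →
        ∀ (a : Fin (2 * d) → Cₛ^∞⟮I; FA, A⟯) (x : M) (b : Basis (Fin (finrank ℝ F)) ℝ (V x)),
          D.polynomialForm p a x b = 0) ∧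
    (∀ D : L.Connection F V, D.Extends D₀ → ∀ l : ℕ, 2 * q < l →
      ∀ w : L.Form l, D.IsTraceMonomial l w → w = 0) ∧
    (∀ D : L.Connection F V, ∀ (l : ℕ) (w : L.Form l),
      D.IsTraceMonomial l w → w ∈ L.closedForms l) ∧
    ∀ l : ℕ, 2 * q < l → L.pontryaginSpace F V l = ⊥ := by
  obtain ⟨D₁, hD₁⟩ := D₀.exists_extension
  exact ⟨⟨D₁, hD₁⟩,
    fun D hD d hd p hp _ a x b ↦ hD.polynomialForm_eq_zero hD₀ hq hd hp a x b,
    fun D hD l hl w hw ↦ hD.traceMonomial_eq_zero hD₀ hq hl hw,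
    fun D l w hw ↦ hw.mem_closedForms,
    -- The extension `D₁` is the reference connection: its monomials are zero in this degree, so
    -- those of any other connection are exact.
    fun l hl ↦ LieAlgebroid.Connection.pontryaginSpace_eq_bot D₁ (by omega)
      fun w hw ↦ hD₁.traceMonomial_eq_zero hD₀ hq hl hw⟩
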